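/- Let $\ell\ge 0$ be an integer, $\mathbb{N}=\{0,1,2,\dots\}$, and let $\mathcal{H}_\ell=\ell_2(\mathbb{N}^\ell\times\mathbb{Z})=\ell_2(\mathbb{N})^{\otimes\ell}\otimes\ell_2(\mathbb{Z})$ with standard basis $(e_\gamma)$. Let $D_\ell$ be the self-adjoint operator $D_\ell e_\gamma=d(\gamma)e_\gamma$, where $d(\gamma)=\pm(\gamma_1+\cdots+\gamma_\ell+|\gamma_{\ell+1}|)$ with sign $+$ if $\gamma_{\ell+1}\ge 0$ and $-$ if $\gamma_{\ell+1}<0$. Define Fréchet algebras $\mathcal{A}_\ell^\infty$ of bounded operators on $\mathcal{H}_\ell$ with seminorms $\|\cdot\|_m$, $m\in\mathbb{N}$, recursively. $\mathcal{A}_0^\infty$ consists of the operators $\sum_{n\in\mathbb{Z}}a_n\mathbf{z}^n$ on $\ell_2(\mathbb{Z})$ with $\mathbf{z}e_k=e_{k+1}$ and $\|a\|_m=\sum_n(1+|n|)^m|a_n|<\infty$ for all $m$. For $\ell\ge1$ let $\alpha_1$ be the left shift ($e_0\mapsto0$, $e_k\mapsto e_{k-1}$ for $k\ge 1$) on the first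 factor $\ell_2(\mathbb{N})$ and $p_0$ the projection onto $e_0$ in this factor. Then $\mathcal{A}_\ell^\infty$ consists of the operators $$a=\sum_{j,k\ge0}\alpha_1^{*j}(p_0\otimes a_{jk})\alpha_1^k+\sum_{k\ge0}\lambda_k\alpha_1^k+\sum_{k>0}\lambda_{-k}\alpha_1^{*k}$$ with $a_{jk}\in\mathcal{A}_{\ell-1}^\infty$, $\lambda_k\in\mathbb{C}$ and $$\|a\|_m=\max_{r,s\le m}\sum_{j,k}(1+j+k)^r\|a_{jk}\|_s+\sum_{k\in\mathbb{Z}}(1+|k|)^m|\lambda_k|<\infty\quad\text{for all }m.$$ Let $\delta=[|D_\ell|,\cdot]$, whose domain consists of the bounded operators $T$ that leave $\mathrm{Dom}(|D_\ell|)$ invariant and for which $[|D_\ell|,T]$ extends to a bounded operator. Let $OP^0=\bigcap_n\mathrm{Dom}(\delta^n)$. Let $|D_\ell|^{-z}$ be taken to be $0$ on $\ker D_\ell$. Then: 1. $(\mathcal{A}_\ell^\infty,\mathcal{H}_\ell,D_\ell)$ is a spectral triple: $\mathcal{A}_\ell^\infty$ is a unital $*$-algebra of bounded operators, $D_\ell$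 is self-adjoint with compact resolvent, and $[D_\ell,a]$ extends to a bounded operator for every $a\in\mathcal{A}_\ell^\infty$. It is regular: $a\in OP^0$ and $[D_\ell,a]\in OP^0$ for all $a\in\mathcal{A}_\ell^\infty$. It is $(\ell+1)+$ summable: the sum of the first $N$ singular values of $|D_\ell|^{-(\ell+1)}$ is $O(\log N)$. 2. It has simple dimension spectrum $\{1,2,\dots,\ell+1\}$. That is, let $\mathcal{B}$ be the algebra generated by the operators $\delta^n(a)$ and $\delta^n([D_\ell,a])$ with $a\in\mathcal{A}_\ell^\infty$, $n\in\mathbb{N}$. For every $b\in\mathcal{B}$ the operator $b|D_\ell|^{-z}$ is of trace class for $\mathrm{Re}\,z>\ell+1$, and $z\mapsto\mathrm{Trace}(b|D_\ell|^{-z})$ extends to a meromorphic function on $\mathbb{C}$ all of whose poles are simple and lie in $\{1,2,\dots,\ell+1\}$. Moreover every point of $\{1,2,\dots,\ell+1\}$ is a pole of this function for some $b\in\mathcal{B}$. -/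

import Mathlib

open scoped ENNReal InnerProductSpace

noncomputable section

namespace TorusTriple

/-! ### The Hilbert spaces `ℓ₂(ι)` and some operators on them -/

/-- The Hilbert space `ℓ₂(ι)` of square summable complex families. -/
abbrev L2 (ι : Type) : Type := lp (fun _ : ι => ℂ) 2

section Operators

variable {ι κ : Type}

theorem memℓp_two_iff {f : ι → ℂ} : Memℓp f 2 ↔ Summable fun i => ‖f i‖ ^ 2 := by
  rw [memℓp_gen_iff (by norm_num)]
  norm_num

theorem memℓp_comp {f : ι → κ} (hf : Function.Injective f) (x : L2 κ) :
    Memℓp (fun i => x (f i)) 2 := by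
  have h : Memℓp (fun j => x j) 2 := lp.memℓp x
  rw [memℓp_two_iff] at h ⊢
  exact h.comp_injective hf

/-- For an injective map `f : ι → κ`, the contraction `ℓ₂(κ) → ℓ₂(ι)`, `x ↦ x ∘ f`. It maps the basis
vector `e_{f i}` to `e_i` and kills `e_j` when `j` is not in the range of `f`. -/
def pullback (f : ι → κ) (hf : Function.Injective f) : L2 κ →L[ℂ] L2 ι :=
  LinearMap.mkContinuous
    { toFun := fun x => ⟨fun i => x (f i), memℓp_comp hf x⟩
      map_add' := fun _ _ => rfl
      map_smul' := fun _ _ => rfl } 1 (by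
    intro x
    rw [one_mul]
    refine lp.norm_le_of_forall_sum_le (by norm_num) (norm_nonneg _) fun s => ?_
    have h := lp.sum_rpow_le_norm_rpow (p := 2) (by norm_num) x (s.map ⟨f, hf⟩)
    rw [Finset.sum_map] at h
    exact h)

@[simp] theorem pullback_apply (f : ι → κ) (hf : Function.Injective f) (x : L2 κ) (i : ι) :
    pullback f hf x i = x (f i) := rfl

theorem memℓp_mul {c : ι → ℂ} {C : ℝ} (hC : ∀ i, ‖c i‖ ≤ C) (x : L2 ι) :
    Memℓp (fun i => c i * x i) 2 := by
  have h : Memℓp (fun j => x j) 2 := lp.memℓp x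
  rw [memℓp_two_iff] at h ⊢
  refine Summable.of_nonneg_of_le (fun i => by positivity) (fun i => ?_) (h.mul_left (C ^ 2))
  rw [norm_mul, mul_pow]
  have := hC i
  gcongr

open Classical in
/-- The diagonal operator `e_i ↦ c_i e_i` as a bounded operator on `ℓ₂(ι)`, when the family `c` is
bounded; the zero operator by convention when `c` is unbounded. -/
def diagCLM (c : ι → ℂ) : L2 ι →L[ℂ] L2 ι :=
  if h : ∃ C : ℝ, ∀ i, ‖c i‖ ≤ C then
    LinearMap.mkContinuous
      { toFun := fun x => ⟨fun i => c i * x i, memℓp_mul h.choose_spec x⟩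
        map_add' := fun x y => lp.ext (funext fun i => mul_add (c i) (x i) (y i))
        map_smul' := fun a x => lp.ext (funext fun i => mul_left_comm (c i) a (x i)) }
      |h.choose| (by
      intro x
      refine lp.norm_le_of_forall_sum_le (by norm_num) (by positivity) fun s => ?_
      have h1 := lp.sum_rpow_le_norm_rpow (p := 2) (by norm_num) x s
      norm_num at h1 ⊢
      rw [mul_pow]
      refine le_trans ?_ (mul_le_mul_of_nonneg_left h1 (sq_nonneg _))
      rw [Finset.mul_sum]
      refine Finset.sum_le_sum fun i _ => ?_
      rw [mul_pow]
      have h2 := (h.choose_spec i).trans (le_abs_self _)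
      gcongr)
  else 0

theorem diagCLM_apply {c : ι → ℂ} {C : ℝ} (hC : ∀ i, ‖c i‖ ≤ C) (x : L2 ι) (i : ι) :
    diagCLM c x i = c i * x i := by
  rw [diagCLM, dif_pos ⟨C, hC⟩]
  rfl

/-- The (in general unbounded) diagonal operator `e_i ↦ d_i e_i` on its maximal domain
`{x ∈ ℓ₂(ι) | (d_i x_i)_i ∈ ℓ₂(ι)}`. -/
def diagOp (d : ι → ℝ) : L2 ι →ₗ.[ℂ] L2 ι where
  domain :=
    { carrier := {x | Memℓp (fun i => (d i : ℂ) * x i) 2}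
      add_mem' := by
        intro x y hx hy
        have h := Memℓp.add hx hy
        have he : (fun i => (d i : ℂ) * (x + y) i)
            = (fun i => (d i : ℂ) * x i) + fun i => (d i : ℂ) * y i :=
          funext fun i => mul_add (d i : ℂ) (x i) (y i)
        change Memℓp (fun i => (d i : ℂ) * (x + y) i) 2
        rw [he]
        exact h
      zero_mem' := by
        have he : (fun i => (d i : ℂ) * (0 : L2 ι) i) = 0 := funext fun i => mul_zero (d i : ℂ)
        change Memℓp (fun i => (d i : ℂ) * (0 : L2 ι) i) 2
        rw [he]
        exact zero_memℓp
      smul_mem' := by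
        intro a x hx
        have h := Memℓp.const_smul hx a
        have he : (fun i => (d i : ℂ) * (a • x) i) = a • fun i => (d i : ℂ) * x i :=
          funext fun i => mul_left_comm (d i : ℂ) a (x i)
        change Memℓp (fun i => (d i : ℂ) * (a • x) i) 2
        rw [he]
        exact h }
  toFun :=
    { toFun := fun x => ⟨fun i => (d i : ℂ) * (x : L2 ι) i, x.2⟩
      map_add' := fun x y => lp.ext (funext fun i => mul_add (d i : ℂ) _ _)
      map_smul' := fun a x => lp.ext (funext fun i => mul_left_comm (d i : ℂ) a _) }

end Operators

/-! ### Commutators with an unbounded operator, `OP⁰`, spectral triples -/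

section General

variable {H : Type} [NormedAddCommGroup H] [InnerProductSpace ℂ H]

/-- The bounded operator `X` leaves `Dom T` invariant, and the commutator `[T, X]`, defined on `Dom T`,
extends to the bounded operator `Y`. For densely defined `T` the operator `Y` is determined by `X`. -/
def IsCommutator (T : H →ₗ.[ℂ] H) (X Y : H →L[ℂ] H) : Prop :=
  ∀ x : T.domain, ∃ h : X x ∈ T.domain, T ⟨X x, h⟩ - X (T x) = Y x

/-- `X` is in the domain of `δⁿ`, where `δ = [T, ·]`, and `δⁿ(X) = Y`. -/
def IsIterCommutator (T : H →ₗ.[ℂ] H) : ℕ → (H →L[ℂ] H) → (H →L[ℂ] H) → Prop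
  | 0, X, Y => Y = X
  | n + 1, X, Y => ∃ Z, IsIterCommutator T n X Z ∧ IsCommutator T Z Y

/-- The intersection over `n` of the domains of `δⁿ`, where `δ = [T, ·]`. For `T = |D|` this
is `OP⁰`. -/
def OPZero (T : H →ₗ.[ℂ] H) : Set (H →L[ℂ] H) :=
  {X | ∀ n, ∃ Y, IsIterCommutator T n X Y}

/-- Some resolvent operator `R = (D - μ)⁻¹` exists as a bounded operator and is compact. -/
def HasCompactResolvent (D : H →ₗ.[ℂ] H) : Prop :=
  ∃ (μ : ℂ) (R : H →L[ℂ] H), IsCompactOperator R ∧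
    (∀ x : H, ∃ h : R x ∈ D.domain, D ⟨R x, h⟩ - μ • R x = x) ∧
    ∀ x : D.domain, R (D x - μ • (x : H)) = x

/-- `(A, H, D)` is a spectral triple: `A` is a unital `*`-algebra of bounded operators on `H`, `D` is a
self-adjoint operator with compact resolvent, and `[D, a]` is bounded for `a ∈ A`. -/
def IsSpectralTriple [CompleteSpace H] (A : Set (H →L[ℂ] H)) (D : H →ₗ.[ℂ] H) : Prop :=
  (∃ S : StarSubalgebra ℂ (H →L[ℂ] H), (S : Set (H →L[ℂ] H)) = A) ∧
    IsSelfAdjoint D ∧ HasCompactResolvent D ∧ ∀ a ∈ A, ∃ c, IsCommutator D a c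

/-- The `n`-th approximation number (singular value, counted from `n = 0`) of a bounded operator: its
distance to the operators of rank at most `n`. -/
def approxNumber (T : H →L[ℂ] H) (n : ℕ) : ℝ :=
  sInf {r | ∃ F : H →L[ℂ] H, (F : H →ₗ[ℂ] H).rank ≤ n ∧ r = ‖T - F‖}

/-- `T` belongs to the ideal `𝓛^(1,∞)` of Dixmier traceable operators: the sum of the first `N`
singular values is `O(log N)`. -/
def IsDixmierTraceable (T : H →L[ℂ] H) : Prop :=
  ∃ C : ℝ, ∀ N : ℕ, 2 ≤ N → ∑ n ∈ Finset.range N, approxNumber T n ≤ C * Real.log N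

/-- `T` is of trace class, i.e. `T = ∑ ⟨x_n, ·⟩ y_n` for vectors with `∑ ‖x_n‖ ‖y_n‖ < ∞`. -/
def IsTraceClass (T : H →L[ℂ] H) : Prop :=
  ∃ x y : ℕ → H, (Summable fun n => ‖x n‖ * ‖y n‖) ∧
    ∀ v : H, HasSum (fun n => ⟪x n, v⟫_ℂ • y n) (T v)

end General

/-! ### Regularity and dimension spectrum for a diagonal Dirac operator `D e_i = d_i e_i` -/

section Diagonal

variable {ι : Type}

/-- The trace of an operator on `ℓ₂(ι)`, computed in the standard basis. -/
def trace [DecidableEq ι] (T : L2 ι →L[ℂ] L2 ι) : ℂ :=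
  ∑' i, (T (lp.single 2 i (1 : ℂ))) i

/-- The operator `|D|` for `D = diag(d)`. -/
def absOp (d : ι → ℝ) : L2 ι →ₗ.[ℂ] L2 ι := diagOp fun i => |d i|

open Classical in
/-- The operator `|D|^{-z}` for `D = diag(d)`, taken to be zero on the kernel of `D`. -/
def absPow (d : ι → ℝ) (z : ℂ) : L2 ι →L[ℂ] L2 ι :=
  diagCLM fun i => if d i = 0 then 0 else ((|d i| : ℝ) : ℂ) ^ (-z)

/-- Regularity: `a` and `[D, a]` belong to `OP⁰` for all `a ∈ A`. -/
def IsRegular (A : Set (L2 ι →L[ℂ] L2 ι)) (d : ι → ℝ) : Prop :=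
  ∀ a ∈ A, a ∈ OPZero (absOp d) ∧ ∃ c, IsCommutator (diagOp d) a c ∧ c ∈ OPZero (absOp d)

/-- `D` is `p+` summable: `|D|^{-p}` is Dixmier traceable. -/
def IsPlusSummable (d : ι → ℝ) (p : ℝ) : Prop :=
  IsDixmierTraceable (absPow d p)

/-- The algebra generated by the operators `δⁿ(a)` and `δⁿ([D, a])` for `a ∈ A` and `n ∈ ℕ`, where
`δ = [|D|, ·]`. -/
def derivAlgebra (A : Set (L2 ι →L[ℂ] L2 ι)) (d : ι → ℝ) : Subalgebra ℂ (L2 ι →L[ℂ] L2 ι) :=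
  Algebra.adjoin ℂ {Y | ∃ a ∈ A, ∃ n, IsIterCommutator (absOp d) n a Y ∨
    ∃ c, IsCommutator (diagOp d) a c ∧ IsIterCommutator (absOp d) n c Y}

/-- The function `f`, meromorphic on `ℂ`, continues the function `z ↦ Trace(b |D|^{-z})`, initially
defined for `Re z > p`. -/
def IsZetaContinuation [DecidableEq ι] (d : ι → ℝ) (p : ℝ) (b : L2 ι →L[ℂ] L2 ι) (f : ℂ → ℂ) :
    Prop :=
  Meromorphic f ∧ ∀ z : ℂ, p < z.re → f z = trace (b * absPow d z)

/-- For all `b` in the algebra generated by the `δⁿ(a)` and `δⁿ([D, a])`, `a ∈ A`, the operator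
`b |D|^{-z}` is of trace class for `Re z > p`, and its trace extends to a meromorphic function on `ℂ`
that has only simple poles, all in the discrete set `Σ`. Every point of `Σ` is such a pole for
some `b`. -/
def HasSimpleDimensionSpectrum [DecidableEq ι] (A : Set (L2 ι →L[ℂ] L2 ι)) (d : ι → ℝ) (p : ℝ)
    (Sigma : Set ℂ) : Prop :=
  IsDiscrete Sigma ∧
    (∀ b ∈ derivAlgebra A d,
      (∀ z : ℂ, p < z.re → IsTraceClass (b * absPow d z)) ∧
      ∃ f, IsZetaContinuation d p b f ∧
        ∀ s, meromorphicOrderAt f s < 0 → s ∈ Sigma ∧ meromorphicOrderAt f s = (-1 : ℤ)) ∧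
    ∀ s ∈ Sigma, ∃ b ∈ derivAlgebra A d, ∃ f, IsZetaContinuation d p b f ∧
      meromorphicOrderAt f s < 0

end Diagonal

/-! ### The torus equivariant spectral triple -/

/-- The index set `ℕ^ℓ × ℤ`. -/
abbrev Idx (ℓ : ℕ) : Type := (Fin ℓ → ℕ) × ℤ

/-- The Hilbert space `ℓ₂(ℕ^ℓ × ℤ) = ℓ₂(ℕ)^{⊗ℓ} ⊗ ℓ₂(ℤ)`. -/
abbrev Hil (ℓ : ℕ) : Type := L2 (Idx ℓ)

/-- The eigenvalues of the Dirac operator `D_ℓ`: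
`d(γ) = ±(γ₁ + ⋯ + γ_ℓ + |γ_{ℓ+1}|)`, with sign `+` if `γ_{ℓ+1} ≥ 0` and `-` if `γ_{ℓ+1} < 0`. -/
def dirac (ℓ : ℕ) (γ : Idx ℓ) : ℝ :=
  if 0 ≤ γ.2 then (∑ i, (γ.1 i : ℝ)) + |(γ.2 : ℝ)| else -((∑ i, (γ.1 i : ℝ)) + |(γ.2 : ℝ)|)

/-- The operator `𝐳ⁿ` on `ℓ₂(ℤ)`, `e_k ↦ e_{k+n}`, for an integer `n`. -/
def zPow (n : ℤ) : Hil 0 →L[ℂ] Hil 0 :=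
  pullback (fun γ => (γ.1, γ.2 - n)) (by
    rintro ⟨g, k⟩ ⟨g', k'⟩ h
    simp only [Prod.mk.injEq] at h
    exact Prod.ext h.1 (by have := h.2; dsimp only; omega))

/-- The left shift `α₁` on the first tensor factor: `e_{(k, γ)} ↦ e_{(k-1, γ)}` for `k ≥ 1`
and `e_{(0, γ)} ↦ 0`. -/
def alpha (ℓ : ℕ) : Hil (ℓ + 1) →L[ℂ] Hil (ℓ + 1) :=
  pullback (fun γ => (Fin.cons (γ.1 0 + 1) (Fin.tail γ.1), γ.2)) (by
    rintro ⟨g, k⟩ ⟨g', k'⟩ h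
    simp only [Prod.mk.injEq, Fin.cons_inj, add_left_inj] at h
    refine Prod.ext ?_ h.2
    dsimp only
    rw [← Fin.cons_self_tail g, ← Fin.cons_self_tail g', h.1.1, h.1.2])

/-- The co-isometry `H_{ℓ+1} → H_ℓ`, `e_{(0, γ)} ↦ e_γ` and `e_{(k, γ)} ↦ 0` for `k ≥ 1`. -/
def slice (ℓ : ℕ) : Hil (ℓ + 1) →L[ℂ] Hil ℓ :=
  pullback (fun γ => (Fin.cons 0 γ.1, γ.2)) (by
    rintro ⟨g, k⟩ ⟨g', k'⟩ h
    simp only [Prod.mk.injEq, Fin.cons_inj, true_and] at h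
    exact Prod.ext h.1 h.2)

/-- The operator `p₀ ⊗ a`, where `p₀` is the projection onto `e_0 ∈ ℓ₂(ℕ)`. -/
def pTensor {ℓ : ℕ} (a : Hil ℓ →L[ℂ] Hil ℓ) : Hil (ℓ + 1) →L[ℂ] Hil (ℓ + 1) :=
  (ContinuousLinearMap.adjoint (slice ℓ)).comp (a.comp (slice ℓ))

/-- `α₁^k` for `k ≥ 0` and `(α₁*)^{-k}` for `k < 0`. -/
def alphaPow (ℓ : ℕ) (k : ℤ) : Hil (ℓ + 1) →L[ℂ] Hil (ℓ + 1) :=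
  if 0 ≤ k then alpha ℓ ^ k.toNat else star (alpha ℓ) ^ (-k).toNat

/-- The coefficients in the expansion of an element of `𝓐_ℓ^∞`: Fourier coefficients for `ℓ = 0`; in
the recursion step a double sequence of coefficients `a_{jk}` of the previous level and a bi-infinite
sequence of numbers `λ_k`. -/
def Coeff : ℕ → Type
  | 0 => ℤ → ℂ
  | ℓ + 1 => (ℕ → ℕ → Coeff ℓ) × (ℤ → ℂ)

/-- The weighted sum `∑_{k ∈ ℤ} (1 + |k|)^m |λ_k|`. -/
def seqNorm (m : ℕ) (lam : ℤ → ℂ) : ℝ≥0∞ :=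
  ∑' k : ℤ, (1 + (k.natAbs : ℝ≥0∞)) ^ m * ‖lam k‖ₑ

/-- The `m`-th seminorm. For `ℓ = 0` it is `∑ (1 + |n|)^m |a_n|`, and in the recursion step it is
`max_{r, s ≤ m} ∑_{j,k} (1 + j + k)^r ‖a_{jk}‖_s + ∑_k (1 + |k|)^m |λ_k|`. -/
def seminorm : (ℓ : ℕ) → ℕ → Coeff ℓ → ℝ≥0∞
  | 0, m, c => seqNorm m c
  | ℓ + 1, m, c =>
    (⨆ r ∈ Finset.range (m + 1), ⨆ s ∈ Finset.range (m + 1),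
      ∑' jk : ℕ × ℕ, (1 + (jk.1 : ℝ≥0∞) + jk.2) ^ r * seminorm ℓ s (c.1 jk.1 jk.2)) +
    seqNorm m c.2

/-- The operator with given coefficients: `∑ a_n 𝐳ⁿ` for `ℓ = 0`, and
`∑_{j,k} (α₁*)^j (p₀ ⊗ a_{jk}) α₁^k + ∑_{k ≥ 0} λ_k α₁^k + ∑_{k > 0} λ_{-k} (α₁*)^k` in the recursion
step. For coefficients with finite seminorms all sums converge absolutely in operator norm. -/
def realize : (ℓ : ℕ) → Coeff ℓ → (Hil ℓ →L[ℂ] Hil ℓ)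
  | 0, c => ∑' n : ℤ, (c n : ℂ) • zPow n
  | ℓ + 1, c =>
    ∑' jk : ℕ × ℕ,
      star (alpha ℓ) ^ jk.1 * pTensor (realize ℓ (c.1 jk.1 jk.2)) * alpha ℓ ^ jk.2 +
    ∑' k : ℤ, (c.2 k : ℂ) • alphaPow ℓ k

/-- The smooth function algebra `𝓐_ℓ^∞`: all operators whose coefficients have finite seminorms. -/
def smoothAlgebra (ℓ : ℕ) : Set (Hil ℓ →L[ℂ] Hil ℓ) :=
  {a | ∃ c : Coeff ℓ, (∀ m, seminorm ℓ m c < ∞) ∧ realize ℓ c = a}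

end TorusTriple

end

/-! Everything is read off from matrices in the standard basis. Call a matrix rapid in the direction
of a weight `v` if its entry at `(x, y)` is `O((1 + v(x) + |x - y|)^{-N})` for every `N`; for `v =
0` this is rapid decay off the diagonal. Since weights are nonnegative and 1-Lipschitz, adjoints of
matrices rapid for `v` are rapid for `v`, and so are products in which one factor is rapid for `v`
and the other for `0`.

The smooth algebra has an intrinsic description (`mem_smoothAlgebra_iff`). Blocked along the first
coordinate, an element is a rapidly decreasing array of smooth slices plus a Toeplitz part `λ_{j-i}`
times the identity. Iterating this gives the conditions of `IsSmooth`: the commutator with the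
`p`-th coordinate decays in the preceding ones, the failure of invariance under the `i`-th shift
decays in the coordinates up to `i`, and the shift of `ℤ` acts trivially. Conversely `λ_n` is the
limit along the `n`-th diagonal, and subtracting it leaves the slices. These conditions survive
products and adjoints, which yields the `*`-algebra.

The larger class `IsAsympInvariant` asks only that the failure of invariance in each direction decay
in that one coordinate. It is an algebra, stable under `[|D|, ·]`. It contains the commutators `[D,
a]`: with `F` the sign of `D`, `[D, a] = F [|D|, a] + [F, a] |D|`, and `[F, a] |D|` decays in all
directions. Regularity follows, and all of the algebra generated by the `δⁿ(a)` and `δⁿ([D, a])`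
lies in this class.

For the zeta functions only the diagonal entries matter. Their difference in direction `p`, taken
away from the origin, is rapid in the `p`-th coordinate, so differencing once in each of the `ℓ + 1`
directions leaves a rapidly decreasing function. On sums over the spheres `|x| = n` each of these
differences acts as the difference in `n`. Summing back `ℓ + 1` times (`hasExpansion_of_rapidIn`),
the sphere sums are a polynomial of degree at most `ℓ` plus a rapid sequence, so the zeta function
is a combination of `ζ(z - j)`, `j ≤ ℓ`, plus an entire function. The pole at `k + 1` occurs for `p₀
⊗ ⋯ ⊗ p₀ ⊗ 1`, with the identity on `H_k`: its sphere sums count the spheres of `ℕ^k × ℤ`, which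
grow exactly like `n^k`.

Compact resolvent and summability come from counting lattice points in boxes. -/

noncomputable section

namespace TorusTriple

set_option linter.unusedSectionVars false

/-! ### Matrices of operators on `ℓ₂(ι)` -/

section Matrices

variable {ι κ : Type} [DecidableEq ι] [DecidableEq κ]

/-- The basis vector `e_i` of `ℓ₂(ι)`. -/
def basisVec (i : ι) : L2 ι := lp.single 2 i (1 : ℂ)

theorem basisVec_apply (i j : ι) : basisVec i j = if j = i then 1 else 0 := by
  rw [basisVec, lp.single_apply, Pi.single_apply]

theorem norm_basisVec (i : ι) : ‖basisVec i‖ = 1 := by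
  rw [basisVec, lp.norm_single (by norm_num), norm_one]

theorem hasSum_basisVec (v : L2 ι) : HasSum (fun i => v i • basisVec i) v := by
  have h := lp.hasSum_single (p := 2) (by norm_num) v
  convert h using 2 with i
  rw [basisVec, ← lp.single_smul, smul_eq_mul, mul_one]

theorem inner_basisVec (i : ι) (v : L2 ι) : ⟪basisVec i, v⟫_ℂ = v i := by
  rw [basisVec, lp.inner_single_left]
  simp

theorem norm_apply_le (v : L2 ι) (i : ι) : ‖v i‖ ≤ ‖v‖ :=
  lp.norm_apply_le_norm (by norm_num) v i

/-- Evaluation at a coordinate as a continuous linear functional. -/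
def coordCLM (i : ι) : L2 ι →L[ℂ] ℂ := innerSL ℂ (basisVec i)

theorem coordCLM_apply (i : ι) (v : L2 ι) : coordCLM i v = v i := by
  rw [coordCLM, innerSL_apply_apply, inner_basisVec]

/-- The matrix of an operator with respect to the standard basis. -/
def mat (T : L2 ι →L[ℂ] L2 κ) (x : κ) (y : ι) : ℂ := T (basisVec y) x

theorem mat_hasSum (T : L2 ι →L[ℂ] L2 κ) (v : L2 ι) (x : κ) :
    HasSum (fun y => mat T x y * v y) (T v x) := by
  have h := (hasSum_basisVec v).mapL ((coordCLM x).comp T)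
  simp only [ContinuousLinearMap.comp_apply, coordCLM_apply, map_smul, smul_eq_mul] at h
  convert h using 2 with y
  rw [mul_comm, mat]

theorem mat_injective {S T : L2 ι →L[ℂ] L2 κ} (h : ∀ x y, mat S x y = mat T x y) : S = T := by
  ext v x
  refine (mat_hasSum S v x).unique ?_
  simp only [h]
  exact mat_hasSum T v x

theorem norm_mat_le (T : L2 ι →L[ℂ] L2 κ) (x : κ) (y : ι) : ‖mat T x y‖ ≤ ‖T‖ := by
  refine (norm_apply_le _ x).trans ((T.le_opNorm _).trans ?_)
  rw [norm_basisVec, mul_one]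

theorem mat_add (S T : L2 ι →L[ℂ] L2 κ) (x : κ) (y : ι) :
    mat (S + T) x y = mat S x y + mat T x y := rfl

theorem mat_sub (S T : L2 ι →L[ℂ] L2 κ) (x : κ) (y : ι) :
    mat (S - T) x y = mat S x y - mat T x y := rfl

theorem mat_smul (a : ℂ) (T : L2 ι →L[ℂ] L2 κ) (x : κ) (y : ι) :
    mat (a • T) x y = a * mat T x y := rfl

theorem mat_one (x y : ι) : mat (1 : L2 ι →L[ℂ] L2 ι) x y = if x = y then 1 else 0 :=
  basisVec_apply y x

theorem mat_mul_hasSum (S T : L2 ι →L[ℂ] L2 ι) (x y : ι) :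
    HasSum (fun z => mat S x z * mat T z y) (mat (S * T) x y) :=
  mat_hasSum S (T (basisVec y)) x

theorem mat_star (T : L2 ι →L[ℂ] L2 ι) (x y : ι) : mat (star T) x y = star (mat T y x) := by
  rw [mat, ← inner_basisVec, ContinuousLinearMap.star_eq_adjoint,
    ContinuousLinearMap.adjoint_inner_right, ← inner_conj_symm, inner_basisVec]
  rfl

/-- The matrix of a sum of operators is the sum of the matrices. -/
theorem mat_tsum {α : Type} {F : α → (L2 ι →L[ℂ] L2 κ)} (hF : Summable F) (x : κ) (y : ι) :
    HasSum (fun a => mat (F a) x y) (mat (∑' a, F a) x y) := by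
  have h := hF.hasSum.mapL ((coordCLM x).comp (ContinuousLinearMap.apply ℂ (L2 κ) (basisVec y)))
  simpa only [ContinuousLinearMap.comp_apply, coordCLM_apply] using! h

theorem mat_pullback (f : ι → κ) (hf : Function.Injective f) (x : ι) (y : κ) :
    mat (pullback f hf) x y = if f x = y then 1 else 0 :=
  basisVec_apply y (f x)

theorem norm_pullback_le (f : ι → κ) (hf : Function.Injective f) : ‖pullback f hf‖ ≤ 1 :=
  LinearMap.mkContinuous_norm_le _ zero_le_one _

theorem adjoint_pullback_apply (f : ι → κ) (hf : Function.Injective f) (i : ι) :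
    ContinuousLinearMap.adjoint (pullback f hf) (basisVec i) = basisVec (f i) := by
  ext j
  rw [← inner_basisVec, ContinuousLinearMap.adjoint_inner_right, ← inner_conj_symm,
    inner_basisVec, pullback_apply, basisVec_apply, basisVec_apply]
  by_cases h : f i = j
  · simp [h]
  · rw [if_neg h, if_neg (fun h' => h h'.symm), map_zero]

/-- Conjugation by the coisometry `pullback f` reindexes the matrix. -/
theorem mat_conj_pullback (f : ι → ι) (hf : Function.Injective f) (T : L2 ι →L[ℂ] L2 ι) (x y : ι) :
    mat (pullback f hf * T * star (pullback f hf)) x y = mat T (f x) (f y) := by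
  change T (ContinuousLinearMap.adjoint (pullback f hf) (basisVec y)) (f x) = _
  rw [adjoint_pullback_apply]
  rfl

theorem pullback_mul_star (f : ι → ι) (hf : Function.Injective f) :
    pullback f hf * star (pullback f hf) = 1 := by
  refine mat_injective fun x y => ?_
  have := mat_conj_pullback f hf 1 x y
  rw [mul_one] at this
  rw [this, mat_one, mat_one]
  simp only [hf.eq_iff]

theorem mat_star_pullback_mul (f : ι → ι) (hf : Function.Injective f) (x y : ι) [Decidable (∃ z, f z = x)] :
    mat (star (pullback f hf) * pullback f hf) x y = if x = y ∧ ∃ z, f z = x then 1 else 0 := by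
  refine (mat_mul_hasSum _ _ x y).unique ?_
  simp only [mat_star, mat_pullback]
  by_cases h : x = y ∧ ∃ z, f z = x
  · obtain ⟨rfl, z, rfl⟩ := h
    rw [if_pos ⟨rfl, z, rfl⟩]
    convert hasSum_ite_eq z (1 : ℂ) using 2 with w
    by_cases hw : w = z
    · simp [hw]
    · simp [hw, hf.eq_iff]
  · rw [if_neg h]
    convert hasSum_zero using 2 with z
    by_cases h1 : f z = x
    · have : f z ≠ y := fun h2 => h ⟨h1.symm.trans h2, z, h1⟩
      simp [this]
    · simp [h1]

theorem mat_diagCLM {c : ι → ℂ} {C : ℝ} (hC : ∀ i, ‖c i‖ ≤ C) (x y : ι) :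
    mat (diagCLM c) x y = if x = y then c x else 0 := by
  rw [mat, diagCLM_apply hC, basisVec_apply]
  simp

theorem mat_mul_diagCLM {c : ι → ℂ} {C : ℝ} (hC : ∀ i, ‖c i‖ ≤ C) (T : L2 ι →L[ℂ] L2 ι) (x y : ι) :
    mat (T * diagCLM c) x y = mat T x y * c y := by
  refine (mat_mul_hasSum _ _ x y).unique ?_
  simp only [mat_diagCLM hC]
  convert hasSum_ite_eq y (mat T x y * c y) using 2 with z
  by_cases h : z = y
  · subst h; simp
  · simp [h]

theorem norm_diagCLM_le {c : ι → ℂ} {C : ℝ} (hC0 : 0 ≤ C) (hC : ∀ i, ‖c i‖ ≤ C) : ‖diagCLM c‖ ≤ C := by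
  refine ContinuousLinearMap.opNorm_le_bound _ hC0 fun v => ?_
  refine lp.norm_le_of_forall_sum_le (by norm_num) (by positivity) fun s => ?_
  have h1 := lp.sum_rpow_le_norm_rpow (p := 2) (by norm_num) v s
  norm_num at h1 ⊢
  rw [mul_pow]
  refine le_trans ?_ (mul_le_mul_of_nonneg_left h1 (sq_nonneg _))
  rw [Finset.mul_sum]
  refine Finset.sum_le_sum fun i _ => ?_
  rw [diagCLM_apply hC, norm_mul, mul_pow]
  have := hC i
  gcongr

/-- Schur's test: a matrix with uniformly summable rows and columns is the matrix of a bounded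
operator. -/
theorem exists_mat_eq {t : ι → ι → ℂ} {C : ℝ} (hr : ∀ x, Summable fun y => ‖t x y‖)
    (hrC : ∀ x, ∑' y, ‖t x y‖ ≤ C) (hc : ∀ (s : Finset ι) y, ∑ x ∈ s, ‖t x y‖ ≤ C) :
    ∃ T : L2 ι →L[ℂ] L2 ι, ∀ x y, mat T x y = t x y := by
  rcases isEmpty_or_nonempty ι with hι | ⟨⟨x₀⟩⟩
  · exact ⟨0, fun x => hι.elim x⟩
  have hC0 : 0 ≤ C := (tsum_nonneg fun _ => norm_nonneg _).trans (hrC x₀)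
  have sq (v : L2 ι) : HasSum (fun y => ‖v y‖ ^ 2) (‖v‖ ^ 2) := by
    have := lp.hasSum_norm (p := 2) (by norm_num) v
    simpa using this
  have htb (x y : ι) : ‖t x y‖ ≤ C := ((hr x).le_tsum y fun _ _ => norm_nonneg _).trans (hrC x)
  have hs2 (v : L2 ι) (x : ι) : Summable fun y => ‖t x y‖ * ‖v y‖ ^ 2 :=
    Summable.of_nonneg_of_le (fun y => by positivity)
      (fun y => mul_le_mul_of_nonneg_right (htb x y) (by positivity)) ((sq v).summable.mul_left C)
  have hs1 (v : L2 ι) (x : ι) : Summable fun y => ‖t x y * v y‖ := by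
    refine Summable.of_nonneg_of_le (fun y => norm_nonneg _) (fun y => ?_) ((hr x).add (hs2 v x))
    rw [norm_mul]
    nlinarith [norm_nonneg (t x y), sq_nonneg (‖v y‖ - 1), mul_nonneg (norm_nonneg (t x y)) (sq_nonneg (‖v y‖ - 1))]
  -- Cauchy–Schwarz with respect to the weights `‖t x y‖` of the row `x`; the row bound `C` accounts
  -- for one factor, and the column bound is used when summing over `x`.
  have cs (v : L2 ι) (x : ι) :
      ‖∑' y, t x y * v y‖ ^ 2 ≤ C * ∑' y, ‖t x y‖ * ‖v y‖ ^ 2 := by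
    have h1 : ‖∑' y, t x y * v y‖ ≤ ∑' y, ‖t x y * v y‖ := norm_tsum_le_tsum_norm (hs1 v x)
    have h2 : (∑' y, ‖t x y * v y‖) ^ 2 ≤ C * ∑' y, ‖t x y‖ * ‖v y‖ ^ 2 := by
      refine le_of_tendsto ((hs1 v x).hasSum.pow 2) (Filter.Eventually.of_forall fun s => ?_)
      have h3 : (∑ y ∈ s, ‖t x y * v y‖) ^ 2 ≤
          (∑ y ∈ s, ‖t x y‖) * ∑ y ∈ s, ‖t x y‖ * ‖v y‖ ^ 2 := by
        refine Finset.sum_sq_le_sum_mul_sum_of_sq_le_mul _ (fun _ _ => norm_nonneg _)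
          (fun _ _ => by positivity) fun y _ => le_of_eq ?_
        rw [norm_mul]; ring
      refine h3.trans (mul_le_mul (((hr x).sum_le_tsum s fun _ _ => norm_nonneg _).trans (hrC x))
        ((hs2 v x).sum_le_tsum s fun _ _ => by positivity)
        (Finset.sum_nonneg fun _ _ => by positivity) hC0)
    exact (pow_le_pow_left₀ (norm_nonneg _) h1 2).trans h2
  have bd (v : L2 ι) (s : Finset ι) :
      ∑ x ∈ s, ‖∑' y, t x y * v y‖ ^ 2 ≤ C ^ 2 * ‖v‖ ^ 2 := by
    calc ∑ x ∈ s, ‖∑' y, t x y * v y‖ ^ 2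
        ≤ ∑ x ∈ s, C * ∑' y, ‖t x y‖ * ‖v y‖ ^ 2 := Finset.sum_le_sum fun x _ => cs v x
      _ = C * ∑' y, (∑ x ∈ s, ‖t x y‖) * ‖v y‖ ^ 2 := by
          rw [← Finset.mul_sum, ← Summable.tsum_finsetSum fun x _ => hs2 v x]
          simp only [Finset.sum_mul]
      _ ≤ C * (C * ‖v‖ ^ 2) := by
          refine mul_le_mul_of_nonneg_left ?_ hC0
          rw [← (sq v).tsum_eq, ← tsum_mul_left]
          have hle (y : ι) : (∑ x ∈ s, ‖t x y‖) * ‖v y‖ ^ 2 ≤ C * ‖v y‖ ^ 2 :=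
            mul_le_mul_of_nonneg_right (hc s y) (by positivity)
          exact Summable.tsum_le_tsum hle (Summable.of_nonneg_of_le
            (fun y => by positivity) hle ((sq v).summable.mul_left C)) ((sq v).summable.mul_left C)
      _ = C ^ 2 * ‖v‖ ^ 2 := by ring
  have hmem (v : L2 ι) : Memℓp (fun x => ∑' y, t x y * v y) 2 := by
    rw [memℓp_two_iff]
    exact summable_of_sum_le (fun _ => by positivity) (bd v)
  let T : L2 ι →L[ℂ] L2 ι := LinearMap.mkContinuous
    { toFun := fun v => ⟨fun x => ∑' y, t x y * v y, hmem v⟩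
      map_add' := fun v w => lp.ext (funext fun x => by
        change ∑' y, t x y * (v y + w y) = ∑' y, t x y * v y + ∑' y, t x y * w y
        rw [← (hs1 v x).of_norm.tsum_add (hs1 w x).of_norm]
        simp only [mul_add])
      map_smul' := fun a v => lp.ext (funext fun x => by
        change ∑' y, t x y * (a * v y) = a * ∑' y, t x y * v y
        rw [← tsum_mul_left]
        simp only [mul_left_comm]) } C (by
    intro v
    refine lp.norm_le_of_forall_sum_le (by norm_num) (by positivity) fun s => ?_
    have := bd v s
    norm_num
    rw [mul_pow]
    exact this)
  refine ⟨T, fun x y => ?_⟩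
  change ∑' z, t x z * basisVec y z = t x y
  simp only [basisVec_apply, mul_ite, mul_one, mul_zero, tsum_ite_eq]

end Matrices

/-! ### Commutators with diagonal operators -/

section Commutators

variable {ι : Type} [DecidableEq ι]

theorem basisVec_mem_domain (d : ι → ℝ) (y : ι) : basisVec y ∈ (diagOp d).domain := by
  change Memℓp (fun i => (d i : ℂ) * basisVec y i) 2
  have h : (fun i => (d i : ℂ) * basisVec y i) = fun i => (((d y : ℂ) • basisVec y : L2 ι)) i := by
    ext i
    change _ = (d y : ℂ) * basisVec y i
    rw [basisVec_apply]
    split_ifs with h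
    · rw [h]
    · simp
  rw [h]
  exact lp.memℓp _

theorem diagOp_apply (d : ι → ℝ) (v : (diagOp d).domain) (x : ι) :
    (diagOp d v) x = (d x : ℂ) * (v : L2 ι) x := rfl

/-- This turns every question about unbounded commutators into an entrywise identity. In the
converse direction the domain condition is automatic: coordinatewise `d · Xv = Yv + X(d · v)`, and
the right side is square summable. -/
theorem isCommutator_diagOp_iff (d : ι → ℝ) (X Y : L2 ι →L[ℂ] L2 ι) :
    IsCommutator (diagOp d) X Y ↔ ∀ x y, mat Y x y = ((d x : ℂ) - d y) * mat X x y := by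
  constructor
  · intro h x y
    obtain ⟨h1, h2⟩ := h ⟨basisVec y, basisVec_mem_domain d y⟩
    have h3 := congrArg (fun v : L2 ι => v x) h2
    change (d x : ℂ) * mat X x y - X (diagOp d ⟨basisVec y, basisVec_mem_domain d y⟩) x = mat Y x y at h3
    have h4 : diagOp d ⟨basisVec y, basisVec_mem_domain d y⟩ = (d y : ℂ) • basisVec y := by
      ext i
      change (d i : ℂ) * basisVec y i = (d y : ℂ) * basisVec y i
      rw [basisVec_apply]
      split_ifs with h
      · rw [h]
      · simp
    rw [h4, map_smul] at h3
    change (d x : ℂ) * mat X x y - d y * mat X x y = mat Y x y at h3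
    rw [← h3]; ring
  · intro h v
    have key (x : ι) : (d x : ℂ) * (X (v : L2 ι)) x = (Y (v : L2 ι) + X (diagOp d v)) x := by
      have h1 := (mat_hasSum Y (v : L2 ι) x).add (mat_hasSum X (diagOp d v) x)
      have h2 := (mat_hasSum X (v : L2 ι) x).mul_left (d x : ℂ)
      have e : (fun y => (d x : ℂ) * (mat X x y * (v : L2 ι) y))
          = fun y => mat Y x y * (v : L2 ι) y + mat X x y * diagOp d v y := by
        ext y
        rw [h, diagOp_apply]; ring
      rw [e] at h2
      exact h2.unique h1
    have hm : X (v : L2 ι) ∈ (diagOp d).domain := by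
      change Memℓp (fun x => (d x : ℂ) * (X (v : L2 ι)) x) 2
      simp only [key]
      exact lp.memℓp _
    refine ⟨hm, ?_⟩
    ext x
    change (d x : ℂ) * (X (v : L2 ι)) x - X (diagOp d v) x = Y v x
    rw [key]
    change Y v x + X (diagOp d v) x - X (diagOp d v) x = Y v x
    ring

end Commutators

/-! ### Rapidly decreasing matrices on `ℕ^ℓ × ℤ` -/

section Rapid

variable {ℓ : ℕ}

/-- The `ℓ₁`-distance of two indices. -/
def offd (x y : Idx ℓ) : ℝ := ∑ i, |(x.1 i : ℝ) - y.1 i| + |(x.2 : ℝ) - y.2|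

/-- The `ℓ₁`-norm of an index. -/
def nrm (x : Idx ℓ) : ℝ := ∑ i, (x.1 i : ℝ) + |(x.2 : ℝ)|

/-- The coordinates of an index; `none` stands for the integer coordinate. -/
def co : Option (Fin ℓ) → Idx ℓ → ℝ
  | some i, x => x.1 i
  | none, x => x.2

theorem offd_nonneg (x y : Idx ℓ) : 0 ≤ offd x y := by unfold offd; positivity

theorem nrm_nonneg (x : Idx ℓ) : 0 ≤ nrm x := by unfold nrm; positivity

theorem offd_self (x : Idx ℓ) : offd x x = 0 := by simp [offd]

theorem offd_comm (x y : Idx ℓ) : offd x y = offd y x := by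
  unfold offd
  simp only [abs_sub_comm]

theorem offd_triangle (x y z : Idx ℓ) : offd x z ≤ offd x y + offd y z := by
  unfold offd
  have h1 : ∑ i, |(x.1 i : ℝ) - z.1 i| ≤ ∑ i, |(x.1 i : ℝ) - y.1 i| + ∑ i, |(y.1 i : ℝ) - z.1 i| := by
    rw [← Finset.sum_add_distrib]
    exact Finset.sum_le_sum fun i _ => abs_sub_le _ _ _
  have h2 := abs_sub_le (x.2 : ℝ) y.2 z.2
  linarith

theorem abs_co_sub_le (p : Option (Fin ℓ)) (x y : Idx ℓ) : |co p x - co p y| ≤ offd x y := by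
  have h0 : ∀ i, 0 ≤ |(x.1 i : ℝ) - y.1 i| := fun i => abs_nonneg _
  cases p with
  | none => exact le_add_of_nonneg_left (Finset.sum_nonneg fun i _ => h0 i)
  | some i =>
    exact (Finset.single_le_sum (fun i _ => h0 i) (Finset.mem_univ i)).trans
      (le_add_of_nonneg_right (abs_nonneg _))

theorem abs_co_le_nrm (p : Option (Fin ℓ)) (x : Idx ℓ) : |co p x| ≤ nrm x := by
  have h0 : ∀ i, 0 ≤ (x.1 i : ℝ) := fun i => by positivity
  cases p with
  | none => exact le_add_of_nonneg_left (Finset.sum_nonneg fun i _ => h0 i)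
  | some i =>
    change |(x.1 i : ℝ)| ≤ _
    rw [abs_of_nonneg (h0 i)]
    exact (Finset.single_le_sum (fun i _ => h0 i) (Finset.mem_univ i)).trans
      (le_add_of_nonneg_right (abs_nonneg _))

theorem abs_nrm_sub_le (x y : Idx ℓ) : |nrm x - nrm y| ≤ offd x y := by
  unfold nrm offd
  have h1 : |∑ i, (x.1 i : ℝ) - ∑ i, (y.1 i : ℝ)| ≤ ∑ i, |(x.1 i : ℝ) - y.1 i| := by
    rw [← Finset.sum_sub_distrib]
    exact Finset.abs_sum_le_sum_abs _ _
  have h2 := abs_abs_sub_abs_le (x.2 : ℝ) y.2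
  rw [abs_le] at *
  constructor <;> linarith [h1.1, h1.2, h2.1, h2.2]

/-- A weight: a nonnegative `1`-Lipschitz function on the index set. -/
structure IsWeight (v : Idx ℓ → ℝ) : Prop where
  nonneg : ∀ x, 0 ≤ v x
  lip : ∀ x y, v x ≤ v y + offd x y

theorem isWeight_zero : IsWeight (0 : Idx ℓ → ℝ) where
  nonneg _ := le_rfl
  lip x y := by simpa using offd_nonneg x y

theorem isWeight_nrm : IsWeight (nrm : Idx ℓ → ℝ) where
  nonneg := nrm_nonneg
  lip x y := by linarith [(abs_le.1 (abs_nrm_sub_le x y)).2]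

theorem isWeight_co (p : Option (Fin ℓ)) : IsWeight fun x : Idx ℓ => |co p x| where
  nonneg x := abs_nonneg _
  lip x y := by linarith [abs_sub_abs_le_abs_sub (co p x) (co p y), abs_co_sub_le p x y]

theorem isWeight_sum (s : Finset (Fin ℓ)) : IsWeight fun x : Idx ℓ => ∑ i ∈ s, (x.1 i : ℝ) where
  nonneg x := by positivity
  lip x y := by
    have h1 : ∑ i ∈ s, (x.1 i : ℝ) ≤ ∑ i ∈ s, (y.1 i : ℝ) + ∑ i ∈ s, |(x.1 i : ℝ) - y.1 i| := by
      rw [← Finset.sum_add_distrib]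
      exact Finset.sum_le_sum fun i _ => by linarith [le_abs_self ((x.1 i : ℝ) - y.1 i)]
    have h2 : ∑ i ∈ s, |(x.1 i : ℝ) - y.1 i| ≤ ∑ i, |(x.1 i : ℝ) - y.1 i| :=
      Finset.sum_le_sum_of_subset_of_nonneg (Finset.subset_univ s) fun i _ _ => abs_nonneg _
    have h3 := abs_nonneg ((x.2 : ℝ) - y.2)
    unfold offd
    linarith

/-- The bound `‖t x y‖ (1 + v x + |x - y|)^N ≤ C`. -/
def RapidAt (v : Idx ℓ → ℝ) (N : ℕ) (C : ℝ) (t : Idx ℓ → Idx ℓ → ℂ) : Prop :=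
  ∀ x y, ‖t x y‖ * (1 + v x + offd x y) ^ N ≤ C

/-- The matrix `t` decreases rapidly away from the diagonal and in direction of the weight `v`. -/
def Rapid (v : Idx ℓ → ℝ) (t : Idx ℓ → Idx ℓ → ℂ) : Prop := ∀ N, ∃ C, RapidAt v N C t

variable {v w : Idx ℓ → ℝ} {t s r : Idx ℓ → Idx ℓ → ℂ}

theorem RapidAt.nonneg (hv : IsWeight v) {N : ℕ} {C : ℝ} (h : RapidAt v N C t) : 0 ≤ C := by
  refine le_trans ?_ (h (0, 0) (0, 0))
  have := hv.nonneg ((0, 0) : Idx ℓ)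
  have := offd_nonneg ((0, 0) : Idx ℓ) (0, 0)
  positivity

theorem Rapid.exists_nonneg (hv : IsWeight v) (h : Rapid v t) (N : ℕ) : ∃ C, 0 ≤ C ∧ RapidAt v N C t := by
  obtain ⟨C, hC⟩ := h N
  exact ⟨C, hC.nonneg hv, hC⟩

/-- A matrix that is bounded by a rapidly decreasing one up to polynomial factors. -/
theorem Rapid.of_le (hv : IsWeight v) (h : Rapid v t) {K : ℝ} (hK : 0 ≤ K) (k : ℕ)
    (hs : ∀ x y, ‖s x y‖ ≤ K * (‖t x y‖ * (1 + v x + offd x y) ^ k)) : Rapid v s := by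
  intro N
  obtain ⟨C, hC⟩ := h (k + N)
  refine ⟨K * C, fun x y => ?_⟩
  have h0 : 0 ≤ 1 + v x + offd x y := by linarith [hv.nonneg x, offd_nonneg x y]
  calc ‖s x y‖ * (1 + v x + offd x y) ^ N
      ≤ K * (‖t x y‖ * (1 + v x + offd x y) ^ k) * (1 + v x + offd x y) ^ N :=
        mul_le_mul_of_nonneg_right (hs x y) (by positivity)
    _ = K * (‖t x y‖ * (1 + v x + offd x y) ^ (k + N)) := by ring
    _ ≤ K * C := mul_le_mul_of_nonneg_left (hC x y) hK

theorem Rapid.of_norm_le (hv : IsWeight v) (h : Rapid v t) (hs : ∀ x y, ‖s x y‖ ≤ ‖t x y‖) :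
    Rapid v s :=
  h.of_le hv zero_le_one 0 fun x y => by simpa using hs x y

theorem Rapid.mono (hw : IsWeight w) (h : Rapid v t) (hwv : ∀ x, w x ≤ v x) : Rapid w t := by
  intro N
  obtain ⟨C, hC⟩ := h N
  refine ⟨C, fun x y => le_trans ?_ (hC x y)⟩
  have h0 : 0 ≤ 1 + w x + offd x y := by linarith [hw.nonneg x, offd_nonneg x y]
  have := hwv x
  gcongr

theorem Rapid.zero_weight (hv : IsWeight v) (h : Rapid v t) : Rapid 0 t :=
  h.mono isWeight_zero hv.nonneg

theorem rapid_zero (v : Idx ℓ → ℝ) : Rapid v (fun _ _ => 0) := fun _ => ⟨0, fun x y => by simp⟩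

theorem Rapid.add (hv : IsWeight v) (ht : Rapid v t) (hs : Rapid v s) :
    Rapid v fun x y => t x y + s x y := by
  intro N
  obtain ⟨C, hC⟩ := ht N
  obtain ⟨C', hC'⟩ := hs N
  refine ⟨C + C', fun x y => le_trans ?_ (add_le_add (hC x y) (hC' x y))⟩
  have h0 : 0 ≤ 1 + v x + offd x y := by linarith [hv.nonneg x, offd_nonneg x y]
  rw [← add_mul]
  have := norm_add_le (t x y) (s x y)
  gcongr

theorem Rapid.smul (hv : IsWeight v) (ht : Rapid v t) (a : ℂ) : Rapid v fun x y => a * t x y :=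
  ht.of_le hv (norm_nonneg a) 0 fun x y => by simp

theorem Rapid.sub (hv : IsWeight v) (ht : Rapid v t) (hs : Rapid v s) :
    Rapid v fun x y => t x y - s x y := by
  have := ht.add hv (hs.of_norm_le hv (s := fun x y => - s x y) fun x y => by simp)
  simpa only [sub_eq_add_neg] using this

/-- The weight sits on the row index, but the Lipschitz condition moves it to the column index at
the cost of a factor 2. -/
theorem Rapid.star (hv : IsWeight v) (ht : Rapid v t) : Rapid v fun x y => star (t y x) := by
  intro N
  obtain ⟨C, hC0, hC⟩ := ht.exists_nonneg hv N
  refine ⟨2 ^ N * C, fun x y => ?_⟩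
  have h0 : 0 ≤ 1 + v x + offd x y := by linarith [hv.nonneg x, offd_nonneg x y]
  have h1 : 1 + v x + offd x y ≤ 2 * (1 + v y + offd y x) := by
    linarith [hv.lip x y, hv.nonneg y, offd_comm x y, offd_nonneg x y]
  calc ‖Star.star (t y x)‖ * (1 + v x + offd x y) ^ N
      ≤ ‖t y x‖ * (2 * (1 + v y + offd y x)) ^ N := by rw [norm_star]; gcongr
    _ = 2 ^ N * (‖t y x‖ * (1 + v y + offd y x) ^ N) := by rw [mul_pow]; ring
    _ ≤ 2 ^ N * C := mul_le_mul_of_nonneg_left (hC y x) (by positivity)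

/-- Decay in two directions. -/
theorem Rapid.add_weight (hv : IsWeight v) (hw : IsWeight w) (ht : Rapid v t) (ht' : Rapid w t) :
    Rapid (fun x => v x + w x) t := by
  intro N
  obtain ⟨C, hC⟩ := ht N
  obtain ⟨C', hC'⟩ := ht' N
  refine ⟨2 ^ N * max C C', fun x y => ?_⟩
  have hv0 := hv.nonneg x
  have hw0 := hw.nonneg x
  have ho := offd_nonneg x y
  rcases le_total (v x) (w x) with h | h
  · calc ‖t x y‖ * (1 + (v x + w x) + offd x y) ^ N
        ≤ ‖t x y‖ * (2 * (1 + w x + offd x y)) ^ N := by gcongr; linarith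
      _ = 2 ^ N * (‖t x y‖ * (1 + w x + offd x y) ^ N) := by rw [mul_pow]; ring
      _ ≤ 2 ^ N * max C C' :=
        mul_le_mul_of_nonneg_left ((hC' x y).trans (le_max_right _ _)) (by positivity)
  · calc ‖t x y‖ * (1 + (v x + w x) + offd x y) ^ N
        ≤ ‖t x y‖ * (2 * (1 + v x + offd x y)) ^ N := by gcongr; linarith
      _ = 2 ^ N * (‖t x y‖ * (1 + v x + offd x y) ^ N) := by rw [mul_pow]; ring
      _ ≤ 2 ^ N * max C C' :=
        mul_le_mul_of_nonneg_left ((hC x y).trans (le_max_left _ _)) (by positivity)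

/-! ### Lattice sums and products of rapid matrices -/

theorem exists_sum_int_le : ∃ G : ℝ, 0 ≤ G ∧ ∀ (a : ℤ) (s : Finset ℤ),
    ∑ n ∈ s, ((1 + |(a : ℝ) - n|) ^ 2)⁻¹ ≤ G := by
  have hs : Summable fun n : ℤ => ((1 + |(n : ℝ)|) ^ 2)⁻¹ := by
    have h1 : Summable fun n : ℤ => 1 / |(n : ℝ)| ^ 2 := by
      simpa using! (Real.summable_one_div_int_pow (p := 2)).2 (by norm_num)
    have h2 : Summable fun n : ℤ => if n = 0 then (1 : ℝ) else 0 :=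
      (hasSum_ite_eq 0 1).summable
    refine Summable.of_nonneg_of_le (fun n => by positivity) (fun n => ?_) (h1.add h2)
    by_cases hn : n = 0
    · simp [hn]
    · have : 0 < |(n : ℝ)| := abs_pos.2 (by exact_mod_cast hn)
      rw [if_neg hn, add_zero, one_div]
      gcongr
      linarith
  refine ⟨∑' n : ℤ, ((1 + |(n : ℝ)|) ^ 2)⁻¹, tsum_nonneg fun n => by positivity, fun a s => ?_⟩
  have h := hs.sum_le_tsum (s.map ⟨fun n => a - n, sub_right_injective⟩) fun n _ => by positivity
  rw [Finset.sum_map] at h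
  simpa using h

/-- The distance dominates each of the `ℓ + 1` coordinate differences, so the power `2(ℓ + 1)`
dominates a product of squares, and the sum factors into one-dimensional sums bounded uniformly in
the centre. -/
theorem exists_sum_offd_le (ℓ : ℕ) : ∃ K : ℝ, 0 ≤ K ∧ ∀ (x : Idx ℓ) (s : Finset (Idx ℓ)),
    ∑ z ∈ s, ((1 + offd x z) ^ (2 * (ℓ + 1)))⁻¹ ≤ K := by
  obtain ⟨G, hG0, hG⟩ := exists_sum_int_le
  refine ⟨G ^ ℓ * G, by positivity, fun x s => ?_⟩
  let f (z : Idx ℓ) : ℝ := (∏ i, ((1 + |(x.1 i : ℝ) - z.1 i|) ^ 2)⁻¹) * ((1 + |(x.2 : ℝ) - z.2|) ^ 2)⁻¹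
  have hle (z : Idx ℓ) : ((1 + offd x z) ^ (2 * (ℓ + 1)))⁻¹ ≤ f z := by
    have h1 : ∏ i, ((1 + |(x.1 i : ℝ) - z.1 i|) ^ 2) ≤ ∏ i : Fin ℓ, (1 + offd x z) ^ 2 := by
      refine Finset.prod_le_prod (fun i _ => by positivity) fun i _ => ?_
      have := abs_co_sub_le (some i) x z
      simp only [co] at this
      gcongr
    have h2 : (1 + |(x.2 : ℝ) - z.2|) ^ 2 ≤ (1 + offd x z) ^ 2 := by
      have := abs_co_sub_le none x z
      simp only [co] at this
      gcongr
    have h3 : (1 + offd x z) ^ (2 * (ℓ + 1)) = (∏ i : Fin ℓ, (1 + offd x z) ^ 2) * (1 + offd x z) ^ 2 := by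
      rw [Finset.prod_const, Finset.card_univ, Fintype.card_fin, ← pow_mul]; ring
    simp only [f]
    rw [Finset.prod_inv_distrib, ← mul_inv, h3]
    have h4 : 0 < ∏ i, ((1 + |(x.1 i : ℝ) - z.1 i|) ^ 2) :=
      Finset.prod_pos fun i _ => by positivity
    have := offd_nonneg x z
    gcongr
  classical
  let S (i : Fin ℓ) : Finset ℕ := s.image fun z => z.1 i
  let S' : Finset ℤ := s.image fun z => z.2
  have hsub : s ⊆ Fintype.piFinset S ×ˢ S' := by
    intro z hz
    rw [Finset.mem_product, Fintype.mem_piFinset]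
    exact ⟨fun i => Finset.mem_image_of_mem _ hz, Finset.mem_image_of_mem _ hz⟩
  calc ∑ z ∈ s, ((1 + offd x z) ^ (2 * (ℓ + 1)))⁻¹ ≤ ∑ z ∈ s, f z := Finset.sum_le_sum fun z _ => hle z
    _ ≤ ∑ z ∈ Fintype.piFinset S ×ˢ S', f z :=
        Finset.sum_le_sum_of_subset_of_nonneg hsub fun z _ _ => by
          simp only [f]
          exact mul_nonneg (Finset.prod_nonneg fun i _ => by positivity) (by positivity)
    _ = (∏ i, ∑ n ∈ S i, ((1 + |(x.1 i : ℝ) - n|) ^ 2)⁻¹) * ∑ n ∈ S', ((1 + |(x.2 : ℝ) - n|) ^ 2)⁻¹ := by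
        rw [Finset.prod_univ_sum, Finset.sum_product, Finset.sum_mul_sum]
    _ ≤ G ^ ℓ * G := by
        have h1 : ∏ i, ∑ n ∈ S i, ((1 + |(x.1 i : ℝ) - n|) ^ 2)⁻¹ ≤ ∏ i : Fin ℓ, G := by
          refine Finset.prod_le_prod (fun i _ => Finset.sum_nonneg fun n _ => by positivity) fun i _ => ?_
          have := hG (x.1 i) ((S i).map Nat.castEmbedding)
          rw [Finset.sum_map] at this
          simpa using this
        rw [Finset.prod_const, Finset.card_univ, Fintype.card_fin] at h1
        exact mul_le_mul h1 (hG _ _) (Finset.sum_nonneg fun n _ => by positivity) (by positivity)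

/-- A common estimate for the two multiplication lemmas. -/
theorem exists_norm_hasSum_le (ℓ : ℕ) : ∃ K : ℝ, 0 ≤ K ∧ ∀ (x : Idx ℓ) (f : Idx ℓ → ℂ) (a : ℂ) (B : ℝ),
    0 ≤ B → HasSum f a → (∀ z, ‖f z‖ * (1 + offd x z) ^ (2 * (ℓ + 1)) ≤ B) → ‖a‖ ≤ B * K := by
  obtain ⟨K, hK0, hK⟩ := exists_sum_offd_le ℓ
  refine ⟨K, hK0, fun x f a B hB hf h => ?_⟩
  refine le_of_tendsto hf.norm (Filter.Eventually.of_forall fun s => ?_)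
  calc ‖∑ z ∈ s, f z‖ ≤ ∑ z ∈ s, ‖f z‖ := norm_sum_le _ _
    _ ≤ ∑ z ∈ s, B * ((1 + offd x z) ^ (2 * (ℓ + 1)))⁻¹ := by
        refine Finset.sum_le_sum fun z _ => ?_
        have := offd_nonneg x z
        rw [← div_eq_mul_inv, le_div_iff₀ (by positivity)]
        exact h z
    _ = B * ∑ z ∈ s, ((1 + offd x z) ^ (2 * (ℓ + 1)))⁻¹ := by rw [Finset.mul_sum]
    _ ≤ B * K := mul_le_mul_of_nonneg_left (hK x s) hB

/-- The inequality `1 + v(x) + |x - y| ≤ (1 + v(x) + |x - z|)(1 + |z - y|)` distributes the weight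
over the two factors; the surplus power `2(ℓ + 1)` on the first one makes the sum over `z` converge.
-/
theorem Rapid.mul_right (hv : IsWeight v) (ht : Rapid v t) (hr : Rapid 0 r)
    (h : ∀ x y, HasSum (fun z => t x z * r z y) (s x y)) : Rapid v s := by
  intro N
  obtain ⟨K, hK0, hK⟩ := exists_norm_hasSum_le ℓ
  obtain ⟨C, hC0, hC⟩ := ht.exists_nonneg hv (N + 2 * (ℓ + 1))
  obtain ⟨C', hC'0, hC'⟩ := hr.exists_nonneg isWeight_zero N
  refine ⟨C * C' * K, fun x y => ?_⟩
  have hw := hv.nonneg x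
  have h1 := (h x y).mul_right (((1 + v x + offd x y) ^ N : ℝ) : ℂ)
  have h2 := hK x _ _ (C * C') (by positivity) h1 fun z => ?_
  · rw [norm_mul, Complex.norm_real, Real.norm_eq_abs, abs_of_nonneg] at h2
    · exact h2
    · have := offd_nonneg x y
      positivity
  have o1 := offd_nonneg x y
  have o2 := offd_nonneg x z
  have o3 := offd_nonneg z y
  have o4 := offd_triangle x z y
  rw [norm_mul, norm_mul, Complex.norm_real, Real.norm_eq_abs, abs_of_nonneg (by positivity)]
  have h3 : 1 + v x + offd x y ≤ (1 + v x + offd x z) * (1 + (0 : Idx ℓ → ℝ) z + offd z y) := by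
    simp only [Pi.zero_apply]
    nlinarith [mul_nonneg hw o3, mul_nonneg o2 o3]
  calc ‖t x z‖ * ‖r z y‖ * (1 + v x + offd x y) ^ N * (1 + offd x z) ^ (2 * (ℓ + 1))
      ≤ ‖t x z‖ * ‖r z y‖ * ((1 + v x + offd x z) * (1 + (0 : Idx ℓ → ℝ) z + offd z y)) ^ N
          * (1 + v x + offd x z) ^ (2 * (ℓ + 1)) := by
        have hz : 0 ≤ (1 + v x + offd x z) * (1 + (0 : Idx ℓ → ℝ) z + offd z y) := by
          simp only [Pi.zero_apply]; positivity
        have h4 : 1 + offd x z ≤ 1 + v x + offd x z := by linarith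
        gcongr
    _ = (‖t x z‖ * (1 + v x + offd x z) ^ (N + 2 * (ℓ + 1)))
          * (‖r z y‖ * (1 + (0 : Idx ℓ → ℝ) z + offd z y) ^ N) := by rw [mul_pow]; ring
    _ ≤ C * C' := mul_le_mul (hC x z) (hC' z y) (by simp only [Pi.zero_apply]; positivity) hC0

theorem Rapid.mul_left (hv : IsWeight v) (ht : Rapid 0 t) (hr : Rapid v r)
    (h : ∀ x y, HasSum (fun z => t x z * r z y) (s x y)) : Rapid v s := by
  have h1 : Rapid v fun y x => Star.star (s x y) := by
    refine Rapid.mul_right hv (hr.star hv) (ht.star isWeight_zero) fun y x => ?_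
    have := (h x y).star
    simpa only [star_mul', mul_comm] using! this
  have h2 := h1.star hv
  simpa only [star_star] using h2

/-- The operator with a given rapidly decreasing matrix. -/
theorem Rapid.exists_mat_eq (h : Rapid 0 t) : ∃ T : Hil ℓ →L[ℂ] Hil ℓ, ∀ x y, mat T x y = t x y := by
  obtain ⟨K, hK0, hK⟩ := exists_sum_offd_le ℓ
  obtain ⟨C, hC0, hC⟩ := h.exists_nonneg isWeight_zero (2 * (ℓ + 1))
  have hle (x y : Idx ℓ) : ‖t x y‖ ≤ C * ((1 + offd x y) ^ (2 * (ℓ + 1)))⁻¹ := by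
    have := offd_nonneg x y
    rw [← div_eq_mul_inv, le_div_iff₀ (by positivity)]
    simpa using hC x y
  have hrow (x : Idx ℓ) (s : Finset (Idx ℓ)) : ∑ y ∈ s, ‖t x y‖ ≤ C * K :=
    (Finset.sum_le_sum fun y _ => hle x y).trans (by
      rw [← Finset.mul_sum]
      exact mul_le_mul_of_nonneg_left (hK x s) hC0)
  have hcol (s : Finset (Idx ℓ)) (y : Idx ℓ) : ∑ x ∈ s, ‖t x y‖ ≤ C * K :=
    (Finset.sum_le_sum fun x _ => hle x y).trans (by
      simp only [offd_comm _ y]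
      rw [← Finset.mul_sum]
      exact mul_le_mul_of_nonneg_left (hK y s) hC0)
  have hsum (x : Idx ℓ) : Summable fun y => ‖t x y‖ :=
    summable_of_sum_le (fun _ => norm_nonneg _) (hrow x)
  exact TorusTriple.exists_mat_eq hsum (fun x => (hsum x).tsum_le_of_sum_le (hrow x)) hcol

end Rapid

/-! ### Asymptotically shift invariant operators -/

section Shifts

variable {ℓ : ℕ} {v w : Idx ℓ → ℝ} {t s : Idx ℓ → Idx ℓ → ℂ}

/-- Where the matrix does not vanish, the new weight is controlled by the old one and the distance
to the diagonal, so decay already known suffices. This exploits operators living near a wall: edge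
projections, and sign changes across zero. -/
theorem Rapid.of_support (hv : IsWeight v) (hw : IsWeight w) (h : Rapid v t) {K : ℝ} (hK : 0 ≤ K)
    (hs : ∀ x y, t x y ≠ 0 → w x ≤ K * (1 + v x + offd x y)) : Rapid w t := by
  intro N
  obtain ⟨C, hC0, hC⟩ := h.exists_nonneg hv N
  refine ⟨(K + 1) ^ N * C, fun x y => ?_⟩
  by_cases h0 : t x y = 0
  · rw [h0, norm_zero, zero_mul]; positivity
  have h1 := hs x y h0
  have h2 := hw.nonneg x
  have h3 := hv.nonneg x
  have h4 := offd_nonneg x y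
  calc ‖t x y‖ * (1 + w x + offd x y) ^ N ≤ ‖t x y‖ * ((K + 1) * (1 + v x + offd x y)) ^ N := by
        gcongr; linarith
    _ = (K + 1) ^ N * (‖t x y‖ * (1 + v x + offd x y) ^ N) := by rw [mul_pow]; ring
    _ ≤ (K + 1) ^ N * C := mul_le_mul_of_nonneg_left (hC x y) (by positivity)

theorem Rapid.op_mul_right (hv : IsWeight v) {S T : Hil ℓ →L[ℂ] Hil ℓ} (hS : Rapid v (mat S))
    (hT : Rapid 0 (mat T)) : Rapid v (mat (S * T)) :=
  hS.mul_right hv hT (mat_mul_hasSum S T)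

theorem Rapid.op_mul_left (hv : IsWeight v) {S T : Hil ℓ →L[ℂ] Hil ℓ} (hS : Rapid 0 (mat S))
    (hT : Rapid v (mat T)) : Rapid v (mat (S * T)) :=
  hS.mul_left hv hT (mat_mul_hasSum S T)

theorem Rapid.op_star (hv : IsWeight v) {T : Hil ℓ →L[ℂ] Hil ℓ} (hT : Rapid v (mat T)) :
    Rapid v (mat (Star.star T)) := by
  have := hT.star hv
  simpa only [← mat_star] using! this

theorem rapid_diag {c : Idx ℓ → ℂ} {C : ℝ} (hC : ∀ x, ‖c x‖ ≤ C) : Rapid 0 (mat (diagCLM c)) := by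
  refine fun N => ⟨max C 0, fun x y => ?_⟩
  rw [mat_diagCLM hC]
  split_ifs with h
  · subst h
    simpa [offd_self] using Or.inl (hC x)
  · simp

theorem rapid_one : Rapid 0 (mat (1 : Hil ℓ →L[ℂ] Hil ℓ)) := by
  refine fun N => ⟨1, fun x y => ?_⟩
  rw [mat_one]
  split_ifs with h
  · subst h; simp [offd_self]
  · simp

/-- The shift of an index by one in direction of a coordinate. -/
def sh : Option (Fin ℓ) → Idx ℓ → Idx ℓ
  | some i, x => (Function.update x.1 i (x.1 i + 1), x.2)
  | none, x => (x.1, x.2 + 1)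

theorem co_injective {x y : Idx ℓ} (h : ∀ p, co p x = co p y) : x = y := by
  refine Prod.ext (funext fun i => ?_) ?_
  · have := h (some i)
    simpa [co] using this
  · have := h none
    simpa [co] using this

theorem co_sh (p q : Option (Fin ℓ)) (x : Idx ℓ) : co q (sh p x) = co q x + if q = p then 1 else 0 := by
  cases p with
  | none => cases q <;> simp [co, sh]
  | some i =>
    cases q with
    | none => simp [co, sh]
    | some j =>
      by_cases h : j = i
      · subst h; simp [co, sh]
      · simp [co, sh, h]

theorem sh_injective (p : Option (Fin ℓ)) : Function.Injective (sh p) := by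
  intro x y h
  refine co_injective fun q => ?_
  have := congrArg (co q) h
  rw [co_sh, co_sh] at this
  linarith

theorem offd_eq_sum (x y : Idx ℓ) : offd x y = ∑ p, |co p x - co p y| := by
  rw [Fintype.sum_option, add_comm]; rfl

theorem nrm_eq_sum (x : Idx ℓ) : nrm x = ∑ p, |co p x| := by
  rw [Fintype.sum_option, add_comm]
  simp [nrm, co]

theorem offd_sh_le (p : Option (Fin ℓ)) (x : Idx ℓ) : offd x (sh p x) ≤ 1 := by
  rw [offd_eq_sum]
  simp only [co_sh]
  rw [Finset.sum_eq_single p]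
  · simp
  · intro q _ hq; simp [hq]
  · simp

theorem nrm_sh_some (i : Fin ℓ) (x : Idx ℓ) : nrm (sh (some i) x) = nrm x + 1 := by
  have h0 (p : Option (Fin ℓ)) : |co p (sh (some i) x)| = |co p x| + if p = some i then 1 else 0 := by
    rw [co_sh]
    split_ifs with h
    · subst h
      have : 0 ≤ co (some i) x := by simp [co]
      rw [abs_of_nonneg this, abs_of_nonneg (by linarith)]
    · simp
  simp only [nrm_eq_sum, h0, Finset.sum_add_distrib, Finset.sum_ite_eq', Finset.mem_univ, if_true]

theorem nrm_sh_none (x : Idx ℓ) : nrm (sh none x) = nrm x + if 0 ≤ x.2 then 1 else -1 := by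
  simp only [nrm, sh, add_assoc]
  congr 1
  push_cast
  split_ifs with h
  · have h' : (0 : ℝ) ≤ x.2 := by exact_mod_cast h
    rw [abs_of_nonneg h', abs_of_nonneg (by linarith)]
  · have h' : (x.2 : ℝ) + 1 ≤ 0 := by exact_mod_cast (by omega : x.2 + 1 ≤ 0)
    rw [abs_of_nonpos h', abs_of_nonpos (by linarith)]; ring

/-- The backward shift in direction of a coordinate. -/
def shiftOp (p : Option (Fin ℓ)) : Hil ℓ →L[ℂ] Hil ℓ := pullback (sh p) (sh_injective p)

theorem mat_conj_shiftOp (p : Option (Fin ℓ)) (T : Hil ℓ →L[ℂ] Hil ℓ) (x y : Idx ℓ) :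
    mat (shiftOp p * T * star (shiftOp p)) x y = mat T (sh p x) (sh p y) :=
  mat_conj_pullback _ _ T x y

theorem shiftOp_mul_star (p : Option (Fin ℓ)) : shiftOp p * star (shiftOp p) = 1 :=
  pullback_mul_star _ _

theorem rapid_shiftOp (p : Option (Fin ℓ)) : Rapid 0 (mat (shiftOp p)) := by
  refine fun N => ⟨2 ^ N, fun x y => ?_⟩
  rw [shiftOp, mat_pullback]
  split_ifs with h
  · have h1 := offd_sh_le p x
    rw [h] at h1
    have h2 := offd_nonneg x y
    rw [norm_one, one_mul, Pi.zero_apply]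
    gcongr
    linarith
  · simp

theorem rapid_conj_shiftOp (hv : IsWeight v) (p : Option (Fin ℓ)) {T : Hil ℓ →L[ℂ] Hil ℓ}
    (hT : Rapid v (mat T)) : Rapid v (mat (shiftOp p * T * star (shiftOp p))) :=
  ((rapid_shiftOp p).op_mul_left hv hT).op_mul_right hv ((rapid_shiftOp p).op_star isWeight_zero)

/-- The projection onto the kernel of the shift in direction of a coordinate. -/
def edgeProj (i : Fin ℓ) : Hil ℓ →L[ℂ] Hil ℓ := diagCLM fun x => if x.1 i = 0 then 1 else 0

theorem edge_le (i : Fin ℓ) (x : Idx ℓ) : ‖(if x.1 i = 0 then 1 else 0 : ℂ)‖ ≤ 1 := by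
  split_ifs <;> simp

theorem star_shiftOp_mul_some (i : Fin ℓ) :
    star (shiftOp (some i)) * shiftOp (some i) = 1 - edgeProj i := by
  classical
  refine mat_injective fun x y => ?_
  rw [shiftOp, mat_star_pullback_mul, mat_sub, mat_one, edgeProj, mat_diagCLM (edge_le i)]
  have h : (∃ z, sh (some i) z = x) ↔ x.1 i ≠ 0 := by
    constructor
    · rintro ⟨z, rfl⟩
      simp [sh]
    · intro h
      refine ⟨(Function.update x.1 i (x.1 i - 1), x.2), Prod.ext ?_ rfl⟩
      simp only [sh, Function.update_self, Function.update_idem]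
      rw [Nat.sub_add_cancel (Nat.pos_of_ne_zero h), Function.update_eq_self]
  rw [h]
  by_cases hxy : x = y <;> by_cases hx : x.1 i = 0 <;> simp [hxy, hx]
  · subst hxy; simp [hx]
  · subst hxy; simp [hx]

theorem star_shiftOp_mul_none : star (shiftOp (none : Option (Fin ℓ))) * shiftOp none = 1 := by
  classical
  refine mat_injective fun x y => ?_
  rw [shiftOp, mat_star_pullback_mul, mat_one]
  have h : ∃ z : Idx ℓ, sh none z = x := ⟨(x.1, x.2 - 1), Prod.ext rfl (by simp [sh])⟩
  simp [h]

theorem rapid_edgeProj (i : Fin ℓ) : Rapid (fun x => |co (some i) x|) (mat (edgeProj i)) := by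
  refine (rapid_diag (edge_le i)).of_support isWeight_zero (isWeight_co _) zero_le_one fun x y h => ?_
  rw [edgeProj, mat_diagCLM (edge_le i)] at h
  have h0 : x.1 i = 0 := by
    by_contra h'
    simp [h'] at h
  have := offd_nonneg x y
  simp only [co, h0, Pi.zero_apply]
  norm_num
  linarith

/-- In a natural direction the shift `S` is only a coisometry, with `S*S = 1 - e` for the edge
projection `e`, so conjugation by `S` is not multiplicative. The last summand is the defect; it
passes through the wall where the coordinate vanishes. -/
theorem shift_mul_some (i : Fin ℓ) (T R : Hil ℓ →L[ℂ] Hil ℓ) :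
    shiftOp (some i) * (T * R) * star (shiftOp (some i)) - T * R =
      (shiftOp (some i) * T * star (shiftOp (some i)) - T)
          * (shiftOp (some i) * R * star (shiftOp (some i)))
        + T * (shiftOp (some i) * R * star (shiftOp (some i)) - R)
        + shiftOp (some i) * T * edgeProj i * (R * star (shiftOp (some i))) := by
  have h : edgeProj i = 1 - star (shiftOp (some i)) * shiftOp (some i) := by
    rw [star_shiftOp_mul_some]; abel
  rw [h]
  noncomm_ring

/-- The shift of `ℤ` is unitary, so no wall term appears. -/
theorem shift_mul_none (T R : Hil ℓ →L[ℂ] Hil ℓ) :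
    shiftOp none * (T * R) * star (shiftOp none) =
      (shiftOp none * T * star (shiftOp none)) * (shiftOp none * R * star (shiftOp none)) := by
  calc shiftOp none * (T * R) * star (shiftOp none)
      = shiftOp none * T * 1 * (R * star (shiftOp none)) := by noncomm_ring
    _ = _ := by rw [← star_shiftOp_mul_none]; noncomm_ring

/-- Operators whose matrix decreases rapidly off the diagonal and becomes shift invariant rapidly in
each coordinate direction. -/
structure IsAsympInvariant (T : Hil ℓ →L[ℂ] Hil ℓ) : Prop where
  rapid : Rapid 0 (mat T)
  shift : ∀ p, Rapid (fun x => |co p x|) (mat (shiftOp p * T * star (shiftOp p) - T))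

variable {S T : Hil ℓ →L[ℂ] Hil ℓ}

theorem Rapid.op_add (hv : IsWeight v) (hS : Rapid v (mat S)) (hT : Rapid v (mat T)) :
    Rapid v (mat (S + T)) := hS.add hv hT

theorem Rapid.op_sub (hv : IsWeight v) (hS : Rapid v (mat S)) (hT : Rapid v (mat T)) :
    Rapid v (mat (S - T)) := hS.sub hv hT

theorem Rapid.op_smul (hv : IsWeight v) (hT : Rapid v (mat T)) (a : ℂ) :
    Rapid v (mat (a • T)) := hT.smul hv a

theorem rapid_op_zero (v : Idx ℓ → ℝ) : Rapid v (mat (0 : Hil ℓ →L[ℂ] Hil ℓ)) := rapid_zero v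

theorem shift_add (p : Option (Fin ℓ)) (S T : Hil ℓ →L[ℂ] Hil ℓ) :
    shiftOp p * (S + T) * star (shiftOp p) - (S + T)
      = (shiftOp p * S * star (shiftOp p) - S) + (shiftOp p * T * star (shiftOp p) - T) := by
  noncomm_ring

theorem shift_smul (p : Option (Fin ℓ)) (a : ℂ) (T : Hil ℓ →L[ℂ] Hil ℓ) :
    shiftOp p * (a • T) * star (shiftOp p) - a • T
      = a • (shiftOp p * T * star (shiftOp p) - T) := by
  rw [mul_smul_comm, smul_mul_assoc, smul_sub]

theorem shift_one (p : Option (Fin ℓ)) :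
    shiftOp p * 1 * star (shiftOp p) - (1 : Hil ℓ →L[ℂ] Hil ℓ) = 0 := by
  rw [mul_one, shiftOp_mul_star, sub_self]

theorem shift_star (p : Option (Fin ℓ)) (T : Hil ℓ →L[ℂ] Hil ℓ) :
    shiftOp p * star T * star (shiftOp p) - star T
      = star (shiftOp p * T * star (shiftOp p) - T) := by
  simp only [star_sub, star_mul, star_star, mul_assoc]

namespace IsAsympInvariant

theorem add (hS : IsAsympInvariant S) (hT : IsAsympInvariant T) : IsAsympInvariant (S + T) where
  rapid := hS.rapid.op_add isWeight_zero hT.rapid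
  shift p := by
    rw [shift_add]
    exact (hS.shift p).op_add (isWeight_co p) (hT.shift p)

theorem smul (a : ℂ) (hT : IsAsympInvariant T) : IsAsympInvariant (a • T) where
  rapid := hT.rapid.op_smul isWeight_zero a
  shift p := by
    rw [shift_smul]
    exact (hT.shift p).op_smul (isWeight_co p) a

theorem one : IsAsympInvariant (1 : Hil ℓ →L[ℂ] Hil ℓ) where
  rapid := rapid_one
  shift p := by
    rw [shift_one]
    exact rapid_op_zero _

theorem mul (hS : IsAsympInvariant S) (hT : IsAsympInvariant T) : IsAsympInvariant (S * T) where
  rapid := hS.rapid.op_mul_right isWeight_zero hT.rapid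
  shift p := by
    have h1 := (hS.shift p).op_mul_right (isWeight_co p) (rapid_conj_shiftOp isWeight_zero p hT.rapid)
    have h2 := hS.rapid.op_mul_left (isWeight_co p) (hT.shift p)
    cases p with
    | none =>
      have e : shiftOp none * (S * T) * star (shiftOp none) - S * T =
          (shiftOp none * S * star (shiftOp none) - S) * (shiftOp none * T * star (shiftOp none))
          + S * (shiftOp none * T * star (shiftOp none) - T) := by
        rw [shift_mul_none]; noncomm_ring
      rw [e]
      exact h1.op_add (isWeight_co _) h2
    | some i =>
      rw [shift_mul_some]
      -- The wall term decays in the `i`-th coordinate because the edge projection does; factors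
      -- that are rapid off the diagonal preserve this.
      refine (h1.op_add (isWeight_co _) h2).op_add (isWeight_co _) ?_
      refine Rapid.op_mul_right (isWeight_co _) ?_
        (hT.rapid.op_mul_right isWeight_zero ((rapid_shiftOp _).op_star isWeight_zero))
      exact ((rapid_shiftOp _).op_mul_right isWeight_zero hS.rapid).op_mul_left (isWeight_co _)
        (rapid_edgeProj i)

theorem of_rapid_nrm (hT : Rapid nrm (mat T)) : IsAsympInvariant T where
  rapid := hT.zero_weight isWeight_nrm
  shift p := ((rapid_conj_shiftOp isWeight_nrm p hT).op_sub isWeight_nrm hT).mono (isWeight_co p)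
    (abs_co_le_nrm p)

end IsAsympInvariant

/-! ### The sign operator and the derivation given by the norm -/

/-- The sign of an index: the sign of its integer coordinate. -/
def sgn (x : Idx ℓ) : ℂ := if 0 ≤ x.2 then 1 else -1

theorem norm_sgn (x : Idx ℓ) : ‖sgn x‖ = 1 := by
  unfold sgn
  split_ifs <;> simp

theorem norm_sgn_le (x : Idx ℓ) : ‖sgn x‖ ≤ 1 := (norm_sgn x).le

/-- Between indices of opposite sign the integer coordinate crosses zero, so its size is at most the
length of the jump. -/
theorem abs_co_none_le_of_sgn_ne {x y : Idx ℓ} (h : sgn x ≠ sgn y) : |co none x| ≤ |co none x - co none y| := by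
  unfold sgn at h
  simp only [co]
  have key : ∀ a b : ℤ, (0 ≤ a ↔ ¬ 0 ≤ b) → |(a : ℝ)| ≤ |(a : ℝ) - b| := by
    intro a b hab
    have : |a| ≤ |a - b| := by
      rcases abs_cases a with h1 | h1 <;> rcases abs_cases (a - b) with h2 | h2 <;> omega
    exact_mod_cast this
  apply key
  by_cases hx : 0 ≤ x.2 <;> by_cases hy : 0 ≤ y.2 <;> simp [hx, hy] at h ⊢

theorem dirac_eq (x : Idx ℓ) : (dirac ℓ x : ℂ) = sgn x * nrm x := by
  unfold dirac sgn nrm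
  split_ifs <;> push_cast <;> ring

theorem abs_dirac (x : Idx ℓ) : |dirac ℓ x| = nrm x := by
  have h := congrArg (fun z : ℂ => ‖z‖) (dirac_eq x)
  simp only [norm_mul, norm_sgn, one_mul, Complex.norm_real, Real.norm_eq_abs] at h
  rw [h, abs_of_nonneg (nrm_nonneg x)]

/-- The sign of the Dirac operator. -/
def signOp (ℓ : ℕ) : Hil ℓ →L[ℂ] Hil ℓ := diagCLM sgn

theorem mat_signOp_mul (T : Hil ℓ →L[ℂ] Hil ℓ) (x y : Idx ℓ) :
    mat (signOp ℓ * T) x y = sgn x * mat T x y :=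
  diagCLM_apply norm_sgn_le _ x

theorem isAsympInvariant_signOp : IsAsympInvariant (signOp ℓ) where
  rapid := rapid_diag norm_sgn_le
  shift p := by
    refine Rapid.of_support isWeight_zero (isWeight_co p) ?_ zero_le_one fun x y h => ?_
    · exact (rapid_conj_shiftOp isWeight_zero p (rapid_diag norm_sgn_le)).op_sub isWeight_zero
        (rapid_diag norm_sgn_le)
    · have ho := offd_nonneg x y
      rw [mat_sub, mat_conj_shiftOp, signOp, mat_diagCLM norm_sgn_le, mat_diagCLM norm_sgn_le] at h
      simp only [(sh_injective p).eq_iff] at h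
      cases p with
      | some i =>
        refine absurd ?_ h
        by_cases hxy : x = y <;> simp [sgn, sh, hxy]
      | none =>
        by_cases hxy : x = y
        · simp only [hxy, if_true, sgn, sh] at h
          -- A unit step changes the sign only from `-1` to `0`.
          have : y.2 = -1 := by
            by_contra h'
            by_cases h1 : 0 ≤ y.2
            · simp [h1, (by omega : 0 ≤ y.2 + 1)] at h
            · have h2 : ¬ 0 ≤ y.2 + 1 := by omega
              simp only [if_neg h1, if_neg h2, sub_self, ne_eq, not_true_eq_false] at h
          simp only [co, hxy, this, Pi.zero_apply] at ho ⊢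
          norm_num
          linarith
        · simp [hxy] at h

/-- The derivation `[|D|, ·]` on matrices preserves asymptotic shift invariance. -/
theorem IsAsympInvariant.of_commutator_nrm (hT : IsAsympInvariant T)
    (hS : ∀ x y, mat S x y = ((nrm x : ℂ) - nrm y) * mat T x y) : IsAsympInvariant S := by
  have hn (x y : Idx ℓ) : ‖(nrm x : ℂ) - nrm y‖ ≤ offd x y := by
    rw [← Complex.ofReal_sub, Complex.norm_real]
    exact abs_nrm_sub_le x y
  have hle {v : Idx ℓ → ℝ} (hv : IsWeight v) {t : Idx ℓ → Idx ℓ → ℂ} (ht : Rapid v t) :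
      Rapid v fun x y => ((nrm x : ℂ) - nrm y) * t x y := by
    refine ht.of_le hv zero_le_one 1 fun x y => ?_
    rw [norm_mul, one_mul, pow_one, mul_comm]
    have := hv.nonneg x
    exact mul_le_mul_of_nonneg_left ((hn x y).trans (by linarith)) (norm_nonneg _)
  have hS0 : Rapid 0 (mat S) := (hle isWeight_zero hT.rapid).of_norm_le isWeight_zero fun x y => (hS x y ▸ le_rfl)
  refine ⟨hS0, fun p => ?_⟩
  -- By the product rule, the shifted minus the unshifted entry of `S` is `(nrm x - nrm y)` times
  -- the difference for `T`, plus `E x y` times the shifted entry of `T`. A step in a natural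
  -- direction always adds 1 to the norm, a step in `ℤ` adds the sign, so `E` vanishes unless `p` is
  -- the integer direction and the signs of `x` and `y` differ.
  let E (x y : Idx ℓ) : ℂ := ((nrm (sh p x) : ℂ) - nrm x) - (nrm (sh p y) - nrm y)
  have hE2 (x y : Idx ℓ) : ‖E x y‖ ≤ 2 := by
    have h1 (x : Idx ℓ) : ‖(nrm (sh p x) : ℂ) - nrm x‖ ≤ 1 := by
      refine (hn _ _).trans ?_
      rw [offd_comm]
      exact offd_sh_le p x
    calc ‖E x y‖ ≤ _ := norm_sub_le _ _
      _ ≤ 1 + 1 := add_le_add (h1 x) (h1 y)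
      _ = 2 := by norm_num
  have hE (x y : Idx ℓ) (h : E x y ≠ 0) : |co p x| ≤ offd x y := by
    cases p with
    | some i => simp [E, nrm_sh_some] at h
    | none =>
      refine (abs_co_none_le_of_sgn_ne fun hxy => h ?_).trans (abs_co_sub_le none x y)
      simp only [E, nrm_sh_none]
      unfold sgn at hxy
      by_cases hx : 0 ≤ x.2 <;> by_cases hy : 0 ≤ y.2 <;> simp [hx, hy] at hxy ⊢
      all_goals norm_num at hxy
  have h1 := hle (isWeight_co p) (hT.shift p)
  have h2 : Rapid (fun x => |co p x|) fun x y => E x y * mat T (sh p x) (sh p y) := by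
    have h3 : Rapid 0 fun x y => E x y * mat T (sh p x) (sh p y) := by
      refine (rapid_conj_shiftOp isWeight_zero p hT.rapid).of_le isWeight_zero zero_le_two 0 fun x y => ?_
      rw [mat_conj_shiftOp, norm_mul, pow_zero, mul_one]
      exact mul_le_mul_of_nonneg_right (hE2 x y) (norm_nonneg _)
    refine h3.of_support isWeight_zero (isWeight_co p) zero_le_one fun x y h => ?_
    have := hE x y (left_ne_zero_of_mul h)
    simp only [Pi.zero_apply]
    linarith
  refine (h1.add (isWeight_co p) h2).of_norm_le (isWeight_co p) fun x y => le_of_eq (congrArg _ ?_)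
  rw [mat_sub, mat_sub, mat_conj_shiftOp, mat_conj_shiftOp, hS, hS]
  simp only [E]
  ring

end Shifts

/-! ### A matrix description of the smooth algebra -/

section SmoothClass

variable {ℓ : ℕ} {v w : Idx ℓ → ℝ} {S T : Hil ℓ →L[ℂ] Hil ℓ}

/-- The natural coordinates preceding a given one. -/
def before : Option (Fin ℓ) → Finset (Fin ℓ)
  | some i => Finset.univ.filter (· < i)
  | none => Finset.univ

/-- The sum of the coordinates preceding a given one. -/
def below (p : Option (Fin ℓ)) (x : Idx ℓ) : ℝ := ∑ q ∈ before p, (x.1 q : ℝ)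

theorem isWeight_below (p : Option (Fin ℓ)) : IsWeight (below p : Idx ℓ → ℝ) := isWeight_sum _

/-- The sum of the natural coordinates up to a given one. -/
def upTo (i : Fin ℓ) (x : Idx ℓ) : ℝ := ∑ q with q ≤ i, (x.1 q : ℝ)

theorem isWeight_upTo (i : Fin ℓ) : IsWeight (upTo i : Idx ℓ → ℝ) := isWeight_sum _

theorem upTo_eq (i : Fin ℓ) (x : Idx ℓ) : upTo i x = below (some i) x + |co (some i) x| := by
  have h : (Finset.univ.filter (· ≤ i)) = insert i (Finset.univ.filter (· < i)) := by
    ext q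
    simp [le_iff_eq_or_lt]
  rw [upTo, h, Finset.sum_insert (by simp), add_comm, co, abs_of_nonneg (by positivity)]
  rfl

/-- The matrices of the elements of the smooth algebra: up to rapidly decreasing terms in the previous
coordinates, they are diagonal in each coordinate and shift invariant in each coordinate. -/
structure IsSmooth (T : Hil ℓ →L[ℂ] Hil ℓ) : Prop where
  rapid : Rapid 0 (mat T)
  sep : ∀ p, Rapid (below p) fun x y => ((co p x : ℂ) - co p y) * mat T x y
  shift : ∀ i, Rapid (upTo i) (mat (shiftOp (some i) * T * star (shiftOp (some i)) - T))
  inv : shiftOp none * T * star (shiftOp none) = T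

namespace IsSmooth

theorem isAsympInvariant (hT : IsSmooth T) : IsAsympInvariant T where
  rapid := hT.rapid
  shift p := by
    cases p with
    | none =>
      rw [hT.inv, sub_self]
      exact rapid_op_zero _
    | some i =>
      refine (hT.shift i).mono (isWeight_co _) fun x => ?_
      rw [upTo_eq]
      linarith [(isWeight_below (some i)).nonneg x]

theorem add (hS : IsSmooth S) (hT : IsSmooth T) : IsSmooth (S + T) where
  rapid := hS.rapid.op_add isWeight_zero hT.rapid
  sep p := by
    simp only [mat_add, mul_add]
    exact (hS.sep p).add (isWeight_below p) (hT.sep p)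
  shift i := by
    rw [shift_add]
    exact (hS.shift i).op_add (isWeight_upTo i) (hT.shift i)
  inv := by
    rw [mul_add, add_mul, hS.inv, hT.inv]

theorem smul (a : ℂ) (hT : IsSmooth T) : IsSmooth (a • T) where
  rapid := hT.rapid.op_smul isWeight_zero a
  sep p := by
    simp only [mat_smul, mul_left_comm]
    exact (hT.sep p).smul (isWeight_below p) a
  shift i := by
    rw [shift_smul]
    exact (hT.shift i).op_smul (isWeight_upTo i) a
  inv := by
    rw [mul_smul_comm, smul_mul_assoc, hT.inv]

theorem one : IsSmooth (1 : Hil ℓ →L[ℂ] Hil ℓ) where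
  rapid := rapid_one
  sep p := by
    refine (rapid_zero _).of_norm_le (isWeight_below p) fun x y => ?_
    rw [mat_one]
    split_ifs with h
    · simp [h]
    · simp
  shift i := by
    rw [shift_one]
    exact rapid_op_zero _
  inv := by rw [mul_one, shiftOp_mul_star]

theorem star (hT : IsSmooth T) : IsSmooth (star T) where
  rapid := hT.rapid.op_star isWeight_zero
  sep p := by
    refine ((hT.sep p).star (isWeight_below p)).of_norm_le (isWeight_below p) fun x y => le_of_eq ?_
    rw [mat_star, norm_star, norm_mul, norm_mul, norm_star, norm_sub_rev]
  shift i := by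
    rw [shift_star]
    exact (hT.shift i).op_star (isWeight_upTo i)
  inv := by
    have h := congrArg Star.star hT.inv
    simpa only [star_mul, star_star, mul_assoc] using h

/-- The commutator with the number operator of a coordinate. -/
theorem exists_sep (hT : IsSmooth T) (p : Option (Fin ℓ)) : ∃ Δ : Hil ℓ →L[ℂ] Hil ℓ,
    (∀ x y, mat Δ x y = ((co p x : ℂ) - co p y) * mat T x y) ∧ Rapid (below p) (mat Δ) := by
  obtain ⟨Δ, hΔ⟩ := ((hT.sep p).zero_weight (isWeight_below p)).exists_mat_eq
  exact ⟨Δ, hΔ, (hT.sep p).of_norm_le (isWeight_below p) fun x y => (hΔ x y ▸ le_rfl)⟩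

theorem mul (hS : IsSmooth S) (hT : IsSmooth T) : IsSmooth (S * T) where
  rapid := hS.rapid.op_mul_right isWeight_zero hT.rapid
  sep p := by
    obtain ⟨Δ, hΔ, hΔ'⟩ := hS.exists_sep p
    obtain ⟨Γ, hΓ, hΓ'⟩ := hT.exists_sep p
    have h1 : Rapid (below p) (mat (Δ * T + S * Γ)) :=
      (hΔ'.op_mul_right (isWeight_below p) hT.rapid).op_add (isWeight_below p)
        (hS.rapid.op_mul_left (isWeight_below p) hΓ')
    refine h1.of_norm_le (isWeight_below p) fun x y => le_of_eq (congrArg _ ?_)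
    have h2 := (mat_mul_hasSum Δ T x y).add (mat_mul_hasSum S Γ x y)
    have h3 := (mat_mul_hasSum S T x y).mul_left ((co p x : ℂ) - co p y)
    refine h3.unique ?_
    have e : (fun z => ((co p x : ℂ) - co p y) * (mat S x z * mat T z y))
        = fun z => mat Δ x z * mat T z y + mat S x z * mat Γ z y := by
      ext z
      rw [hΔ, hΓ]; ring
    rw [e]
    exact h2
  shift i := by
    have hw := isWeight_upTo i
    rw [shift_mul_some]
    refine (((hS.shift i).op_mul_right hw (rapid_conj_shiftOp isWeight_zero _ hT.rapid)).op_add hw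
      (hS.rapid.op_mul_left hw (hT.shift i))).op_add hw ?_
    refine Rapid.op_mul_right hw ?_
      (hT.rapid.op_mul_right isWeight_zero ((rapid_shiftOp _).op_star isWeight_zero))
    have h1 : Rapid (fun x => |co (some i) x|) (mat (shiftOp (some i) * S * edgeProj i)) :=
      ((rapid_shiftOp _).op_mul_right isWeight_zero hS.rapid).op_mul_left (isWeight_co _)
        (rapid_edgeProj i)
    obtain ⟨Δ, hΔ, hΔ'⟩ := hS.exists_sep (some i)
    -- Nonzero entries have `y.1 i = 0`, while the row of `S` is at a shifted index with `i`-th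
    -- coordinate at least 1. The difference of these coordinates is at least 1, so the entry is
    -- dominated by that of the commutator `Δ`, which decays in the preceding coordinates.
    have h2 : Rapid (below (some i)) (mat (shiftOp (some i) * S * edgeProj i)) := by
      have hb := isWeight_below (some i)
      have h3 : Rapid (below (some i)) (mat (shiftOp (some i) * Δ)) :=
        (rapid_shiftOp _).op_mul_left hb hΔ'
      refine h3.of_norm_le hb fun x y => ?_
      rw [edgeProj, mat_mul_diagCLM (edge_le i)]
      change ‖mat S (sh (some i) x) y * _‖ ≤ ‖mat Δ (sh (some i) x) y‖
      rw [hΔ, norm_mul, norm_mul, mul_comm]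
      refine mul_le_mul_of_nonneg_right ?_ (norm_nonneg _)
      split_ifs with hy
      · rw [← Complex.ofReal_sub, Complex.norm_real, co_sh]
        simp only [co, hy, if_true, norm_one]
        norm_num
        rw [abs_of_nonneg (by positivity)]
        linarith [(Nat.cast_nonneg (x.1 i) : (0 : ℝ) ≤ x.1 i)]
      · simp
    have h4 := h2.add_weight (isWeight_below _) (isWeight_co _) h1
    exact h4.mono hw fun x => (upTo_eq i x).le
  inv := by
    rw [shift_mul_none, hS.inv, hT.inv]

/-- Smooth operators commute with the sign up to smoothing operators, so that their commutators with the Dirac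
operator are asymptotically shift invariant. -/
theorem exists_commutator_dirac (hT : IsSmooth T) : ∃ Y : Hil ℓ →L[ℂ] Hil ℓ, IsAsympInvariant Y ∧
    ∀ x y, mat Y x y = ((dirac ℓ x : ℂ) - dirac ℓ y) * mat T x y := by
  have hδ : Rapid 0 fun x y => ((nrm x : ℂ) - nrm y) * mat T x y := by
    refine hT.rapid.of_le isWeight_zero zero_le_one 1 fun x y => ?_
    rw [norm_mul, one_mul, pow_one, mul_comm, ← Complex.ofReal_sub, Complex.norm_real]
    have h := abs_nrm_sub_le x y
    refine mul_le_mul_of_nonneg_left (h.trans ?_) (norm_nonneg _)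
    simp only [Pi.zero_apply]
    linarith
  obtain ⟨Δ, hΔ⟩ := hδ.exists_mat_eq
  have hΔ' := hT.isAsympInvariant.of_commutator_nrm hΔ
  -- Write `d(x) - d(y) = sgn x (|x| - |y|) + (sgn x - sgn y)|y|`. The second term lives where the
  -- signs differ: there the integer coordinates differ by at least 1, so `sep none` gives decay in
  -- all natural coordinates, while crossing zero gives decay in the integer one. Together this is
  -- decay in the full norm, which absorbs the factor `|y|`.
  have hG : Rapid nrm fun x y => (sgn x - sgn y) * nrm y * mat T x y := by
    have h1 : Rapid nrm fun x y => (sgn x - sgn y) * (((co none x : ℂ) - co none y) * mat T x y) := by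
      have h2 : Rapid (below none) fun x y => (sgn x - sgn y) * (((co none x : ℂ) - co none y) * mat T x y) := by
        refine (hT.sep none).of_le (isWeight_below none) zero_le_two 0 fun x y => ?_
        rw [norm_mul, pow_zero, mul_one]
        refine mul_le_mul_of_nonneg_right ((norm_sub_le _ _).trans ?_) (norm_nonneg _)
        rw [norm_sgn, norm_sgn]; norm_num
      refine h2.of_support (isWeight_below none) isWeight_nrm zero_le_one fun x y h => ?_
      have h3 : sgn x ≠ sgn y := fun h' => by simp [h'] at h
      have h4 := (abs_co_none_le_of_sgn_ne h3).trans (abs_co_sub_le none x y)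
      have h5 : nrm x = below none x + |co none x| := rfl
      linarith
    refine h1.of_le isWeight_nrm zero_le_one 1 fun x y => ?_
    rw [one_mul, pow_one]
    by_cases hxy : sgn x = sgn y
    · simp [hxy]
    have h6 : 1 ≤ ‖(co none x : ℂ) - co none y‖ := by
      have hne : x.2 ≠ y.2 := fun h' => hxy (by unfold sgn; rw [h'])
      simp only [co]
      rw [← Complex.ofReal_sub, Complex.norm_real]
      have : (1 : ℤ) ≤ |x.2 - y.2| := Int.one_le_abs (sub_ne_zero.2 hne)
      rw [Real.norm_eq_abs]
      exact_mod_cast this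
    have h7 : ‖(nrm y : ℂ)‖ ≤ 1 + nrm x + offd x y := by
      rw [Complex.norm_real, Real.norm_eq_abs, abs_of_nonneg (nrm_nonneg y)]
      linarith [isWeight_nrm.lip y x, offd_comm x y]
    calc ‖(sgn x - sgn y) * nrm y * mat T x y‖
        = ‖sgn x - sgn y‖ * (1 * ‖mat T x y‖) * ‖(nrm y : ℂ)‖ := by
          rw [norm_mul, norm_mul]; ring
      _ ≤ ‖sgn x - sgn y‖ * (‖(co none x : ℂ) - co none y‖ * ‖mat T x y‖) * (1 + nrm x + offd x y) := by
          gcongr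
      _ = _ := by rw [norm_mul, norm_mul]
  obtain ⟨G, hG'⟩ := (hG.zero_weight isWeight_nrm).exists_mat_eq
  have hGs : IsAsympInvariant G := IsAsympInvariant.of_rapid_nrm
    (hG.of_norm_le isWeight_nrm fun x y => (hG' x y ▸ le_rfl))
  refine ⟨signOp ℓ * Δ + G, (isAsympInvariant_signOp.mul hΔ').add hGs, fun x y => ?_⟩
  rw [mat_add, mat_signOp_mul, hΔ, hG', dirac_eq, dirac_eq]
  ring

end IsSmooth

/-! ### Regularity -/

theorem IsAsympInvariant.exists_commutator_abs (hT : IsAsympInvariant T) :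
    ∃ Y, IsCommutator (absOp (dirac ℓ)) T Y ∧ IsAsympInvariant Y := by
  have hδ : Rapid 0 fun x y => ((nrm x : ℂ) - nrm y) * mat T x y := by
    refine hT.rapid.of_le isWeight_zero zero_le_one 1 fun x y => ?_
    rw [norm_mul, one_mul, pow_one, mul_comm, ← Complex.ofReal_sub, Complex.norm_real]
    have h := abs_nrm_sub_le x y
    refine mul_le_mul_of_nonneg_left (h.trans ?_) (norm_nonneg _)
    simp only [Pi.zero_apply]
    linarith
  obtain ⟨Y, hY⟩ := hδ.exists_mat_eq
  refine ⟨Y, ?_, hT.of_commutator_nrm hY⟩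
  rw [absOp, isCommutator_diagOp_iff]
  simpa only [abs_dirac] using hY

/-- The induction must carry asymptotic invariance along, since boundedness of one commutator does
not produce the next. -/
theorem IsAsympInvariant.mem_OPZero (hT : IsAsympInvariant T) : T ∈ OPZero (absOp (dirac ℓ)) := by
  have h (n : ℕ) : ∃ Y, IsIterCommutator (absOp (dirac ℓ)) n T Y ∧ IsAsympInvariant Y := by
    induction n with
    | zero => exact ⟨T, rfl, hT⟩
    | succ n ih =>
      obtain ⟨Z, hZ, hZ'⟩ := ih
      obtain ⟨Y, hY, hY'⟩ := hZ'.exists_commutator_abs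
      exact ⟨Y, ⟨Z, hZ, hY⟩, hY'⟩
  intro n
  obtain ⟨Y, hY, -⟩ := h n
  exact ⟨Y, hY⟩

theorem IsAsympInvariant.of_isIterCommutator (hT : IsAsympInvariant T) {n : ℕ}
    (h : IsIterCommutator (absOp (dirac ℓ)) n T S) : IsAsympInvariant S := by
  induction n generalizing S with
  | zero => rwa [show S = T from h]
  | succ n ih =>
    obtain ⟨Z, hZ, hS⟩ := h
    rw [absOp, isCommutator_diagOp_iff] at hS
    refine (ih hZ).of_commutator_nrm ?_
    simpa only [abs_dirac] using hS

theorem IsSmooth.exists_isCommutator (hT : IsSmooth T) :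
    ∃ Y, IsCommutator (diagOp (dirac ℓ)) T Y ∧ IsAsympInvariant Y := by
  obtain ⟨Y, hY, hY'⟩ := hT.exists_commutator_dirac
  exact ⟨Y, (isCommutator_diagOp_iff _ _ _).2 hY', hY⟩

theorem IsSmooth.isAsympInvariant_of_isCommutator (hT : IsSmooth T)
    (h : IsCommutator (diagOp (dirac ℓ)) T S) : IsAsympInvariant S := by
  obtain ⟨Y, hY, hY'⟩ := hT.exists_commutator_dirac
  have : S = Y := mat_injective fun x y => by
    rw [(isCommutator_diagOp_iff _ _ _).1 h, hY']
  rwa [this]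

/-- The generators belong to the class by stability under the derivation, and the class is an
algebra; every zeta function thus reduces to this single class. -/
theorem isAsympInvariant_of_mem_derivAlgebra {A : Set (Hil ℓ →L[ℂ] Hil ℓ)} (hA : ∀ a ∈ A, IsSmooth a)
    {b : Hil ℓ →L[ℂ] Hil ℓ} (hb : b ∈ derivAlgebra A (dirac ℓ)) : IsAsympInvariant b := by
  induction hb using Algebra.adjoin_induction with
  | mem Y hY =>
    obtain ⟨a, ha, n, h | ⟨c, hc, h⟩⟩ := hY
    · exact (hA a ha).isAsympInvariant.of_isIterCommutator h
    · exact ((hA a ha).isAsympInvariant_of_isCommutator hc).of_isIterCommutator h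
  | algebraMap r =>
    rw [Algebra.algebraMap_eq_smul_one]
    exact IsAsympInvariant.one.smul r
  | add x y _ _ hx hy => exact hx.add hy
  | mul x y _ _ hx hy => exact hx.mul hy

theorem isRegular_of_isSmooth {A : Set (Hil ℓ →L[ℂ] Hil ℓ)} (hA : ∀ a ∈ A, IsSmooth a) :
    IsRegular A (dirac ℓ) := by
  intro a ha
  obtain ⟨c, hc, hc'⟩ := (hA a ha).exists_isCommutator
  exact ⟨(hA a ha).isAsympInvariant.mem_OPZero, c, hc, hc'.mem_OPZero⟩

end SmoothClass

/-! ### Splitting off the first coordinate -/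

section Slices

variable {ℓ : ℕ}

/-- The index with first coordinate `i` and remaining coordinates `x`. -/
def ic (i : ℕ) (x : Idx ℓ) : Idx (ℓ + 1) := (Fin.cons i x.1, x.2)

theorem exists_eq_ic (y : Idx (ℓ + 1)) : ∃ i x, y = ic i x :=
  ⟨y.1 0, (Fin.tail y.1, y.2), Prod.ext (Fin.cons_self_tail y.1).symm rfl⟩

theorem ic_inj {i j : ℕ} {x y : Idx ℓ} : ic i x = ic j y ↔ i = j ∧ x = y := by
  constructor
  · intro h
    have h1 := congrArg Prod.fst h
    have h2 := congrArg Prod.snd h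
    simp only [ic, Fin.cons_inj] at h1 h2
    exact ⟨h1.1, Prod.ext h1.2 h2⟩
  · rintro ⟨rfl, rfl⟩
    rfl

theorem ic_injective (i : ℕ) : Function.Injective (ic i : Idx ℓ → Idx (ℓ + 1)) :=
  fun _ _ h => (ic_inj.1 h).2

theorem offd_ic (i j : ℕ) (x y : Idx ℓ) : offd (ic i x) (ic j y) = |(i : ℝ) - j| + offd x y := by
  simp [offd, ic, Fin.sum_univ_succ, add_assoc]

/-- The inclusion of the coordinates of `Idx ℓ` into those of `Idx (ℓ + 1)`. -/
abbrev up (p : Option (Fin ℓ)) : Option (Fin (ℓ + 1)) := p.map Fin.succ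

theorem eq_some_zero_or_up (p : Option (Fin (ℓ + 1))) : p = some 0 ∨ ∃ q, p = up q := by
  rcases p with _ | i
  · exact Or.inr ⟨none, rfl⟩
  · refine Fin.cases (Or.inl rfl) (fun i => Or.inr ⟨some i, rfl⟩) i

theorem co_zero_ic (i : ℕ) (x : Idx ℓ) : co (some 0) (ic i x) = i := by simp [co, ic]

theorem co_up_ic (p : Option (Fin ℓ)) (i : ℕ) (x : Idx ℓ) : co (up p) (ic i x) = co p x := by
  cases p <;> simp [co, ic]

theorem sh_zero_ic (i : ℕ) (x : Idx ℓ) : sh (some 0) (ic i x) = ic (i + 1) x := by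
  simp [sh, ic, Fin.cons_zero, Fin.update_cons_zero]

theorem sh_up_ic (p : Option (Fin ℓ)) (i : ℕ) (x : Idx ℓ) : sh (up p) (ic i x) = ic i (sh p x) := by
  cases p with
  | none => rfl
  | some q => simp [sh, ic, Fin.cons_update]

theorem below_zero_ic (x : Idx (ℓ + 1)) : below (some 0) x = 0 := by
  simp [below, before]

theorem below_up_ic (p : Option (Fin ℓ)) (i : ℕ) (x : Idx ℓ) :
    below (up p) (ic i x) = i + below p x := by
  cases p with
  | none => simp [below, before, ic, Fin.sum_univ_succ]
  | some q => simp [below, before, ic, Finset.sum_filter, Fin.sum_univ_succ]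

theorem upTo_zero_ic (i : ℕ) (x : Idx ℓ) : upTo 0 (ic i x) = i := by
  simp [upTo, ic, Finset.sum_filter]

theorem upTo_succ_ic (q : Fin ℓ) (i : ℕ) (x : Idx ℓ) : upTo q.succ (ic i x) = i + upTo q x := by
  simp [upTo, ic, Finset.sum_filter, Fin.sum_univ_succ]

theorem alpha_ic (i : ℕ) (x : Idx ℓ) (v : Hil (ℓ + 1)) : alpha ℓ v (ic i x) = v (ic (i + 1) x) := rfl

theorem alpha_pow_apply (k i : ℕ) (x : Idx ℓ) (v : Hil (ℓ + 1)) :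
    (alpha ℓ ^ k) v (ic i x) = v (ic (i + k) x) := by
  induction k generalizing v with
  | zero => rfl
  | succ k ih =>
    rw [pow_succ]
    exact (ih _).trans (alpha_ic _ x v)

theorem slice_mul_alpha_pow (k : ℕ) : (slice ℓ).comp (alpha ℓ ^ k) = pullback (ic k) (ic_injective k) := by
  ext v x
  rw [ContinuousLinearMap.comp_apply, pullback_apply]
  change (alpha ℓ ^ k) v (ic 0 x) = _
  rw [alpha_pow_apply, zero_add]

/-- The map `slice` after `α₁^k` restricts a vector to the `k`-th slice, so the summand is `a`
placed in block `(j, k)`. Both its norm bound and its matrix are read off from this form. -/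
theorem corner_eq (j k : ℕ) (a : Hil ℓ →L[ℂ] Hil ℓ) :
    star (alpha ℓ) ^ j * pTensor a * alpha ℓ ^ k =
      (ContinuousLinearMap.adjoint (pullback (ic j) (ic_injective j))).comp
        (a.comp (pullback (ic k) (ic_injective k))) := by
  rw [← slice_mul_alpha_pow, ← slice_mul_alpha_pow, ContinuousLinearMap.adjoint_comp, ← star_pow]
  rfl

theorem norm_corner_le (j k : ℕ) (a : Hil ℓ →L[ℂ] Hil ℓ) :
    ‖star (alpha ℓ) ^ j * pTensor a * alpha ℓ ^ k‖ ≤ ‖a‖ := by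
  rw [corner_eq]
  refine (ContinuousLinearMap.opNorm_comp_le _ _).trans ?_
  have h1 := norm_pullback_le (ic j : Idx ℓ → _) (ic_injective j)
  have h2 := norm_pullback_le (ic k : Idx ℓ → _) (ic_injective k)
  have h3 := ContinuousLinearMap.opNorm_comp_le a (pullback (ic k) (ic_injective k))
  rw [LinearIsometryEquiv.norm_map]
  have := norm_nonneg a
  nlinarith [norm_nonneg (a.comp (pullback (ic k : Idx ℓ → _) (ic_injective k)))]

theorem pullback_ic_basisVec (k b : ℕ) (y : Idx ℓ) :
    pullback (ic k) (ic_injective k) (basisVec (ic b y)) = if b = k then basisVec y else 0 := by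
  ext x
  rw [pullback_apply, basisVec_apply]
  simp only [ic_inj]
  by_cases h : b = k
  · simp [h, basisVec_apply]
  · simp [h, Ne.symm h]

theorem mat_corner (j k a b : ℕ) (T : Hil ℓ →L[ℂ] Hil ℓ) (x y : Idx ℓ) :
    mat (star (alpha ℓ) ^ j * pTensor T * alpha ℓ ^ k) (ic a x) (ic b y) =
      if a = j ∧ b = k then mat T x y else 0 := by
  rw [corner_eq, mat, ← inner_basisVec, ContinuousLinearMap.comp_apply,
    ContinuousLinearMap.adjoint_inner_right, ContinuousLinearMap.comp_apply, pullback_ic_basisVec,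
    pullback_ic_basisVec]
  by_cases ha : a = j <;> by_cases hb : b = k <;> simp [ha, hb, inner_basisVec, mat]

theorem norm_alpha_le : ‖alpha ℓ‖ ≤ 1 := norm_pullback_le _ _

theorem norm_pow_le_one {A : Type*} [NormedRing A] [NormOneClass A] {a : A} (h : ‖a‖ ≤ 1) (k : ℕ) :
    ‖a ^ k‖ ≤ 1 := (norm_pow_le a k).trans (pow_le_one₀ (norm_nonneg a) h)

instance : Nontrivial (Hil ℓ) := ⟨basisVec (0, 0), 0, fun h => by
  have := congrArg norm h
  rw [norm_basisVec, norm_zero] at this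
  exact one_ne_zero this⟩

theorem norm_alphaPow_le (k : ℤ) : ‖alphaPow ℓ k‖ ≤ 1 := by
  unfold alphaPow
  split_ifs
  · exact norm_pow_le_one norm_alpha_le _
  · exact norm_pow_le_one ((norm_star _).trans_le norm_alpha_le) _

theorem mat_alpha_pow (k a b : ℕ) (x y : Idx ℓ) :
    mat (alpha ℓ ^ k) (ic a x) (ic b y) = if a + k = b ∧ x = y then 1 else 0 := by
  rw [mat, alpha_pow_apply, basisVec_apply]
  simp only [ic_inj]

theorem mat_alphaPow (k : ℤ) (a b : ℕ) (x y : Idx ℓ) :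
    mat (alphaPow ℓ k) (ic a x) (ic b y) = if k = (b : ℤ) - a ∧ x = y then 1 else 0 := by
  unfold alphaPow
  split_ifs with h1 h2 h2
  · rw [mat_alpha_pow, if_pos ⟨by omega, h2.2⟩]
  · rw [mat_alpha_pow, if_neg fun h3 => h2 ⟨by omega, h3.2⟩]
  · rw [← star_pow, mat_star, mat_alpha_pow, if_pos ⟨by omega, h2.2.symm⟩, star_one]
  · rw [← star_pow, mat_star, mat_alpha_pow, if_neg fun h3 => h2 ⟨by omega, h3.2.symm⟩, star_zero]

end Slices

/-! ### Seminorms and matrices -/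

section Seminorms

variable {ℓ : ℕ}

theorem seqNorm_mono {m m' : ℕ} (h : m ≤ m') (lam : ℤ → ℂ) : seqNorm m lam ≤ seqNorm m' lam := by
  refine ENNReal.tsum_le_tsum fun k => ?_
  gcongr
  exact le_self_add

theorem seminorm_mono {m m' : ℕ} (h : m ≤ m') (c : Coeff ℓ) : seminorm ℓ m c ≤ seminorm ℓ m' c := by
  cases ℓ with
  | zero => exact seqNorm_mono h c
  | succ ℓ =>
    refine add_le_add ?_ (seqNorm_mono h _)
    have h' : Finset.range (m + 1) ⊆ Finset.range (m' + 1) := Finset.range_subset_range.2 (by omega)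
    exact (iSup₂_mono fun r _ => biSup_mono fun _ hi => h' hi).trans (biSup_mono fun _ hi => h' hi)

/-- Each sum increases with both exponents, so the maximum is attained at `r = s = m`. -/
theorem seminorm_succ (m : ℕ) (c : Coeff (ℓ + 1)) : seminorm (ℓ + 1) m c =
    ∑' jk : ℕ × ℕ, (1 + (jk.1 : ℝ≥0∞) + jk.2) ^ m * seminorm ℓ m (c.1 jk.1 jk.2)
      + seqNorm m c.2 := by
  refine congrArg (· + seqNorm m c.2) (le_antisymm ?_ ?_)
  · refine iSup₂_le fun r hr => iSup₂_le fun s hs => ENNReal.tsum_le_tsum fun jk => ?_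
    rw [Finset.mem_range] at hr hs
    refine mul_le_mul' (pow_le_pow_right₀ ?_ (by omega)) (seminorm_mono (by omega) _)
    rw [add_assoc]
    exact le_self_add
  · have hm : m ∈ Finset.range (m + 1) := Finset.mem_range.2 (by omega)
    exact le_iSup₂_of_le m hm (le_iSup₂_of_le m hm le_rfl)

theorem summable_of_enorm_le {α E : Type*} [NormedAddCommGroup E] [CompleteSpace E] {f : α → E}
    {g : α → ℝ≥0∞} (hg : ∑' a, g a ≠ ∞) (h : ∀ a, ‖f a‖ₑ ≤ g a) : Summable f := by
  have h1 : ∑' a, ‖f a‖ₑ ≠ ∞ := ne_top_of_le_ne_top hg (ENNReal.tsum_le_tsum h)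
  refine Summable.of_nnnorm ?_
  exact ENNReal.tsum_coe_ne_top_iff_summable.1 h1

theorem norm_zPow_le (n : ℤ) : ‖zPow n‖ ≤ 1 := norm_pullback_le _ _

theorem enorm_le_enorm_iff {E F : Type*} [NormedAddCommGroup E] [NormedAddCommGroup F] {a : E} {b : F} :
    ‖a‖ₑ ≤ ‖b‖ₑ ↔ ‖a‖ ≤ ‖b‖ := by
  rw [← ofReal_norm, ← ofReal_norm, ENNReal.ofReal_le_ofReal_iff (norm_nonneg b)]

theorem enorm_tsum_le {α E : Type*} [NormedAddCommGroup E] (f : α → E) :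
    ‖∑' a, f a‖ₑ ≤ ∑' a, ‖f a‖ₑ := enorm_tsum_le_tsum_enorm

theorem enorm_add_le_add {E : Type*} [NormedAddCommGroup E] (a b : E) : ‖a + b‖ₑ ≤ ‖a‖ₑ + ‖b‖ₑ :=
  enorm_add_le a b

theorem enorm_smul_le_enorm {E : Type*} [NormedAddCommGroup E] [NormedSpace ℂ E] {T : E} (hT : ‖T‖ ≤ 1)
    (a : ℂ) : ‖a • T‖ₑ ≤ ‖a‖ₑ := by
  rw [enorm_le_enorm_iff]
  rw [norm_smul]
  exact mul_le_of_le_one_right (norm_nonneg a) hT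

theorem enorm_corner_le (j k : ℕ) (a : Hil ℓ →L[ℂ] Hil ℓ) :
    ‖star (alpha ℓ) ^ j * pTensor a * alpha ℓ ^ k‖ₑ ≤ ‖a‖ₑ :=
  enorm_le_enorm_iff.2 (norm_corner_le j k a)

theorem tsum_enorm_le_seqNorm (m : ℕ) (lam : ℤ → ℂ) : ∑' k, ‖lam k‖ₑ ≤ seqNorm m lam := by
  refine ENNReal.tsum_le_tsum fun k => le_mul_of_one_le_left' (one_le_pow₀ le_self_add)

theorem realize_zero (c : ℤ → ℂ) : realize 0 c = ∑' n : ℤ, c n • zPow n := rfl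

theorem realize_succ (c : (ℕ → ℕ → Coeff ℓ) × (ℤ → ℂ)) : realize (ℓ + 1) c =
    ∑' jk : ℕ × ℕ, star (alpha ℓ) ^ jk.1 * pTensor (realize ℓ (c.1 jk.1 jk.2)) * alpha ℓ ^ jk.2
      + ∑' k : ℤ, c.2 k • alphaPow ℓ k := rfl

theorem mat_zPow (n : ℤ) (x y : Idx 0) : mat (zPow n) x y = if n = x.2 - y.2 then 1 else 0 := by
  have h : ((x.1, x.2 - n) : Idx 0) = y ↔ n = x.2 - y.2 := by
    constructor
    · intro h
      have := congrArg Prod.snd h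
      simp only at this
      omega
    · intro h
      refine Prod.ext (Subsingleton.elim _ _) ?_
      simp only
      omega
  refine (mat_pullback _ _ x y).trans ?_
  simp only [h]

/-- The building blocks are contractions and the weights are at least 1. The bound provides the
absolute convergence that allows matrix entries to be computed termwise. -/
theorem enorm_realize_le (c : Coeff ℓ) (m : ℕ) : ‖realize ℓ c‖ₑ ≤ seminorm ℓ m c := by
  induction ℓ with
  | zero =>
    rw [realize_zero c]
    refine (enorm_tsum_le _).trans (le_trans ?_ (tsum_enorm_le_seqNorm m c))
    exact ENNReal.tsum_le_tsum fun n => enorm_smul_le_enorm (norm_zPow_le n) _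
  | succ ℓ ih =>
    rw [seminorm_succ m c, realize_succ c]
    refine (enorm_add_le_add _ _).trans (add_le_add ?_ ?_)
    · refine (enorm_tsum_le _).trans (ENNReal.tsum_le_tsum fun jk => ?_)
      refine (enorm_corner_le _ _ _).trans ((ih _).trans ?_)
      refine le_mul_of_one_le_left' (one_le_pow₀ ?_)
      rw [add_assoc]
      exact le_self_add
    · refine (enorm_tsum_le _).trans (le_trans ?_ (tsum_enorm_le_seqNorm m c.2))
      exact ENNReal.tsum_le_tsum fun n => enorm_smul_le_enorm (norm_alphaPow_le n) _

theorem mat_realize_zero (c : ℤ → ℂ) {m : ℕ} (hc : seminorm 0 m c ≠ ∞) (x y : Idx 0) :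
    mat (realize 0 c) x y = c (x.2 - y.2) := by
  have hs : Summable fun n : ℤ => c n • zPow n :=
    summable_of_enorm_le (ne_top_of_le_ne_top hc (tsum_enorm_le_seqNorm m c))
      fun n => enorm_smul_le_enorm (norm_zPow_le n) _
  rw [realize_zero]
  refine (mat_tsum hs x y).unique ?_
  convert! hasSum_ite_eq (x.2 - y.2) (c (x.2 - y.2)) using 2 with n
  rw [mat_smul, mat_zPow]
  split_ifs with h
  · rw [h, mul_one]
  · rw [mul_zero]

/-- In block `(i, j)` both series collapse: only the corner with the same indices and the power `j -
i` of `α₁` have entries there. -/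
theorem mat_realize_succ (c : (ℕ → ℕ → Coeff ℓ) × (ℤ → ℂ)) {m : ℕ} (hc : seminorm (ℓ + 1) m c ≠ ∞) (i j : ℕ)
    (x y : Idx ℓ) : mat (realize (ℓ + 1) c) (ic i x) (ic j y) =
      mat (realize ℓ (c.1 i j)) x y + if x = y then c.2 (j - i) else 0 := by
  rw [seminorm_succ m c, ENNReal.add_ne_top] at hc
  have hs1 : Summable fun jk : ℕ × ℕ =>
      star (alpha ℓ) ^ jk.1 * pTensor (realize ℓ (c.1 jk.1 jk.2)) * alpha ℓ ^ jk.2 := by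
    refine summable_of_enorm_le hc.1 fun jk => ?_
    refine (enorm_corner_le _ _ _).trans ((enorm_realize_le _ m).trans ?_)
    refine le_mul_of_one_le_left' (one_le_pow₀ ?_)
    rw [add_assoc]
    exact le_self_add
  have hs2 : Summable fun k : ℤ => c.2 k • alphaPow ℓ k :=
    summable_of_enorm_le (ne_top_of_le_ne_top hc.2 (tsum_enorm_le_seqNorm m c.2))
      fun n => enorm_smul_le_enorm (norm_alphaPow_le n) _
  rw [realize_succ, mat_add]
  congr 1
  · refine (mat_tsum hs1 _ _).unique ?_
    convert! hasSum_ite_eq (i, j) (mat (realize ℓ (c.1 i j)) x y) using 2 with jk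
    rw [mat_corner]
    by_cases h : jk = (i, j)
    · subst h; simp
    · rw [if_neg h, if_neg]
      rintro ⟨rfl, rfl⟩
      exact h rfl
  · refine (mat_tsum hs2 _ _).unique ?_
    convert! hasSum_ite_eq ((j : ℤ) - i) (if x = y then c.2 (j - i) else 0) using 2 with k
    rw [mat_smul, mat_alphaPow]
    by_cases h : k = (j : ℤ) - i
    · subst h; simp
    · simp [h]

end Seminorms

/-! ### Quantitative smoothness -/

section SmoothAt

open Filter Topology

variable {ℓ : ℕ}

/-- A quantitative version of `IsSmooth` for a fixed exponent. -/
structure SmoothAt (N : ℕ) (C : ℝ) (t : Idx ℓ → Idx ℓ → ℂ) : Prop where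
  rapid : RapidAt 0 N C t
  sep : ∀ p, RapidAt (below p) N C fun x y => ((co p x : ℂ) - co p y) * t x y
  shift : ∀ i, RapidAt (upTo i) N C fun x y => t (sh (some i) x) (sh (some i) y) - t x y
  inv : ∀ x y, t (sh none x) (sh none y) = t x y

theorem SmoothAt.nonneg {N : ℕ} {C : ℝ} {t : Idx ℓ → Idx ℓ → ℂ} (h : SmoothAt N C t) : 0 ≤ C :=
  h.rapid.nonneg isWeight_zero

theorem RapidAt.mono {v : Idx ℓ → ℝ} {N : ℕ} {C C' : ℝ} {t : Idx ℓ → Idx ℓ → ℂ} (h : RapidAt v N C t)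
    (hC : C ≤ C') : RapidAt v N C' t := fun x y => (h x y).trans hC

theorem isSmooth_of_smoothAt {T : Hil ℓ →L[ℂ] Hil ℓ} (h : ∀ N, ∃ C, SmoothAt N C (mat T)) : IsSmooth T where
  rapid N := (h N).imp fun _ hC => hC.rapid
  sep p N := (h N).imp fun _ hC => hC.sep p
  shift i N := by
    obtain ⟨C, hC⟩ := h N
    refine ⟨C, fun x y => ?_⟩
    rw [mat_sub, mat_conj_shiftOp]
    exact hC.shift i x y
  inv := by
    obtain ⟨C, hC⟩ := h 0
    refine mat_injective fun x y => ?_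
    rw [mat_conj_shiftOp]
    exact hC.inv x y

theorem IsSmooth.exists_smoothAt {T : Hil ℓ →L[ℂ] Hil ℓ} (h : IsSmooth T) (N : ℕ) :
    ∃ C, SmoothAt N C (mat T) := by
  obtain ⟨C₁, h₁⟩ := h.rapid N
  choose f hf using fun p => h.sep p N
  choose g hg using fun i => h.shift i N
  obtain ⟨C₂, h₂⟩ := Finite.exists_le f
  obtain ⟨C₃, h₃⟩ := Finite.exists_le g
  refine ⟨max C₁ (max C₂ C₃), h₁.mono (le_max_left _ _), fun p => (hf p).mono ?_, fun i x y => ?_, fun x y => ?_⟩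
  · exact (h₂ p).trans ((le_max_left _ _).trans (le_max_right _ _))
  · have := hg i x y
    rw [mat_sub, mat_conj_shiftOp] at this
    exact this.trans ((h₃ i).trans ((le_max_right _ _).trans (le_max_right _ _)))
  · rw [← mat_conj_shiftOp, h.inv]

/-- Assembling a smooth matrix from its slices. -/
theorem SmoothAt.glue {N : ℕ} {B : ℝ} {K : ℕ → ℕ → ℝ} {a : ℕ → ℕ → Idx ℓ → Idx ℓ → ℂ} {lam : ℤ → ℂ}
    {t : Idx (ℓ + 1) → Idx (ℓ + 1) → ℂ} (ha : ∀ i j, SmoothAt N (K i j) (a i j))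
    (hK : ∀ i j : ℕ, 2 ^ N * ((1 + (i : ℝ) + j) ^ (N + 1) * K i j) ≤ B)
    (hlam : ∀ n : ℤ, (1 + |(n : ℝ)|) ^ (N + 1) * ‖lam n‖ ≤ B)
    (ht : ∀ i j x y, t (ic i x) (ic j y) = a i j x y + if x = y then lam (j - i) else 0) :
    SmoothAt N (2 * B) t := by
  -- Passing from the weight and distance of the slice to those of the full index costs `2^N (1 + i
  -- + j)^N`. The additional factor `1 + |i - j| ≤ 1 + i + j` is reserved for the commutator with
  -- the first coordinate.
  have h1 {v : Idx ℓ → ℝ} (hv : IsWeight v) {i j : ℕ} {b : Idx ℓ → Idx ℓ → ℂ}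
      (hb : RapidAt v N (K i j) b) (x y : Idx ℓ) :
      ‖b x y‖ * (1 + (i + v x) + (|(i : ℝ) - j| + offd x y)) ^ N * (1 + |(i : ℝ) - j|) ≤ B := by
    refine le_trans ?_ (hK i j)
    have o1 := offd_nonneg x y
    have o2 := hv.nonneg x
    have o3 := (ha i j).nonneg
    have e1 : |(i : ℝ) - j| ≤ i + j := abs_sub_le_of_nonneg_of_le (by positivity) (by linarith [(Nat.cast_nonneg j : (0:ℝ) ≤ j)])
        (by positivity) (by linarith [(Nat.cast_nonneg i : (0:ℝ) ≤ i)])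
    have e2 : 1 + (i + v x) + (|(i : ℝ) - j| + offd x y) ≤ 2 * (1 + (i : ℝ) + j) * (1 + v x + offd x y) := by
      have : (0 : ℝ) ≤ i := by positivity
      have : (0 : ℝ) ≤ j := by positivity
      nlinarith [mul_nonneg (add_nonneg o1 o2) (by positivity : (0 : ℝ) ≤ (i : ℝ) + j)]
    calc ‖b x y‖ * (1 + (i + v x) + (|(i : ℝ) - j| + offd x y)) ^ N * (1 + |(i : ℝ) - j|)
        ≤ ‖b x y‖ * (2 * (1 + (i : ℝ) + j) * (1 + v x + offd x y)) ^ N * (1 + (i : ℝ) + j) := by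
          gcongr ‖b x y‖ * ?_ ^ N * ?_
          linarith
      _ = 2 ^ N * ((1 + (i : ℝ) + j) ^ (N + 1) * (‖b x y‖ * (1 + v x + offd x y) ^ N)) := by
          rw [mul_pow, mul_pow]; ring
      _ ≤ _ := by
          have := hb x y
          gcongr
  have h1' {v : Idx ℓ → ℝ} (hv : IsWeight v) {i j : ℕ} {b : Idx ℓ → Idx ℓ → ℂ}
      (hb : RapidAt v N (K i j) b) (x y : Idx ℓ) :
      ‖b x y‖ * (1 + (i + v x) + (|(i : ℝ) - j| + offd x y)) ^ N ≤ B := by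
    refine le_trans ?_ (h1 hv hb x y)
    have o1 := offd_nonneg x y
    have o2 := hv.nonneg x
    exact le_mul_of_one_le_right (by positivity) (by linarith [abs_nonneg ((i : ℝ) - j)])
  have h2 (i j : ℕ) (x y : Idx ℓ) : ‖(if x = y then lam (j - i) else 0)‖ *
      (1 + (|(i : ℝ) - j| + offd x y)) ^ N * (1 + |(i : ℝ) - j|) ≤ B := by
    have h3 := hlam (j - i)
    push_cast at h3
    rw [abs_sub_comm] at h3
    split_ifs with h
    · subst h
      rw [offd_self, add_zero]
      linarith [h3, show ‖lam (j - i)‖ * (1 + |(i : ℝ) - j|) ^ N * (1 + |(i : ℝ) - j|)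
        = (1 + |(i : ℝ) - j|) ^ (N + 1) * ‖lam (j - i)‖ by ring]
    · rw [norm_zero, zero_mul, zero_mul]
      exact le_trans (by positivity) h3
  have h3 (i j : ℕ) (x y : Idx ℓ) :
      ‖t (ic i x) (ic j y)‖ * (1 + (|(i : ℝ) - j| + offd x y)) ^ N * (1 + |(i : ℝ) - j|) ≤ 2 * B := by
    have o1 := offd_nonneg x y
    have e1 := h1 isWeight_zero (ha i j).rapid x y
    have e2 := h2 i j x y
    rw [ht]
    calc _ ≤ (‖a i j x y‖ + ‖(if x = y then lam (j - i) else 0)‖) *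
          (1 + (|(i : ℝ) - j| + offd x y)) ^ N * (1 + |(i : ℝ) - j|) := by
          gcongr
          exact norm_add_le _ _
      _ = ‖a i j x y‖ * (1 + (|(i : ℝ) - j| + offd x y)) ^ N * (1 + |(i : ℝ) - j|) +
          ‖(if x = y then lam (j - i) else 0)‖ *
          (1 + (|(i : ℝ) - j| + offd x y)) ^ N * (1 + |(i : ℝ) - j|) := by ring
      _ ≤ B + B := by
          refine add_le_add (le_trans ?_ e1) e2
          have : (0 : ℝ) ≤ i + (0 : Idx ℓ → ℝ) x := by simp
          gcongr
          linarith
      _ = 2 * B := by ring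
  have hB : 0 ≤ B := by
    refine le_trans ?_ (hlam 0)
    positivity
  refine ⟨fun x' y' => ?_, fun p x' y' => ?_, fun i' x' y' => ?_, fun x' y' => ?_⟩ <;>
    obtain ⟨i, x, rfl⟩ := exists_eq_ic x' <;> obtain ⟨j, y, rfl⟩ := exists_eq_ic y'
  · have o1 := offd_nonneg x y
    rw [offd_ic, Pi.zero_apply, add_zero]
    refine le_trans ?_ (h3 i j x y)
    exact le_mul_of_one_le_right (by positivity) (by linarith [abs_nonneg ((i : ℝ) - j)])
  · rw [offd_ic]
    beta_reduce
    rcases eq_some_zero_or_up p with rfl | ⟨q, rfl⟩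
    · have o1 := offd_nonneg x y
      rw [co_zero_ic, co_zero_ic, below_zero_ic, add_zero, norm_mul]
      refine le_trans ?_ (h3 i j x y)
      have : ‖((i : ℝ) : ℂ) - (j : ℝ)‖ = |(i : ℝ) - j| := by
        rw [← Complex.ofReal_sub, Complex.norm_real, Real.norm_eq_abs]
      rw [this, mul_comm |(i : ℝ) - j|, mul_right_comm]
      gcongr
      linarith
    · rw [co_up_ic, co_up_ic, below_up_ic, ht, mul_add]
      -- The Toeplitz part is the identity in the remaining coordinates and commutes with them.
      have : ((co q x : ℂ) - co q y) * (if x = y then lam (j - i) else 0) = 0 := by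
        split_ifs with h
        · simp [h]
        · simp
      rw [this, add_zero]
      linarith [h1' (isWeight_below q) ((ha i j).sep q) x y]
  · rw [offd_ic]
    beta_reduce
    rcases eq_some_zero_or_up (some i') with h | ⟨q, h⟩
    · rw [Option.some_inj] at h
      subst h
      -- Shifting the first coordinate preserves `j - i`, so the Toeplitz part cancels; the two
      -- slices that remain are each small.
      rw [sh_zero_ic, sh_zero_ic, upTo_zero_ic, ht, ht]
      push_cast
      rw [add_sub_add_right_eq_sub, add_sub_add_right_eq_sub]
      have e1 := h1' isWeight_zero (ha (i + 1) (j + 1)).rapid x y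
      have e2 := h1' isWeight_zero (ha i j).rapid x y
      simp only [Pi.zero_apply, add_zero] at e1 e2
      push_cast at e1
      rw [add_sub_add_right_eq_sub] at e1
      have o1 := offd_nonneg x y
      calc _ ≤ (‖a (i + 1) (j + 1) x y‖ + ‖a i j x y‖) * (1 + (i : ℝ) + (|(i : ℝ) - j| + offd x y)) ^ N := by
            gcongr
            exact norm_sub_le _ _
        _ = ‖a (i + 1) (j + 1) x y‖ * (1 + (i : ℝ) + (|(i : ℝ) - j| + offd x y)) ^ N +
            ‖a i j x y‖ * (1 + (i : ℝ) + (|(i : ℝ) - j| + offd x y)) ^ N := by ring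
        _ ≤ B + B := by
            refine add_le_add (le_trans ?_ e1) e2
            gcongr
            linarith
        _ = 2 * B := by ring
    · cases q with
      | none => simp at h
      | some q =>
        obtain rfl : i' = q.succ := by simpa using h
        have hs (i : ℕ) (x : Idx ℓ) : sh (some q.succ) (ic i x) = ic i (sh (some q) x) := sh_up_ic (some q) i x
        rw [hs, hs, upTo_succ_ic, ht, ht]
        simp only [(sh_injective (some q)).eq_iff, add_sub_add_right_eq_sub]
        linarith [h1' (isWeight_upTo q) ((ha i j).shift q) x y]
  · have hs (i : ℕ) (x : Idx ℓ) : sh none (ic i x) = ic i (sh none x) := sh_up_ic none i x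
    rw [hs, hs, ht, ht, (ha i j).inv]
    simp only [(sh_injective none).eq_iff]

theorem seqNorm_bound {m : ℕ} {lam : ℤ → ℂ} (h : seqNorm m lam ≠ ∞) (n : ℤ) :
    (1 + |(n : ℝ)|) ^ m * ‖lam n‖ ≤ (seqNorm m lam).toReal := by
  have h1 := ENNReal.toReal_mono h (ENNReal.le_tsum (f := fun k : ℤ =>
    (1 + (k.natAbs : ℝ≥0∞)) ^ m * ‖lam k‖ₑ) n)
  rw [ENNReal.toReal_mul, ENNReal.toReal_pow, toReal_enorm, ENNReal.toReal_add (by simp) (by simp)] at h1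
  simpa [Nat.cast_natAbs] using h1

/-- The constant depends on the coefficients only linearly through a seminorm. This uniformity
drives the induction, where infinitely many slices are estimated at once. -/
theorem exists_smoothAt_realize (ℓ N : ℕ) : ∃ (m : ℕ) (K : ℝ), 0 ≤ K ∧ ∀ c : Coeff ℓ, seminorm ℓ m c ≠ ∞ →
    SmoothAt N (K * (seminorm ℓ m c).toReal) (mat (realize ℓ c)) := by
  induction ℓ with
  | zero =>
    refine ⟨N + 1, 1, zero_le_one, fun c hc => ?_⟩
    rw [one_mul]
    have hb (x y : Idx 0) : (1 + |(x.2 : ℝ) - y.2|) ^ (N + 1) * ‖mat (realize 0 c) x y‖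
        ≤ (seminorm 0 (N + 1) c).toReal := by
      rw [mat_realize_zero c hc]
      have := seqNorm_bound (lam := c) hc (x.2 - y.2)
      push_cast at this
      exact this
    have ho (x y : Idx 0) : offd x y = |(x.2 : ℝ) - y.2| := by simp [offd]
    refine ⟨fun x y => (le_trans ?_ (hb x y)), fun p x y => (le_trans ?_ (hb x y)), fun i => i.elim0, fun x y => ?_⟩
    · rw [Pi.zero_apply, add_zero, ho, mul_comm]
      gcongr
      · linarith [abs_nonneg ((x.2 : ℝ) - y.2)]
      · omega
    · cases p with
      | some i => exact i.elim0
      | none =>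
        have h0 : below none x = 0 := by
          rw [below, Finset.eq_empty_of_isEmpty (before none), Finset.sum_empty]
        have h1 : ‖(co none x : ℂ) - co none y‖ = |(x.2 : ℝ) - y.2| := by
          rw [← Complex.ofReal_sub, Complex.norm_real, Real.norm_eq_abs]; rfl
        rw [h0, add_zero, ho, norm_mul, h1, pow_succ, mul_comm (|(x.2 : ℝ) - y.2|), mul_comm, ← mul_assoc,
          mul_right_comm]
        gcongr
        linarith
    · rw [mat_realize_zero c hc, mat_realize_zero c hc]
      simp [sh]
  | succ ℓ ih =>
    obtain ⟨m, K, hK, h⟩ := ih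
    -- The exponent `m` serves the slices by induction, `N + 1` is the power lost in gluing.
    let M := max m (N + 1)
    -- The term `2 ^ N * K` bounds the slices, 1 the Toeplitz part, and the outer 2 comes from
    -- `SmoothAt.glue`.
    refine ⟨M, 2 * (2 ^ N * K + 1), by positivity, fun c hc => ?_⟩
    have hc' := hc
    rw [seminorm_succ, ENNReal.add_ne_top] at hc'
    have hM : N + 1 ≤ M := le_max_right _ _
    set A := (seminorm (ℓ + 1) M c).toReal
    have hA0 : 0 ≤ A := ENNReal.toReal_nonneg
    have hlam (n : ℤ) : (1 + |(n : ℝ)|) ^ (N + 1) * ‖c.2 n‖ ≤ A := by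
      have h1 := seqNorm_bound hc'.2 n
      refine le_trans ?_ (h1.trans (ENNReal.toReal_mono hc ?_))
      · gcongr
        linarith [abs_nonneg (n : ℝ)]
      · rw [seminorm_succ]
        exact le_add_self
    have hterm (i j : ℕ) : (1 + (i : ℝ≥0∞) + j) ^ M * seminorm ℓ M (c.1 i j) ≤ seminorm (ℓ + 1) M c := by
      rw [seminorm_succ]
      refine le_trans ?_ le_self_add
      exact ENNReal.le_tsum (f := fun jk : ℕ × ℕ =>
        (1 + (jk.1 : ℝ≥0∞) + jk.2) ^ M * seminorm ℓ M (c.1 jk.1 jk.2)) (i, j)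
    have hfin (i j : ℕ) : seminorm ℓ m (c.1 i j) ≠ ∞ := by
      refine ne_top_of_le_ne_top hc (le_trans ?_ (hterm i j))
      refine (seminorm_mono (le_max_left _ _) _).trans (le_mul_of_one_le_left' (one_le_pow₀ ?_))
      rw [add_assoc]
      exact le_self_add
    have hreal (i j : ℕ) : (1 + (i : ℝ) + j) ^ (N + 1) * (seminorm ℓ m (c.1 i j)).toReal ≤ A := by
      have h1 : (1 + (i : ℝ≥0∞) + j) ^ (N + 1) * seminorm ℓ m (c.1 i j) ≤ seminorm (ℓ + 1) M c := by
        refine le_trans (mul_le_mul' (pow_le_pow_right₀ ?_ hM) (seminorm_mono (le_max_left _ _) _)) (hterm i j)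
        rw [add_assoc]
        exact le_self_add
      have h2 := ENNReal.toReal_mono hc h1
      rw [ENNReal.toReal_mul, ENNReal.toReal_pow, ENNReal.toReal_add (by simp) (by simp),
        ENNReal.toReal_add (by simp) (by simp)] at h2
      simpa using h2
    rw [mul_assoc]
    refine SmoothAt.glue (K := fun i j => K * (seminorm ℓ m (c.1 i j)).toReal) (lam := c.2)
      (fun i j => h (c.1 i j) (hfin i j)) (fun i j => ?_) (fun n => ?_) (mat_realize_succ c hc)
    · calc 2 ^ N * ((1 + (i : ℝ) + j) ^ (N + 1) * (K * (seminorm ℓ m (c.1 i j)).toReal))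
          = 2 ^ N * K * ((1 + (i : ℝ) + j) ^ (N + 1) * (seminorm ℓ m (c.1 i j)).toReal) := by ring
        _ ≤ 2 ^ N * K * A := mul_le_mul_of_nonneg_left (hreal i j) (by positivity)
        _ ≤ (2 ^ N * K + 1) * A := by linarith
    · refine (hlam n).trans ?_
      have : 0 ≤ 2 ^ N * K * A := by positivity
      linarith

theorem isSmooth_of_mem_smoothAlgebra {a : Hil ℓ →L[ℂ] Hil ℓ} (ha : a ∈ smoothAlgebra ℓ) : IsSmooth a := by
  obtain ⟨c, hc, rfl⟩ := ha
  refine isSmooth_of_smoothAt fun N => ?_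
  obtain ⟨m, K, -, h⟩ := exists_smoothAt_realize ℓ N
  exact ⟨_, h c (hc m).ne⟩

end SmoothAt

/-! ### Recovering the coefficients of a smooth operator -/

section Coefficients

open Filter Topology

variable {ℓ : ℕ}

/-- The limit along the `n`-th diagonal in the first coordinate. -/
def diagLim (t : Idx (ℓ + 1) → Idx (ℓ + 1) → ℂ) (n : ℤ) : ℂ :=
  -- At least one of the two offsets is zero, so `k` runs through the whole `n`-th diagonal from its
  -- first entry. The value is meaningful only once convergence is known, as in
  -- `SmoothAt.tendsto_diag`.
  limUnder atTop fun k : ℕ => t (ic (k + (-n).toNat) (0, 0)) (ic (k + n.toNat) (0, 0))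

/-- The slice `(i, j)` of a matrix, with the limit along the diagonals removed. -/
def sliceAt (t : Idx (ℓ + 1) → Idx (ℓ + 1) → ℂ) (i j : ℕ) (x y : Idx ℓ) : ℂ :=
  t (ic i x) (ic j y) - if x = y then diagLim t (j - i) else 0

/-- The coefficients of a smooth matrix. -/
def coeff : (ℓ : ℕ) → (Idx ℓ → Idx ℓ → ℂ) → Coeff ℓ
  | 0, t => fun n : ℤ => t (0, n) (0, 0)
  | ℓ + 1, t => ((fun i j => coeff ℓ (sliceAt t i j), diagLim t) : (ℕ → ℕ → Coeff ℓ) × (ℤ → ℂ))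

theorem eq_of_shift_invariant {f : Idx ℓ → ℂ} (h : ∀ p x, f (sh p x) = f x) (x y : Idx ℓ) : f x = f y := by
  induction ℓ with
  | zero =>
    have key (n : ℤ) (g : Fin 0 → ℕ) : f (g, n) = f (g, 0) := by
      induction n using Int.induction_on with
      | zero => rfl
      | succ n ih => rw [← ih]; exact h none (g, n)
      | pred n ih =>
        rw [← ih, ← h none (g, -n - 1)]
        simp [sh]
    obtain ⟨g, n⟩ := x
    obtain ⟨g', n'⟩ := y
    rw [key n, key n', Subsingleton.elim g g']
  | succ ℓ ih =>
    obtain ⟨i, x, rfl⟩ := exists_eq_ic x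
    obtain ⟨j, y, rfl⟩ := exists_eq_ic y
    have h1 (k : ℕ) (z : Idx ℓ) : f (ic k z) = f (ic 0 z) := by
      induction k with
      | zero => rfl
      | succ k ihk => rw [← ihk, ← sh_zero_ic, h]
    rw [h1 i, h1 j]
    exact ih (f := fun z => f (ic 0 z)) (fun p z => by rw [← sh_up_ic, h]) x y

variable {t : Idx (ℓ + 1) → Idx (ℓ + 1) → ℂ} {N : ℕ} {C : ℝ}

/-- Of the `N + 2` powers of decay under the first shift, two are spent on `k` to make the
increments summable; the other `N` remain as decay in `i` and `|i - j|`. -/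
theorem SmoothAt.norm_diag_sub_le (h : SmoothAt (N + 2) C t) (i j k : ℕ) (x : Idx ℓ) :
    ‖t (ic (i + k) x) (ic (j + k) x) - t (ic (i + (k + 1)) x) (ic (j + (k + 1)) x)‖ ≤
      C * ((1 + (i : ℝ) + |(i : ℝ) - j|) ^ N)⁻¹ * ((1 + (k : ℝ)) ^ 2)⁻¹ := by
  have h1 := h.shift 0 (ic (i + k) x) (ic (j + k) x)
  beta_reduce at h1
  rw [sh_zero_ic, sh_zero_ic, upTo_zero_ic, offd_ic, offd_self, add_zero, norm_sub_rev] at h1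
  push_cast at h1
  rw [add_sub_add_right_eq_sub, pow_add] at h1
  rw [← div_eq_mul_inv, ← div_eq_mul_inv, le_div_iff₀ (by positivity), le_div_iff₀ (by positivity)]
  refine le_trans ?_ h1
  rw [← add_assoc, ← add_assoc, mul_assoc, mul_comm ((1 + (k : ℝ)) ^ 2)]
  have := abs_nonneg ((i : ℝ) - j)
  have hk : (0 : ℝ) ≤ k := by positivity
  have hi : (0 : ℝ) ≤ i := by positivity
  refine mul_le_mul_of_nonneg_left (mul_le_mul (pow_le_pow_left₀ (by positivity) ?_ _)
    (pow_le_pow_left₀ (by positivity) ?_ _) (by positivity) (by positivity)) (norm_nonneg _) <;> linarith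

theorem summable_inv_sq : Summable fun k : ℕ => ((1 + (k : ℝ)) ^ 2)⁻¹ := by
  have := (summable_nat_add_iff 1).2 (Real.summable_nat_pow_inv.2 (by norm_num : 1 < 2))
  simpa [add_comm] using this

/-- The entries of a smooth matrix converge along each diagonal, with limit independent of the remaining
coordinates. -/
theorem SmoothAt.tendsto_diag (h : SmoothAt (N + 2) C t) (i j : ℕ) (x : Idx ℓ) :
    Tendsto (fun k => t (ic (i + k) x) (ic (j + k) x)) atTop (𝓝 (diagLim t (j - i))) := by
  have hex (i j : ℕ) (x : Idx ℓ) : ∃ L, Tendsto (fun k => t (ic (i + k) x) (ic (j + k) x)) atTop (𝓝 L) := by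
    refine cauchySeq_tendsto_of_complete (cauchySeq_of_dist_le_of_summable _ (fun k => ?_)
      (summable_inv_sq.mul_left (C * ((1 + (i : ℝ) + |(i : ℝ) - j|) ^ N)⁻¹)))
    rw [dist_eq_norm]
    exact h.norm_diag_sub_le i j k x
  choose L hL using hex
  -- Invariance in the integer direction is exact. In a natural direction the error decays in all
  -- coordinates up to that one, including the first, which is `i + k` and tends to infinity.
  have hshift (p : Option (Fin ℓ)) (x : Idx ℓ) : L i j (sh p x) = L i j x := by
    refine tendsto_nhds_unique (hL i j (sh p x)) ?_
    cases p with
    | none =>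
      have e (k : ℕ) : t (ic (i + k) (sh none x)) (ic (j + k) (sh none x)) = t (ic (i + k) x) (ic (j + k) x) := by
        have := h.inv (ic (i + k) x) (ic (j + k) x)
        rwa [show (none : Option (Fin (ℓ + 1))) = up none from rfl, sh_up_ic, sh_up_ic] at this
      simpa only [e] using hL i j x
    | some q =>
      have e (k : ℕ) : ‖t (ic (i + k) (sh (some q) x)) (ic (j + k) (sh (some q) x)) - t (ic (i + k) x) (ic (j + k) x)‖
          ≤ C * ((1 + (k : ℝ)) ^ 2)⁻¹ := by
        have h1 := h.shift q.succ (ic (i + k) x) (ic (j + k) x)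
        beta_reduce at h1
        rw [show some q.succ = up (some q) from rfl, sh_up_ic, sh_up_ic, upTo_succ_ic] at h1
        rw [← div_eq_mul_inv, le_div_iff₀ (by positivity)]
        refine le_trans (mul_le_mul_of_nonneg_left ?_ (norm_nonneg _)) h1
        have o1 := offd_nonneg (ic (i + k) x) (ic (j + k) x)
        have o2 := (isWeight_upTo q).nonneg x
        have o3 : (0 : ℝ) ≤ i := by positivity
        have o4 : (0 : ℝ) ≤ k := by positivity
        push_cast
        calc (1 + (k : ℝ)) ^ 2 ≤ (1 + (k : ℝ)) ^ (N + 2) := pow_le_pow_right₀ (by linarith) (by omega)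
          _ ≤ _ := pow_le_pow_left₀ (by positivity) (by linarith) _
      have h0 : Tendsto (fun k : ℕ => C * ((1 + (k : ℝ)) ^ 2)⁻¹) atTop (𝓝 0) :=
        (summable_inv_sq.mul_left C).tendsto_atTop_zero
      have h2 := (squeeze_zero_norm e h0).add (hL i j x)
      simpa using h2
  have hconst : L i j x = L i j (0, 0) := eq_of_shift_invariant hshift x (0, 0)
  have hlim : Tendsto (fun k : ℕ => t (ic (k + (-((j : ℤ) - i)).toNat) (0, 0)) (ic (k + ((j : ℤ) - i).toNat) (0, 0)))
      atTop (𝓝 (diagLim t (j - i))) := by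
    have := hL (-((j : ℤ) - i)).toNat ((j : ℤ) - i).toNat (0, 0)
    simp only [add_comm _] at this
    exact tendsto_nhds_limUnder ⟨_, this⟩
  -- The diagonal starting at `(i, j)` is the full diagonal `j - i` entered at step `min i j`.
  have h3 := hlim.comp (tendsto_add_atTop_nat (min i j))
  have e (k : ℕ) : t (ic (k + min i j + (-((j : ℤ) - i)).toNat) (0, 0)) (ic (k + min i j + ((j : ℤ) - i).toNat) (0, 0))
      = t (ic (i + k) (0, 0)) (ic (j + k) (0, 0)) := by
    rw [show k + min i j + (-((j : ℤ) - i)).toNat = i + k by omega,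
      show k + min i j + ((j : ℤ) - i).toNat = j + k by omega]
  simp only [Function.comp_def, e] at h3
  rw [tendsto_nhds_unique h3 (hL i j (0, 0)), ← hconst]
  exact hL i j x

theorem SmoothAt.norm_diagLim_le (h : SmoothAt (N + 2) C t) (n : ℤ) :
    ‖diagLim t n‖ * (1 + |(n : ℝ)|) ^ (N + 2) ≤ C := by
  have h1 := h.tendsto_diag (-n).toNat n.toNat (0, 0)
  rw [show ((n.toNat : ℕ) : ℤ) - ((-n).toNat : ℕ) = n by omega] at h1
  refine le_of_tendsto (h1.norm.mul_const _) (Eventually.of_forall fun k => ?_)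
  have h2 := h.rapid (ic ((-n).toNat + k) (0, 0)) (ic (n.toNat + k) (0, 0))
  rw [offd_ic, offd_self] at h2
  push_cast at h2
  rw [add_sub_add_right_eq_sub, abs_sub_comm] at h2
  have e : ((n.toNat : ℕ) : ℝ) - ((-n).toNat : ℕ) = n := by
    exact_mod_cast (by omega : ((n.toNat : ℕ) : ℤ) - ((-n).toNat : ℕ) = n)
  rw [e] at h2
  simpa using h2

/-- The increments of `norm_diag_sub_le` telescope from `k = 0` to the limit. -/
theorem SmoothAt.norm_diag_sub_diagLim_le (h : SmoothAt (N + 2) C t) (i j : ℕ) (x : Idx ℓ) :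
    ‖t (ic i x) (ic j x) - diagLim t (j - i)‖ * (1 + (i : ℝ) + |(i : ℝ) - j|) ^ N ≤
      C * ∑' k : ℕ, ((1 + (k : ℝ)) ^ 2)⁻¹ := by
  have h1 := dist_le_tsum_of_dist_le_of_tendsto₀ (f := fun k => t (ic (i + k) x) (ic (j + k) x))
    _ (fun k => (dist_eq_norm _ _).trans_le (h.norm_diag_sub_le i j k x))
    (summable_inv_sq.mul_left (C * ((1 + (i : ℝ) + |(i : ℝ) - j|) ^ N)⁻¹)) (h.tendsto_diag i j x)
  rw [dist_eq_norm, tsum_mul_left, mul_right_comm, ← div_eq_mul_inv, le_div_iff₀ (by positivity)] at h1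
  exact h1

/-- The slices of a smooth matrix are smooth and decrease rapidly. -/
theorem exists_smoothAt_sliceAt (N M : ℕ) : ∃ K : ℝ, 0 ≤ K ∧
    ∀ {ℓ : ℕ} {t : Idx (ℓ + 1) → Idx (ℓ + 1) → ℂ} {C : ℝ}, SmoothAt (M + N + 2) C t →
      ∀ i j : ℕ, SmoothAt N (K * C * ((1 + (i : ℝ) + j) ^ M)⁻¹) (sliceAt t i j) := by
  have hZ : 0 ≤ ∑' k : ℕ, ((1 + (k : ℝ)) ^ 2)⁻¹ := tsum_nonneg fun k => by positivity
  set Z := ∑' k : ℕ, ((1 + (k : ℝ)) ^ 2)⁻¹ with hZdef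
  refine ⟨2 ^ M * (Z + 1), by positivity, fun {ℓ t C} h i j => ?_⟩
  have hC := h.nonneg
  have key (i j : ℕ) (a b : ℝ) (ha : 0 ≤ a) (hb : 0 ≤ b) :
      (1 + (i : ℝ) + j) ^ M * (1 + a + b) ^ N ≤ 2 ^ M * (1 + (i + a) + (|(i : ℝ) - j| + b)) ^ (M + N + 2) := by
    have e1 : (1 + (i : ℝ) + j) ≤ 2 * (1 + (i + a) + (|(i : ℝ) - j| + b)) := by
      linarith [neg_abs_le ((i : ℝ) - j), abs_nonneg ((i : ℝ) - j), (Nat.cast_nonneg i : (0 : ℝ) ≤ i)]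
    have e2 : 1 + a + b ≤ 1 + (i + a) + (|(i : ℝ) - j| + b) := by
      linarith [abs_nonneg ((i : ℝ) - j), (Nat.cast_nonneg i : (0 : ℝ) ≤ i)]
    have e3 : 1 ≤ 1 + (i + a) + (|(i : ℝ) - j| + b) := by linarith
    calc (1 + (i : ℝ) + j) ^ M * (1 + a + b) ^ N
        ≤ (2 * (1 + (i + a) + (|(i : ℝ) - j| + b))) ^ M * (1 + (i + a) + (|(i : ℝ) - j| + b)) ^ N := by gcongr
      _ = 2 ^ M * (1 + (i + a) + (|(i : ℝ) - j| + b)) ^ (M + N) := by rw [mul_pow, pow_add]; ring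
      _ ≤ _ := mul_le_mul_of_nonneg_left (pow_le_pow_right₀ e3 (by omega)) (by positivity)
  have fin {w : ℝ} (hw : 0 ≤ w) {a b : ℝ} (ha : 0 ≤ a) (hb : 0 ≤ b)
      (hle : w * (1 + (i + a) + (|(i : ℝ) - j| + b)) ^ (M + N + 2) ≤ C) :
      w * (1 + a + b) ^ N ≤ 2 ^ M * (Z + 1) * C * ((1 + (i : ℝ) + j) ^ M)⁻¹ := by
    rw [← div_eq_mul_inv, le_div_iff₀ (by positivity)]
    calc w * (1 + a + b) ^ N * (1 + (i : ℝ) + j) ^ M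
        = w * ((1 + (i : ℝ) + j) ^ M * (1 + a + b) ^ N) := by ring
      _ ≤ w * (2 ^ M * (1 + (i + a) + (|(i : ℝ) - j| + b)) ^ (M + N + 2)) :=
          mul_le_mul_of_nonneg_left (key i j a b ha hb) hw
      _ = 2 ^ M * (w * (1 + (i + a) + (|(i : ℝ) - j| + b)) ^ (M + N + 2)) := by ring
      _ ≤ 2 ^ M * ((Z + 1) * C) := by
          refine mul_le_mul_of_nonneg_left (hle.trans ?_) (by positivity)
          nlinarith
      _ = 2 ^ M * (Z + 1) * C := by ring
  have sepAt (p : Option (Fin ℓ)) (x y : Idx ℓ) :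
      ‖((co p x : ℂ) - co p y) * t (ic i x) (ic j y)‖ *
        (1 + (i + below p x) + (|(i : ℝ) - j| + offd x y)) ^ (M + N + 2) ≤ C := by
    have := h.sep (up p) (ic i x) (ic j y)
    beta_reduce at this
    rwa [co_up_ic, co_up_ic, below_up_ic, offd_ic] at this
  refine ⟨fun x y => ?_, fun p x y => ?_, fun q x y => ?_, fun x y => ?_⟩
  -- On the diagonal of the slice, decay in `i` and `j` is the rate of convergence to the subtracted
  -- limit. Off the diagonal nothing is subtracted, and some coordinate separates `x` from `y` by at
  -- least 1, so `sep` applies; its weight includes `i`.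
  · by_cases hxy : x = y
    · subst hxy
      rw [offd_self, Pi.zero_apply, add_zero, add_zero, one_pow, mul_one, ← div_eq_mul_inv,
        le_div_iff₀ (by positivity), sliceAt, if_pos rfl]
      have h1 := SmoothAt.norm_diag_sub_diagLim_le (N := M + N) h i j x
      rw [← hZdef] at h1
      have h2 := key i j 0 0 le_rfl le_rfl
      have h3 : (1 + (i : ℝ) + j) ^ M ≤ 2 ^ M * (1 + (i : ℝ) + |(i : ℝ) - j|) ^ (M + N) := by
        have e1 : (1 + (i : ℝ) + j) ≤ 2 * (1 + i + |(i : ℝ) - j|) := by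
          linarith [neg_abs_le ((i : ℝ) - j), abs_nonneg ((i : ℝ) - j), (Nat.cast_nonneg i : (0 : ℝ) ≤ i)]
        have e3 : 1 ≤ 1 + (i : ℝ) + |(i : ℝ) - j| := by
          linarith [abs_nonneg ((i : ℝ) - j), (Nat.cast_nonneg i : (0 : ℝ) ≤ i)]
        calc (1 + (i : ℝ) + j) ^ M ≤ (2 * (1 + i + |(i : ℝ) - j|)) ^ M := by gcongr
          _ = 2 ^ M * (1 + i + |(i : ℝ) - j|) ^ M := mul_pow _ _ _
          _ ≤ _ := mul_le_mul_of_nonneg_left (pow_le_pow_right₀ e3 (by omega)) (by positivity)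
      calc ‖t (ic i x) (ic j x) - diagLim t (j - i)‖ * (1 + (i : ℝ) + j) ^ M
          ≤ ‖t (ic i x) (ic j x) - diagLim t (j - i)‖ * (2 ^ M * (1 + (i : ℝ) + |(i : ℝ) - j|) ^ (M + N)) := by
            gcongr
        _ = 2 ^ M * (‖t (ic i x) (ic j x) - diagLim t (j - i)‖ * (1 + (i : ℝ) + |(i : ℝ) - j|) ^ (M + N)) := by ring
        _ ≤ 2 ^ M * (C * Z) := mul_le_mul_of_nonneg_left h1 (by positivity)
        _ ≤ 2 ^ M * (C * (Z + 1)) := by gcongr; linarith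
        _ = 2 ^ M * (Z + 1) * C := by ring
    · obtain ⟨p, hp⟩ : ∃ p, co p x ≠ co p y := by
        by_contra! h'
        exact hxy (co_injective h')
      have h6 : 1 ≤ ‖(co p x : ℂ) - co p y‖ := by
        rw [← Complex.ofReal_sub, Complex.norm_real, Real.norm_eq_abs]
        cases p with
        | none =>
          simp only [co, ne_eq, Int.cast_inj] at hp ⊢
          exact_mod_cast Int.one_le_abs (sub_ne_zero.2 hp)
        | some q =>
          simp only [co, ne_eq, Nat.cast_inj] at hp ⊢
          have : (1 : ℤ) ≤ |(x.1 q : ℤ) - y.1 q| := Int.one_le_abs (by omega)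
          exact_mod_cast this
      have o1 := (isWeight_below p).nonneg x
      have o2 := offd_nonneg x y
      have h7 := sepAt p x y
      rw [norm_mul] at h7
      have h8 : sliceAt t i j x y = t (ic i x) (ic j y) := by rw [sliceAt, if_neg hxy, sub_zero]
      rw [h8]
      refine le_trans ?_ (fin (norm_nonneg (t (ic i x) (ic j y))) o1 o2 (le_trans ?_ h7))
      · rw [Pi.zero_apply]
        gcongr
      · have : (0 : ℝ) ≤ |(i : ℝ) - j| := abs_nonneg _
        refine mul_le_mul_of_nonneg_right ?_ (by positivity)
        exact le_mul_of_one_le_left (norm_nonneg _) h6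
  -- The subtracted limit sits at `x = y`, where the coordinate difference vanishes.
  · have e : ((co p x : ℂ) - co p y) * sliceAt t i j x y = ((co p x : ℂ) - co p y) * t (ic i x) (ic j y) := by
      rw [sliceAt]
      split_ifs with h
      · simp [h]
      · rw [sub_zero]
    beta_reduce
    rw [e]
    exact fin (norm_nonneg _) ((isWeight_below p).nonneg x) (offd_nonneg x y) (sepAt p x y)
  · have h1 := h.shift q.succ (ic i x) (ic j y)
    beta_reduce at h1
    rw [show some q.succ = up (some q) from rfl, sh_up_ic, sh_up_ic, upTo_succ_ic, offd_ic] at h1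
    have e : sliceAt t i j (sh (some q) x) (sh (some q) y) - sliceAt t i j x y =
        t (ic i (sh (some q) x)) (ic j (sh (some q) y)) - t (ic i x) (ic j y) := by
      simp only [sliceAt, (sh_injective (some q)).eq_iff]
      ring
    beta_reduce
    rw [e]
    exact fin (norm_nonneg _) ((isWeight_upTo q).nonneg x) (offd_nonneg x y) h1
  · have h1 := h.inv (ic i x) (ic j y)
    rw [show (none : Option (Fin (ℓ + 1))) = up none from rfl, sh_up_ic, sh_up_ic] at h1
    simp only [sliceAt, (sh_injective none).eq_iff, h1]

theorem ennreal_tsum_ofReal_le {α : Type*} {f : α → ℝ} (hf : ∀ a, 0 ≤ f a) {G : ℝ}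
    (h : ∀ s : Finset α, ∑ a ∈ s, f a ≤ G) : ∑' a, ENNReal.ofReal (f a) ≤ ENNReal.ofReal G := by
  rw [ENNReal.tsum_eq_iSup_sum]
  refine iSup_le fun s => ?_
  rw [← ENNReal.ofReal_sum_of_nonneg fun a _ => hf a]
  exact ENNReal.ofReal_le_ofReal (h s)

theorem exists_seqNorm_le (m : ℕ) : ∃ K : ℝ, 0 ≤ K ∧ ∀ (lam : ℤ → ℂ) (C : ℝ), 0 ≤ C →
    (∀ n, ‖lam n‖ * (1 + |(n : ℝ)|) ^ (m + 2) ≤ C) → seqNorm m lam ≤ ENNReal.ofReal (K * C) := by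
  obtain ⟨G, hG0, hG⟩ := exists_sum_int_le
  refine ⟨G, hG0, fun lam C hC h => ?_⟩
  have hle (n : ℤ) : (1 + (n.natAbs : ℝ≥0∞)) ^ m * ‖lam n‖ₑ ≤ ENNReal.ofReal (C * ((1 + |(0 : ℤ) - (n : ℝ)|) ^ 2)⁻¹) := by
    have e : (1 + (n.natAbs : ℝ≥0∞)) ^ m * ‖lam n‖ₑ = ENNReal.ofReal ((1 + |(n : ℝ)|) ^ m * ‖lam n‖) := by
      rw [ENNReal.ofReal_mul (by positivity), ENNReal.ofReal_pow (by positivity),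
        ENNReal.ofReal_add zero_le_one (by positivity), ENNReal.ofReal_one, ofReal_norm,
        ← Int.cast_abs, Int.abs_eq_natAbs, Int.cast_natCast, ENNReal.ofReal_natCast]
    rw [e]
    refine ENNReal.ofReal_le_ofReal ?_
    rw [Int.cast_zero, zero_sub, abs_neg, ← div_eq_mul_inv, le_div_iff₀ (by positivity)]
    refine le_trans (le_of_eq ?_) (h n)
    ring
  refine (ENNReal.tsum_le_tsum hle).trans (ennreal_tsum_ofReal_le (fun n => by positivity) fun s => ?_)
  rw [← Finset.mul_sum, mul_comm]
  exact mul_le_mul_of_nonneg_right (hG 0 s) hC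

theorem exists_sum_nat_prod_le : ∃ G : ℝ, 0 ≤ G ∧ ∀ s : Finset (ℕ × ℕ),
    ∑ jk ∈ s, ((1 + (jk.1 : ℝ) + jk.2) ^ 4)⁻¹ ≤ G := by
  obtain ⟨G, hG0, hG⟩ := exists_sum_offd_le 1
  refine ⟨G, hG0, fun s => ?_⟩
  have h := hG (0, 0) (s.map ⟨fun jk : ℕ × ℕ => ((fun _ => jk.1, (jk.2 : ℤ)) : Idx 1), fun a b hab => by
    have h1 := congrFun (congrArg Prod.fst hab) 0
    have h2 := congrArg Prod.snd hab
    simp only [Nat.cast_inj] at h1 h2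
    exact Prod.ext h1 h2⟩)
  rw [Finset.sum_map] at h
  refine le_trans (le_of_eq (Finset.sum_congr rfl fun jk _ => ?_)) h
  change _ = ((1 + offd (0, 0) ((fun _ => jk.1, (jk.2 : ℤ)) : Idx 1)) ^ (2 * (1 + 1)))⁻¹
  simp [offd, add_assoc]

theorem exists_seminorm_coeff_le (ℓ m : ℕ) : ∃ (N : ℕ) (K : ℝ), 0 ≤ K ∧ ∀ (t : Idx ℓ → Idx ℓ → ℂ) (C : ℝ),
    SmoothAt N C t → seminorm ℓ m (coeff ℓ t) ≤ ENNReal.ofReal (K * C) := by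
  induction ℓ with
  | zero =>
    obtain ⟨K, hK, h⟩ := exists_seqNorm_le m
    refine ⟨m + 2, K, hK, fun t C ht => h _ C ht.nonneg fun n => ?_⟩
    have := ht.rapid (0, n) (0, 0)
    simpa [offd, coeff] using! this
  | succ ℓ ih =>
    obtain ⟨N, K, hK, h⟩ := ih
    obtain ⟨K₁, hK₁, h₁⟩ := exists_seqNorm_le m
    obtain ⟨K₂, hK₂, h₂⟩ := exists_smoothAt_sliceAt N (m + 4)
    obtain ⟨G, hG0, hG⟩ := exists_sum_nat_prod_le
    -- Here `m` powers absorb the weight of the seminorm, 4 make the sum over `ℕ × ℕ` converge, `N`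
    -- are the smoothness of the slices, and 2 are lost in the telescoping.
    refine ⟨m + 4 + N + 2, G * (K * K₂) + K₁, by positivity, fun t C ht => ?_⟩
    have hC := ht.nonneg
    rw [seminorm_succ, add_mul, ENNReal.ofReal_add (by positivity) (by positivity)]
    refine add_le_add ?_ ?_
    · have hle (jk : ℕ × ℕ) : (1 + (jk.1 : ℝ≥0∞) + jk.2) ^ m * seminorm ℓ m (coeff ℓ (sliceAt t jk.1 jk.2)) ≤
          ENNReal.ofReal (K * K₂ * C * ((1 + (jk.1 : ℝ) + jk.2) ^ 4)⁻¹) := by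
        have e1 := h _ _ (h₂ ht jk.1 jk.2)
        have e2 : (1 + (jk.1 : ℝ≥0∞) + jk.2) ^ m = ENNReal.ofReal ((1 + (jk.1 : ℝ) + jk.2) ^ m) := by
          rw [ENNReal.ofReal_pow (by positivity), ENNReal.ofReal_add (by positivity) (by positivity),
            ENNReal.ofReal_add (by positivity) (by positivity)]
          simp
        rw [e2]
        refine (mul_le_mul_right e1 _).trans ?_
        rw [← ENNReal.ofReal_mul (by positivity)]
        refine ENNReal.ofReal_le_ofReal (le_of_eq ?_)
        have : (1 + (jk.1 : ℝ) + jk.2) ≠ 0 := by positivity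
        rw [pow_add]
        field_simp
      refine (ENNReal.tsum_le_tsum hle).trans (ennreal_tsum_ofReal_le (fun jk => by positivity) fun s => ?_)
      rw [← Finset.mul_sum, mul_comm, ← mul_assoc]
      exact mul_le_mul_of_nonneg_right (mul_le_mul_of_nonneg_right (hG s) (by positivity)) hC |>.trans_eq (by ring)
    · refine h₁ _ C hC fun n => le_trans ?_ (SmoothAt.norm_diagLim_le ht n)
      refine mul_le_mul_of_nonneg_left (pow_le_pow_right₀ ?_ (by omega)) (norm_nonneg _)
      linarith [abs_nonneg (n : ℝ)]

theorem mat_realize_coeff (ℓ : ℕ) (t : Idx ℓ → Idx ℓ → ℂ) (ht : ∀ N, ∃ C, SmoothAt N C t) (x y : Idx ℓ) :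
    mat (realize ℓ (coeff ℓ t)) x y = t x y := by
  have hfin {ℓ : ℕ} {t : Idx ℓ → Idx ℓ → ℂ} (ht : ∀ N, ∃ C, SmoothAt N C t) :
      seminorm ℓ 0 (coeff ℓ t) ≠ ∞ := by
    obtain ⟨N, K, -, h⟩ := exists_seminorm_coeff_le ℓ 0
    obtain ⟨C, hC⟩ := ht N
    exact ne_top_of_le_ne_top ENNReal.ofReal_ne_top (h t C hC)
  induction ℓ with
  | zero =>
    refine (mat_realize_zero (coeff 0 t) (hfin ht) x y).trans ?_
    obtain ⟨C, hC⟩ := ht 0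
    -- For `ℓ = 0` shift invariance makes the matrix constant along the diagonal through `(x, y)`.
    have h1 := eq_of_shift_invariant (f := fun z : Idx 0 => t (z.1, x.2 - y.2 + z.2) z) (fun p z => by
      cases p with
      | some i => exact i.elim0
      | none =>
        refine Eq.trans ?_ (hC.inv (z.1, x.2 - y.2 + z.2) z)
        simp only [sh, add_assoc]) (0, 0) y
    have e1 : ((0, x.2 - y.2) : Idx 0) = (0, x.2 - y.2 + 0) := by rw [add_zero]
    have e2 : x = ((y.1, x.2 - y.2 + y.2) : Idx 0) := Prod.ext (Subsingleton.elim _ _) (by simp)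
    change t (0, x.2 - y.2) (0, 0) = _
    rw [e1]
    refine h1.trans ?_
    rw [← e2]
  | succ ℓ ih =>
    obtain ⟨i, x, rfl⟩ := exists_eq_ic x
    obtain ⟨j, y, rfl⟩ := exists_eq_ic y
    refine (mat_realize_succ (coeff (ℓ + 1) t) (hfin ht) i j x y).trans ?_
    have hs (N : ℕ) : ∃ C, SmoothAt N C (sliceAt t i j) := by
      obtain ⟨K, -, h⟩ := exists_smoothAt_sliceAt N 0
      obtain ⟨C, hC⟩ := ht (0 + N + 2)
      exact ⟨_, h hC i j⟩
    change mat (realize ℓ (coeff ℓ (sliceAt t i j))) x y + (if x = y then diagLim t (j - i) else 0) = _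
    rw [ih (sliceAt t i j) hs, sliceAt]
    ring

/-- Both directions are estimates: seminorms of coefficients control the decay of the matrix and
conversely. Closure under products can then be proved for `IsSmooth` instead of multiplying
expansions. -/
theorem mem_smoothAlgebra_iff {a : Hil ℓ →L[ℂ] Hil ℓ} : a ∈ smoothAlgebra ℓ ↔ IsSmooth a := by
  refine ⟨isSmooth_of_mem_smoothAlgebra, fun ha => ⟨coeff ℓ (mat a), fun m => ?_, ?_⟩⟩
  · obtain ⟨N, K, -, h⟩ := exists_seminorm_coeff_le ℓ m
    obtain ⟨C, hC⟩ := ha.exists_smoothAt N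
    exact (h _ C hC).trans_lt ENNReal.ofReal_lt_top
  · exact mat_injective (mat_realize_coeff ℓ (mat a) ha.exists_smoothAt)

/-- The smooth algebra is a unital `*`-algebra. -/
theorem exists_starSubalgebra (ℓ : ℕ) : ∃ S : StarSubalgebra ℂ (Hil ℓ →L[ℂ] Hil ℓ),
    (S : Set (Hil ℓ →L[ℂ] Hil ℓ)) = smoothAlgebra ℓ :=
  ⟨{ carrier := smoothAlgebra ℓ
     mul_mem' := fun ha hb => mem_smoothAlgebra_iff.2
       ((mem_smoothAlgebra_iff.1 ha).mul (mem_smoothAlgebra_iff.1 hb))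
     add_mem' := fun ha hb => mem_smoothAlgebra_iff.2
       ((mem_smoothAlgebra_iff.1 ha).add (mem_smoothAlgebra_iff.1 hb))
     algebraMap_mem' := fun r => mem_smoothAlgebra_iff.2 (by
       rw [Algebra.algebraMap_eq_smul_one]
       exact IsSmooth.one.smul r)
     star_mem' := fun ha => mem_smoothAlgebra_iff.2 (mem_smoothAlgebra_iff.1 ha).star }, rfl⟩

end Coefficients

/-! ### Diagonal operators: self-adjointness, compactness, approximation numbers -/

section DiagonalOperators

open Filter Topology

variable {ι : Type} [DecidableEq ι]

theorem dense_domain_diagOp (d : ι → ℝ) : Dense ((diagOp d).domain : Set (L2 ι)) := by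
  intro v
  refine mem_closure_of_tendsto (hasSum_basisVec v) (Eventually.of_forall fun s => ?_)
  exact Submodule.sum_mem _ fun i _ => Submodule.smul_mem _ _ (basisVec_mem_domain d i)

/-- Symmetry is immediate from real eigenvalues. Pairing the adjoint at `y` with basis vectors shows
that its coordinates are `d i * y i`, so `y` already lies in the maximal domain. -/
theorem isSelfAdjoint_diagOp (d : ι → ℝ) : IsSelfAdjoint (diagOp d) := by
  have hd := dense_domain_diagOp d
  rw [LinearPMap.isSelfAdjoint_def]
  have hle : diagOp d ≤ (diagOp d).adjoint := by
    refine LinearPMap.IsFormalAdjoint.le_adjoint hd fun x y => ?_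
    refine (lp.hasSum_inner (diagOp d x) (y : L2 ι)).unique ?_
    convert! lp.hasSum_inner (x : L2 ι) (diagOp d y) using 2 with i
    funext i
    change ⟪(d i : ℂ) * (x : L2 ι) i, (y : L2 ι) i⟫_ℂ = ⟪(x : L2 ι) i, (d i : ℂ) * (y : L2 ι) i⟫_ℂ
    simp only [RCLike.inner_apply, map_mul, Complex.conj_ofReal]
    ring
  refine (LinearPMap.eq_of_le_of_domain_eq hle (le_antisymm hle.1 fun y hy => ?_)).symm
  have hw (i : ι) : (d i : ℂ) * y i = ((diagOp d).adjoint ⟨y, hy⟩) i := by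
    have h1 := LinearPMap.adjoint_isFormalAdjoint hd ⟨y, hy⟩ ⟨basisVec i, basisVec_mem_domain d i⟩
    have h2 : diagOp d ⟨basisVec i, basisVec_mem_domain d i⟩ = (d i : ℂ) • basisVec i := by
      ext j
      change (d j : ℂ) * basisVec i j = (d i : ℂ) * basisVec i j
      rw [basisVec_apply]
      split_ifs with h
      · rw [h]
      · simp
    rw [h2, inner_smul_right, ← inner_conj_symm, inner_basisVec, ← inner_conj_symm y, inner_basisVec] at h1
    have h3 := congrArg (starRingEnd ℂ) h1
    simpa using h3.symm
  change Memℓp (fun i => (d i : ℂ) * y i) 2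
  simp only [hw]
  exact lp.memℓp _

/-- The restriction of a diagonal operator to finitely many coordinates. -/
def truncDiag (c : ι → ℂ) (s : Finset ι) : L2 ι →L[ℂ] L2 ι :=
  ∑ i ∈ s, (coordCLM i).smulRight (c i • basisVec i)

theorem truncDiag_apply (c : ι → ℂ) (s : Finset ι) (v : L2 ι) :
    truncDiag c s v = ∑ i ∈ s, v i • c i • basisVec i := by
  simp [truncDiag, coordCLM_apply]

theorem mat_truncDiag (c : ι → ℂ) (s : Finset ι) (x y : ι) :
    mat (truncDiag c s) x y = if x = y ∧ x ∈ s then c x else 0 := by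
  rw [mat, truncDiag_apply, ← coordCLM_apply, map_sum]
  simp only [map_smul, coordCLM_apply, basisVec_apply, smul_eq_mul, mul_ite, mul_one, mul_zero, ite_mul,
    one_mul, zero_mul]
  by_cases hxy : x = y
  · subst hxy
    simp
  · rw [if_neg (fun h => hxy h.1)]
    refine Finset.sum_eq_zero fun i _ => ?_
    split_ifs with h1 h2
    · exact absurd (h1.trans h2) hxy
    · rfl
    · rfl

theorem rank_truncDiag_le (c : ι → ℂ) (s : Finset ι) :
    ((truncDiag c s : L2 ι →L[ℂ] L2 ι) : L2 ι →ₗ[ℂ] L2 ι).rank ≤ s.card := by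
  have h : LinearMap.range ((truncDiag c s : L2 ι →L[ℂ] L2 ι) : L2 ι →ₗ[ℂ] L2 ι) ≤
      Submodule.span ℂ ((basisVec '' (s : Set ι)) : Set (L2 ι)) := by
    rintro _ ⟨v, rfl⟩
    rw [ContinuousLinearMap.coe_coe, truncDiag_apply]
    exact Submodule.sum_mem _ fun i hi => Submodule.smul_mem _ _ (Submodule.smul_mem _ _
      (Submodule.subset_span ⟨i, hi, rfl⟩))
  refine (Submodule.rank_mono h).trans ((rank_span_le _).trans (Cardinal.mk_image_le.trans ?_))
  simp

theorem isCompactOperator_truncDiag (c : ι → ℂ) (s : Finset ι) : IsCompactOperator (truncDiag c s) := by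
  have h : truncDiag c s ∈ compactOperator (RingHom.id ℂ) (L2 ι) (L2 ι) := by
    refine Submodule.sum_mem _ fun i _ => ?_
    exact (isCompactOperator_of_locallyCompactSpace_dom (coordCLM i)).clm_comp
      (ContinuousLinearMap.smulRight (1 : ℂ →L[ℂ] ℂ) (c i • basisVec i))
  exact h

theorem norm_diagCLM_sub_truncDiag_le {c : ι → ℂ} {C : ℝ} (hC : ∀ i, ‖c i‖ ≤ C) {s : Finset ι} {ε : ℝ}
    (hε : 0 ≤ ε) (hs : ∀ i ∉ s, ‖c i‖ ≤ ε) : ‖diagCLM c - truncDiag c s‖ ≤ ε := by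
  have hle (i : ι) : ‖(if i ∈ s then 0 else c i)‖ ≤ ε := by
    split_ifs with h
    · rwa [norm_zero]
    · exact hs i h
  have e : diagCLM c - truncDiag c s = diagCLM fun i => if i ∈ s then 0 else c i := by
    refine mat_injective fun x y => ?_
    rw [mat_sub, mat_diagCLM hC, mat_truncDiag, mat_diagCLM hle]
    by_cases hxy : x = y <;> by_cases hx : x ∈ s <;> simp [hxy, hx]
    · subst hxy; simp [hx]
    · subst hxy; simp [hx]
  rw [e]
  exact norm_diagCLM_le hε hle

theorem approxNumber_diagCLM_le {c : ι → ℂ} {C : ℝ} (hC : ∀ i, ‖c i‖ ≤ C) {s : Finset ι} {ε : ℝ}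
    (hε : 0 ≤ ε) (hs : ∀ i ∉ s, ‖c i‖ ≤ ε) {n : ℕ} (hn : s.card ≤ n) : approxNumber (diagCLM c) n ≤ ε := by
  have hb : BddBelow {r | ∃ F : L2 ι →L[ℂ] L2 ι, (F : L2 ι →ₗ[ℂ] L2 ι).rank ≤ n ∧ r = ‖diagCLM c - F‖} :=
    ⟨0, by rintro _ ⟨F, -, rfl⟩; exact norm_nonneg _⟩
  exact (csInf_le hb ⟨truncDiag c s, (rank_truncDiag_le c s).trans (by exact_mod_cast hn), rfl⟩).trans
    (norm_diagCLM_sub_truncDiag_le hC hε hs)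

theorem isCompactOperator_diagCLM {c : ι → ℂ} {C : ℝ} (hC : ∀ i, ‖c i‖ ≤ C)
    (h : ∀ n : ℕ, ∃ s : Finset ι, ∀ i ∉ s, ‖c i‖ ≤ 1 / ((n : ℝ) + 1)) : IsCompactOperator (diagCLM c) := by
  choose s hs using h
  refine isCompactOperator_of_tendsto (l := atTop) (F := fun n => truncDiag c (s n)) ?_
    (Eventually.of_forall fun n => isCompactOperator_truncDiag c (s n))
  rw [tendsto_iff_norm_sub_tendsto_zero]
  refine squeeze_zero (fun n => norm_nonneg _) (fun n => ?_) tendsto_one_div_add_atTop_nhds_zero_nat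
  rw [norm_sub_rev]
  exact norm_diagCLM_sub_truncDiag_le hC (by positivity) (hs n)

theorem hasCompactResolvent_diagOp {d : ι → ℝ}
    (h : ∀ n : ℕ, ∃ s : Finset ι, ∀ i ∉ s, (n : ℝ) + 1 ≤ |d i|) : HasCompactResolvent (diagOp d) := by
  have hne (i : ι) : (d i : ℂ) - Complex.I ≠ 0 := fun h0 => by
    have := congrArg Complex.im h0
    simp at this
  have h1 (i : ι) : ‖((d i : ℂ) - Complex.I)⁻¹‖ ≤ 1 := by
    rw [norm_inv]
    refine inv_le_one_of_one_le₀ ?_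
    simpa using Complex.abs_im_le_norm ((d i : ℂ) - Complex.I)
  have h2 (i : ι) : |d i| ≤ ‖(d i : ℂ) - Complex.I‖ := by
    simpa using Complex.abs_re_le_norm ((d i : ℂ) - Complex.I)
  -- The point `I` is off the real axis: `|d - I|` is at least 1 and at least `|d|`, so the
  -- resolvent is bounded and its coefficients tend to zero.
  refine ⟨Complex.I, diagCLM fun i => ((d i : ℂ) - Complex.I)⁻¹, ?_, fun x => ?_, fun x => ?_⟩
  · refine isCompactOperator_diagCLM h1 fun n => ?_
    obtain ⟨s, hs⟩ := h n
    refine ⟨s, fun i hi => ?_⟩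
    rw [norm_inv, ← one_div]
    exact one_div_le_one_div_of_le (by positivity) ((hs i hi).trans (h2 i))
  · have e : (fun i => (d i : ℂ) * (diagCLM (fun i => ((d i : ℂ) - Complex.I)⁻¹) x) i) =
        fun i => (x + Complex.I • diagCLM (fun i => ((d i : ℂ) - Complex.I)⁻¹) x) i := by
      ext i
      change _ = x i + Complex.I * (diagCLM (fun i => ((d i : ℂ) - Complex.I)⁻¹) x) i
      rw [diagCLM_apply h1]
      have := hne i
      field_simp
      ring
    have hm : diagCLM (fun i => ((d i : ℂ) - Complex.I)⁻¹) x ∈ (diagOp d).domain := by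
      change Memℓp (fun i => (d i : ℂ) * (diagCLM (fun i => ((d i : ℂ) - Complex.I)⁻¹) x) i) 2
      rw [e]
      exact lp.memℓp _
    refine ⟨hm, ?_⟩
    ext i
    have := congrFun e i
    change (d i : ℂ) * (diagCLM (fun i => ((d i : ℂ) - Complex.I)⁻¹) x) i
      - Complex.I * (diagCLM (fun i => ((d i : ℂ) - Complex.I)⁻¹) x) i = x i
    rw [this]
    change x i + Complex.I * (diagCLM (fun i => ((d i : ℂ) - Complex.I)⁻¹) x) i - _ = x i
    ring
  · ext i
    rw [diagCLM_apply h1]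
    change _ * ((d i : ℂ) * (x : L2 ι) i - Complex.I * (x : L2 ι) i) = _
    rw [← sub_mul, inv_mul_cancel_left₀ (hne i)]

end DiagonalOperators

/-! ### Summability of the Dirac operator -/

section Summability

variable {ℓ : ℕ}

/-- The `ℓ₁`-norm of an index as a natural number. -/
def natNrm (x : Idx ℓ) : ℕ := ∑ i, x.1 i + x.2.natAbs

theorem nrm_eq_natNrm (x : Idx ℓ) : nrm x = natNrm x := by
  simp [nrm, natNrm, Nat.cast_natAbs]

/-- A finite box in the index set. -/
def box (ℓ n : ℕ) : Finset (Idx ℓ) :=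
  (Fintype.piFinset fun _ => Finset.range (n + 1)) ×ˢ Finset.Icc (-(n : ℤ)) n

theorem card_box_le (ℓ n : ℕ) : (box ℓ n).card ≤ (2 * n + 1) ^ (ℓ + 1) := by
  rw [box, Finset.card_product, Fintype.card_piFinset, Finset.prod_const, Finset.card_range,
    Finset.card_univ, Fintype.card_fin, Int.card_Icc, pow_succ]
  refine Nat.mul_le_mul (Nat.pow_le_pow_left (by omega) _) (by omega)

theorem mem_box_of_natNrm_le {n : ℕ} {x : Idx ℓ} (h : natNrm x ≤ n) : x ∈ box ℓ n := by
  unfold natNrm at h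
  rw [box, Finset.mem_product, Fintype.mem_piFinset, Finset.mem_Icc]
  refine ⟨fun i => ?_, ?_, ?_⟩
  · have := Finset.single_le_sum (f := x.1) (fun i _ => Nat.zero_le _) (Finset.mem_univ i)
    rw [Finset.mem_range]
    omega
  · omega
  · omega

theorem le_abs_dirac_of_notMem_box {n : ℕ} {x : Idx ℓ} (h : x ∉ box ℓ n) : (n : ℝ) + 1 ≤ |dirac ℓ x| := by
  rw [abs_dirac, nrm_eq_natNrm]
  have : n + 1 ≤ natNrm x := by
    by_contra h'
    exact h (mem_box_of_natNrm_le (by omega))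
  exact_mod_cast this

theorem hasCompactResolvent_dirac (ℓ : ℕ) : HasCompactResolvent (diagOp (dirac ℓ)) :=
  hasCompactResolvent_diagOp fun n => ⟨box ℓ n, fun _ h => le_abs_dirac_of_notMem_box h⟩

open Classical in
/-- The eigenvalues of `|D|^{-z}`. -/
def powCoef (z : ℂ) (x : Idx ℓ) : ℂ :=
  if dirac ℓ x = 0 then 0 else ((|dirac ℓ x| : ℝ) : ℂ) ^ (-z)

theorem absPow_eq (z : ℂ) : absPow (dirac ℓ) z = diagCLM (powCoef z) := rfl

theorem powCoef_eq (z : ℂ) (x : Idx ℓ) :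
    powCoef z x = if natNrm x = 0 then 0 else (natNrm x : ℂ) ^ (-z) := by
  have h : dirac ℓ x = 0 ↔ natNrm x = 0 := by
    rw [← abs_eq_zero, abs_dirac, nrm_eq_natNrm, Nat.cast_eq_zero]
  unfold powCoef
  simp only [h, abs_dirac, nrm_eq_natNrm, Complex.ofReal_natCast]

theorem norm_powCoef (z : ℂ) {x : Idx ℓ} (hx : natNrm x ≠ 0) :
    ‖powCoef z x‖ = (natNrm x : ℝ) ^ (-z.re) := by
  rw [powCoef_eq, if_neg hx, Complex.norm_natCast_cpow_of_pos (Nat.pos_of_ne_zero hx), Complex.neg_re]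

theorem norm_powCoef_le_one {z : ℂ} (hz : 0 ≤ z.re) (x : Idx ℓ) : ‖powCoef z x‖ ≤ 1 := by
  by_cases hx : natNrm x = 0
  · rw [powCoef_eq, if_pos hx, norm_zero]
    exact zero_le_one
  · rw [norm_powCoef z hx]
    exact Real.rpow_le_one_of_one_le_of_nonpos (by exact_mod_cast Nat.one_le_iff_ne_zero.2 hx) (by linarith)

theorem approxNumber_absPow_le (ℓ k : ℕ) :
    approxNumber (absPow (dirac ℓ) (((ℓ : ℝ) + 1 : ℝ) : ℂ)) k ≤ 3 ^ (ℓ + 1) / ((k : ℝ) + 1) := by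
  have hre : 0 ≤ ((((ℓ : ℝ) + 1 : ℝ) : ℂ)).re := by
    rw [Complex.ofReal_re]; positivity
  rw [absPow_eq]
  rcases Nat.eq_zero_or_pos k with rfl | hk
  · refine (approxNumber_diagCLM_le (norm_powCoef_le_one hre) zero_le_one (s := ∅)
      (fun x _ => norm_powCoef_le_one hre x) (by simp)).trans ?_
    simp only [Nat.cast_zero, zero_add, div_one]
    exact one_le_pow₀ (by norm_num)
  -- The largest box whose size bound is at most `k`. Truncating to it costs at most `(n +
  -- 1)^{-(ℓ+1)}`, and `k + 1 ≤ (2n + 3)^{ℓ+1} ≤ (3(n + 1))^{ℓ+1}`.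
  obtain ⟨n, h1, h2⟩ : ∃ n : ℕ, (2 * n + 1) ^ (ℓ + 1) ≤ k ∧ k < (2 * n + 3) ^ (ℓ + 1) := by
    have hex : ∃ n : ℕ, k < (2 * n + 3) ^ (ℓ + 1) :=
      ⟨k, (by omega : k < 2 * k + 3).trans_le (Nat.le_self_pow (by omega) _)⟩
    classical
    refine ⟨Nat.find hex, ?_, Nat.find_spec hex⟩
    rcases Nat.eq_zero_or_pos (Nat.find hex) with h0 | h0
    · rw [h0, mul_zero, zero_add, one_pow]; exact hk
    · have := Nat.find_min hex (Nat.sub_lt h0 one_pos)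
      rw [not_lt] at this
      rwa [show 2 * (Nat.find hex - 1) + 3 = 2 * Nat.find hex + 1 by omega] at this
  refine (approxNumber_diagCLM_le (norm_powCoef_le_one hre) (s := box ℓ n)
    (ε := (((n : ℝ) + 1) ^ (ℓ + 1))⁻¹) (by positivity) (fun x hx => ?_)
    ((card_box_le ℓ n).trans h1)).trans ?_
  · have h3 : n + 1 ≤ natNrm x := by
      by_contra h'
      exact hx (mem_box_of_natNrm_le (by omega))
    have h3' : (n : ℝ) + 1 ≤ natNrm x := by exact_mod_cast h3
    rw [norm_powCoef _ (by omega), Complex.ofReal_re, Real.rpow_neg (by positivity)]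
    have : ((natNrm x : ℝ)) ^ ((ℓ : ℝ) + 1) = (natNrm x : ℝ) ^ (ℓ + 1) := by
      rw [← Real.rpow_natCast]; push_cast; rfl
    rw [this]
    gcongr
  · have h4 : (k : ℝ) + 1 ≤ (2 * (n : ℝ) + 3) ^ (ℓ + 1) := by exact_mod_cast h2
    have h5 : (2 * (n : ℝ) + 3) ^ (ℓ + 1) ≤ (3 * ((n : ℝ) + 1)) ^ (ℓ + 1) := by
      gcongr
      linarith [(Nat.cast_nonneg n : (0 : ℝ) ≤ n)]
    rw [mul_pow] at h5
    rw [inv_eq_one_div, div_le_div_iff₀ (by positivity) (by positivity)]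
    linarith

theorem isPlusSummable_dirac (ℓ : ℕ) : IsPlusSummable (dirac ℓ) ((ℓ : ℝ) + 1) := by
  -- The summand `1 / log 2` absorbs the 1 in `harmonic N ≤ 1 + log N`, since `N ≥ 2`.
  refine ⟨3 ^ (ℓ + 1) * (1 / Real.log 2 + 1), fun N hN => ?_⟩
  have hlog : Real.log 2 ≤ Real.log N := Real.log_le_log (by norm_num) (by exact_mod_cast hN)
  have hlog2 : 0 < Real.log 2 := Real.log_pos (by norm_num)
  have hh : ∑ k ∈ Finset.range N, 1 / ((k : ℝ) + 1) = (harmonic N : ℝ) := by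
    simp [harmonic]
  calc _ ≤ ∑ k ∈ Finset.range N, 3 ^ (ℓ + 1) * (1 / ((k : ℝ) + 1)) := by
        refine Finset.sum_le_sum fun k _ => ?_
        rw [mul_one_div]
        exact approxNumber_absPow_le ℓ k
    _ = 3 ^ (ℓ + 1) * (harmonic N : ℝ) := by rw [← Finset.mul_sum, hh]
    _ ≤ 3 ^ (ℓ + 1) * (1 + Real.log N) := by
        gcongr
        exact harmonic_le_one_add_log N
    _ ≤ 3 ^ (ℓ + 1) * ((1 / Real.log 2 + 1) * Real.log N) := by
        gcongr
        have : 1 ≤ 1 / Real.log 2 * Real.log N := by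
          rw [one_div, inv_mul_eq_div, one_le_div hlog2]
          exact hlog
        linarith
    _ = _ := by ring

end Summability

/-! ### Rapidly decreasing sequences and polynomial asymptotics -/

section Sequences

/-- A sequence that decreases faster than any power. -/
def RapidSeq (r : ℕ → ℂ) : Prop := ∀ N : ℕ, ∃ C : ℝ, ∀ n : ℕ, ‖r n‖ * (1 + (n : ℝ)) ^ N ≤ C

/-- A sequence that agrees with a polynomial of degree less than `m` up to a rapidly decreasing sequence. The
polynomial is expanded in binomial coefficients. -/
def HasExpansion (m : ℕ) (a : ℕ → ℂ) : Prop :=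
  ∃ c : ℕ → ℂ, RapidSeq fun n => a n - ∑ j ∈ Finset.range m, c j * ((n + j).choose j : ℂ)

theorem RapidSeq.norm_le {r : ℕ → ℂ} (h : RapidSeq r) (N : ℕ) :
    ∃ C : ℝ, 0 ≤ C ∧ ∀ n : ℕ, ‖r n‖ ≤ C * ((1 + (n : ℝ)) ^ N)⁻¹ := by
  obtain ⟨C, hC⟩ := h N
  refine ⟨C, le_trans (by positivity) (hC 0), fun n => ?_⟩
  rw [← div_eq_mul_inv, le_div_iff₀ (by positivity)]
  exact hC n

theorem RapidSeq.summable {r : ℕ → ℂ} (h : RapidSeq r) : Summable r := by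
  obtain ⟨C, -, hC⟩ := h.norm_le 2
  exact Summable.of_norm_bounded (summable_inv_sq.mul_left C) hC

/-- The partial sums of a rapidly decreasing sequence converge rapidly. -/
theorem RapidSeq.sum {r : ℕ → ℂ} (h : RapidSeq r) :
    RapidSeq fun n => ∑ k ∈ Finset.range (n + 1), r k - ∑' k, r k := by
  intro N
  obtain ⟨C, hC0, hC⟩ := h.norm_le (N + 2)
  have hs := summable_inv_sq
  refine ⟨C * ∑' k : ℕ, ((1 + (k : ℝ)) ^ 2)⁻¹, fun n => ?_⟩
  have h1 (k : ℕ) : ‖r (k + (n + 1))‖ ≤ C * ((1 + (n : ℝ)) ^ N)⁻¹ * ((1 + (k : ℝ)) ^ 2)⁻¹ := by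
    refine (hC _).trans ?_
    rw [mul_assoc, ← mul_inv, pow_add]
    push_cast
    gcongr <;> linarith [(Nat.cast_nonneg n : (0 : ℝ) ≤ n), (Nat.cast_nonneg k : (0 : ℝ) ≤ k)]
  have h2 := tsum_of_norm_bounded (hs.mul_left (C * ((1 + (n : ℝ)) ^ N)⁻¹)).hasSum h1
  beta_reduce
  rw [← h.summable.sum_add_tsum_nat_add (n + 1), sub_add_cancel_left, norm_neg]
  calc _ ≤ (∑' k : ℕ, C * ((1 + (n : ℝ)) ^ N)⁻¹ * ((1 + (k : ℝ)) ^ 2)⁻¹) * (1 + (n : ℝ)) ^ N := by gcongr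
    _ = _ := by
      rw [tsum_mul_left]
      field_simp

/-- Discrete integration. By the hockey-stick identity summation raises each binomial coefficient by
one degree, which is the reason for the binomial basis. The sum of the rapid remainder is a
constant, the new coefficient of degree 0, up to a rapid tail. -/
theorem HasExpansion.of_diff {m : ℕ} {a b : ℕ → ℂ} (hb : HasExpansion m b) (h0 : b 0 = a 0)
    (h : ∀ n, b (n + 1) = a (n + 1) - a n) : HasExpansion (m + 1) a := by
  obtain ⟨c, hc⟩ := hb
  set r : ℕ → ℂ := fun n => b n - ∑ j ∈ Finset.range m, c j * ((n + j).choose j : ℂ) with hr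
  refine ⟨fun j => if j = 0 then ∑' k, r k else c (j - 1), ?_⟩
  convert! hc.sum using 2 with n
  have ha : a n = ∑ k ∈ Finset.range (n + 1), b k := by
    induction n with
    | zero => simp [h0]
    | succ n ih => rw [Finset.sum_range_succ, ← ih, h]; ring
  have hsum (j : ℕ) : ∑ k ∈ Finset.range (n + 1), ((k + j).choose j : ℂ) = ((n + (j + 1)).choose (j + 1) : ℂ) := by
    rw [← Nat.cast_sum, Nat.sum_range_add_choose, add_assoc]
  have hshift : ∑ j ∈ Finset.range (m + 1), (if j = 0 then ∑' k, r k else c (j - 1)) * ((n + j).choose j : ℂ) =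
      ∑ j ∈ Finset.range m, c j * ((n + (j + 1)).choose (j + 1) : ℂ) + ∑' k, r k := by
    rw [Finset.sum_range_succ']
    simp
  have hr' : ∑ k ∈ Finset.range (n + 1), r k = ∑ k ∈ Finset.range (n + 1), b k -
      ∑ j ∈ Finset.range m, c j * ((n + (j + 1)).choose (j + 1) : ℂ) := by
    simp only [hr, Finset.sum_sub_distrib]
    rw [Finset.sum_comm]
    simp only [← Finset.mul_sum, hsum]
  rw [ha, hshift, hr']
  ring

open Polynomial in
theorem exists_polynomial_choose (j : ℕ) :
    ∃ P : ℂ[X], P.natDegree ≤ j ∧ ∀ n : ℕ, P.eval (n : ℂ) = ((n + j).choose j : ℂ) := by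
  refine ⟨C ((j.factorial : ℂ)⁻¹) * (ascPochhammer ℂ j).comp (X + 1), ?_, fun n => ?_⟩
  · refine (natDegree_C_mul_le _ _).trans ?_
    rw [natDegree_comp, ascPochhammer_natDegree]
    have : (X + 1 : ℂ[X]).natDegree ≤ 1 := by
      simpa using (natDegree_X_add_C (1 : ℂ)).le
    nlinarith
  · have h := Nat.ascFactorial_eq_factorial_mul_choose n j
    have h' : (ascPochhammer ℂ j).eval ((n + 1 : ℕ) : ℂ) = ((n + 1).ascFactorial j : ℕ) := by
      rw [← ascPochhammer_nat_eq_ascFactorial, ascPochhammer_eval_cast]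
    rw [eval_mul, eval_C, eval_comp, eval_add, eval_X, eval_one, ← Nat.cast_one, ← Nat.cast_add, h', h]
    push_cast
    rw [inv_mul_cancel_left₀ (by exact_mod_cast j.factorial_ne_zero)]

open Polynomial in
-- Powers of `n` are needed because the Dirichlet series of `n^j` is `ζ(z - j)`.
theorem HasExpansion.exists_pow {m : ℕ} {a : ℕ → ℂ} (h : HasExpansion m a) :
    ∃ p : ℕ → ℂ, RapidSeq fun n => a n - ∑ j ∈ Finset.range m, p j * (n : ℂ) ^ j := by
  obtain ⟨c, hc⟩ := h
  choose P hP hP' using exists_polynomial_choose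
  set Q : ℂ[X] := ∑ j ∈ Finset.range m, C (c j) * P j with hQ
  refine ⟨Q.coeff, ?_⟩
  convert! hc using 3 with n
  rcases Nat.eq_zero_or_pos m with rfl | hm
  · simp
  have hdeg : Q.natDegree < m := by
    refine lt_of_le_of_lt (natDegree_sum_le_of_forall_le (n := m - 1) _ _ fun j hj => ?_) (by omega)
    have := Finset.mem_range.1 hj
    exact (natDegree_C_mul_le _ _).trans ((hP j).trans (by omega))
  rw [← eval_eq_sum_range' hdeg, hQ, eval_finsetSum]
  simp only [eval_mul, eval_C, hP']

end Sequences

/-! ### Sums over the spheres in the index set -/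

section Spheres

variable {ℓ : ℕ}

/-- The indices of a given norm. -/
def sphere (ℓ n : ℕ) : Finset (Idx ℓ) := (box ℓ n).filter fun x => natNrm x = n

theorem mem_sphere {n : ℕ} {x : Idx ℓ} : x ∈ sphere ℓ n ↔ natNrm x = n := by
  rw [sphere, Finset.mem_filter, and_iff_right_iff_imp]
  exact fun h => mem_box_of_natNrm_le h.le

theorem card_sphere_le_card_box (ℓ n : ℕ) : (sphere ℓ n).card ≤ (2 * n + 1) ^ (ℓ + 1) :=
  (Finset.card_filter_le _ _).trans (card_box_le ℓ n)

/-- The sum over a sphere. -/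
def sphereSum (f : Idx ℓ → ℂ) (n : ℕ) : ℂ := ∑ x ∈ sphere ℓ n, f x

/-- The neighbour of an index one step away from the origin in direction of a coordinate. -/
def su : Option (Fin ℓ) → Idx ℓ → Idx ℓ
  | some i, x => (Function.update x.1 i (x.1 i + 1), x.2)
  | none, x => (x.1, if 0 ≤ x.2 then x.2 + 1 else x.2 - 1)

theorem co_su_of_ne {p q : Option (Fin ℓ)} (h : q ≠ p) (x : Idx ℓ) : co q (su p x) = co q x := by
  cases p with
  | none =>
    cases q with
    | none => exact absurd rfl h
    | some j => rfl
  | some i =>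
    cases q with
    | none => rfl
    | some j =>
      have : j ≠ i := fun e => h (by rw [e])
      simp [co, su, this]

theorem su_injective (p : Option (Fin ℓ)) : Function.Injective (su p) := by
  cases p with
  | none =>
    rintro ⟨g, k⟩ ⟨g', k'⟩ h
    simp only [su, Prod.mk.injEq] at h
    refine Prod.ext h.1 ?_
    have := h.2
    dsimp only
    split_ifs at this <;> omega
  | some i => exact sh_injective (some i)

theorem su_comm (p q : Option (Fin ℓ)) (x : Idx ℓ) : su p (su q x) = su q (su p x) := by
  cases p with
  | none => cases q <;> rfl
  | some i =>
    cases q with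
    | none => rfl
    | some j =>
      by_cases h : i = j
      · rw [h]
      · simp only [su, Prod.mk.injEq, and_true]
        rw [Function.update_of_ne h, Function.update_of_ne (Ne.symm h), Function.update_comm h]

theorem natNrm_su (p : Option (Fin ℓ)) (x : Idx ℓ) : natNrm (su p x) = natNrm x + 1 := by
  cases p with
  | none =>
    simp only [natNrm, su]
    split_ifs <;> omega
  | some i =>
    have := nrm_sh_some i x
    rw [nrm_eq_natNrm, nrm_eq_natNrm] at this
    exact_mod_cast this

/-- The translation of a function away from the origin, extended by zero. -/
def push (p : Option (Fin ℓ)) (f : Idx ℓ → ℂ) : Idx ℓ → ℂ := Function.extend (su p) f 0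

theorem push_su (p : Option (Fin ℓ)) (f : Idx ℓ → ℂ) (x : Idx ℓ) : push p f (su p x) = f x :=
  (su_injective p).extend_apply _ _ _

theorem push_of_forall_ne {p : Option (Fin ℓ)} {x : Idx ℓ} (h : ∀ y, su p y ≠ x) (f : Idx ℓ → ℂ) :
    push p f x = 0 :=
  Function.extend_apply' _ _ _ fun ⟨y, hy⟩ => h y hy

theorem push_push (p q : Option (Fin ℓ)) (f : Idx ℓ → ℂ) (x : Idx ℓ) :
    push p (push q f) x = Function.extend (fun y => su p (su q y)) f 0 x := by
  by_cases h : ∃ y, su p (su q y) = x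
  · obtain ⟨y, rfl⟩ := h
    rw [push_su, push_su]
    exact (((su_injective p).comp (su_injective q)).extend_apply f 0 y).symm
  · rw [Function.extend_apply' _ _ _ h]
    by_cases h1 : ∃ y, su p y = x
    · obtain ⟨y, rfl⟩ := h1
      rw [push_su]
      exact push_of_forall_ne (fun z hz => h ⟨z, by rw [hz]⟩) f
    · exact push_of_forall_ne (fun z hz => h1 ⟨z, hz⟩) _

theorem push_comm (p q : Option (Fin ℓ)) (f : Idx ℓ → ℂ) : push p (push q f) = push q (push p f) := by
  ext x
  rw [push_push, push_push]
  simp only [su_comm p q]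

/-- The backward difference operator in direction of a coordinate. -/
def bdiff (p : Option (Fin ℓ)) (f : Idx ℓ → ℂ) : Idx ℓ → ℂ := f - push p f

theorem push_sub (p : Option (Fin ℓ)) (f g : Idx ℓ → ℂ) : push p (f - g) = push p f - push p g := by
  ext x
  by_cases h : ∃ y, su p y = x
  · obtain ⟨y, rfl⟩ := h
    simp [push_su]
  · have h' : ∀ y, su p y ≠ x := fun y hy => h ⟨y, hy⟩
    simp [push_of_forall_ne h']

theorem bdiff_comm (p q : Option (Fin ℓ)) (f : Idx ℓ → ℂ) : bdiff p (bdiff q f) = bdiff q (bdiff p f) := by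
  simp only [bdiff, push_sub, push_comm p q]
  abel

theorem sphereSum_bdiff_zero (p : Option (Fin ℓ)) (f : Idx ℓ → ℂ) :
    sphereSum (bdiff p f) 0 = sphereSum f 0 := by
  refine Finset.sum_congr rfl fun x hx => ?_
  rw [bdiff, Pi.sub_apply, push_of_forall_ne, sub_zero]
  rintro y rfl
  rw [mem_sphere, natNrm_su] at hx
  omega

/-- Since `su p` always moves away from the origin, it embeds the `n`-sphere into the next one, and
the pushed function vanishes off the image. The result does not depend on the direction `p`. -/
theorem sphereSum_bdiff_succ (p : Option (Fin ℓ)) (f : Idx ℓ → ℂ) (n : ℕ) :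
    sphereSum (bdiff p f) (n + 1) = sphereSum f (n + 1) - sphereSum f n := by
  have h : ∑ x ∈ sphere ℓ (n + 1), push p f x = sphereSum f n := by
    classical
    have hsub : (sphere ℓ n).image (su p) ⊆ sphere ℓ (n + 1) := by
      intro x hx
      obtain ⟨y, hy, rfl⟩ := Finset.mem_image.1 hx
      rw [mem_sphere] at hy ⊢
      rw [natNrm_su, hy]
    rw [← Finset.sum_subset hsub, Finset.sum_image (su_injective p).injOn]
    · exact Finset.sum_congr rfl fun x _ => push_su p f x
    · intro x hx hx'
      refine push_of_forall_ne (fun y hy => hx' (Finset.mem_image.2 ⟨y, ?_, hy⟩)) f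
      rw [← hy, mem_sphere, natNrm_su] at hx
      rw [mem_sphere]
      omega
  rw [sphereSum, sphereSum, ← h, ← Finset.sum_sub_distrib]
  rfl

/-- Rapid decrease in direction of a coordinate. -/
def RapidIn (p : Option (Fin ℓ)) (f : Idx ℓ → ℂ) : Prop :=
  ∀ N : ℕ, ∃ C : ℝ, ∀ x, ‖f x‖ * (1 + |co p x|) ^ N ≤ C

theorem RapidIn.bdiff {p q : Option (Fin ℓ)} {f : Idx ℓ → ℂ} (h : RapidIn p f) (hpq : p ≠ q) :
    RapidIn p (bdiff q f) := by
  intro N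
  obtain ⟨C, hC⟩ := h N
  have h1 (x : Idx ℓ) : ‖push q f x‖ * (1 + |co p x|) ^ N ≤ C := by
    by_cases hx : ∃ y, su q y = x
    · obtain ⟨y, rfl⟩ := hx
      rw [push_su, co_su_of_ne hpq]
      exact hC y
    · rw [push_of_forall_ne (fun y hy => hx ⟨y, hy⟩), norm_zero, zero_mul]
      exact le_trans (by positivity) (hC x)
  refine ⟨C + C, fun x => le_trans ?_ (add_le_add (hC x) (h1 x))⟩
  rw [← add_mul]
  gcongr
  exact norm_sub_le _ _

/-- Induction on the set of directions in which `f` itself need not decay. Differencing in one of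
them makes it a direction of decay; it commutes with the other differences and respects decay
elsewhere. Summing back costs one degree. -/
theorem hasExpansion_of_rapidIn (s : Finset (Option (Fin ℓ))) (f : Idx ℓ → ℂ)
    (h : ∀ p ∈ s, RapidIn p (bdiff p f)) (h' : ∀ p ∉ s, RapidIn p f) :
    HasExpansion s.card (sphereSum f) := by
  induction s using Finset.induction_on generalizing f with
  | empty =>
    refine ⟨0, fun N => ?_⟩
    choose C hC using fun p => h' p (Finset.notMem_empty p) (N + (ℓ + 1))
    refine ⟨2 ^ (ℓ + 1) * ((ℓ + 1 : ℝ) ^ (N + (ℓ + 1)) * ∑ p, |C p|), fun n => ?_⟩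
    have key (x : Idx ℓ) (hx : x ∈ sphere ℓ n) :
        ‖f x‖ * (1 + (n : ℝ)) ^ (N + (ℓ + 1)) ≤ (ℓ + 1 : ℝ) ^ (N + (ℓ + 1)) * ∑ p, |C p| := by
      rw [mem_sphere] at hx
      -- The largest of the `ℓ + 1` coordinates is at least `n / (ℓ + 1)`, so decay there is decay
      -- in `n`. The spare power `ℓ + 1` compensates for the number of points on the sphere.
      obtain ⟨p, -, hp⟩ := Finset.exists_max_image Finset.univ (fun p => |co p x|) ⟨none, Finset.mem_univ _⟩
      have h1 : (n : ℝ) ≤ (ℓ + 1) * |co p x| := by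
        rw [← hx, ← nrm_eq_natNrm, nrm_eq_sum]
        refine (Finset.sum_le_card_nsmul _ _ _ hp).trans (le_of_eq ?_)
        simp
      calc ‖f x‖ * (1 + (n : ℝ)) ^ (N + (ℓ + 1))
          ≤ ‖f x‖ * ((ℓ + 1) * (1 + |co p x|)) ^ (N + (ℓ + 1)) := by
            gcongr
            linarith [(Nat.cast_nonneg ℓ : (0 : ℝ) ≤ ℓ)]
        _ = (ℓ + 1 : ℝ) ^ (N + (ℓ + 1)) * (‖f x‖ * (1 + |co p x|) ^ (N + (ℓ + 1))) := by
            rw [mul_pow]; ring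
        _ ≤ (ℓ + 1 : ℝ) ^ (N + (ℓ + 1)) * ∑ p, |C p| := by
            gcongr
            refine (hC p x).trans ((le_abs_self _).trans ?_)
            exact Finset.single_le_sum (f := fun p => |C p|) (fun _ _ => abs_nonneg _) (Finset.mem_univ p)
    simp only [Finset.card_empty, Finset.range_zero, Finset.sum_empty, sub_zero]
    have hcard : ((sphere ℓ n).card : ℝ) ≤ 2 ^ (ℓ + 1) * (1 + (n : ℝ)) ^ (ℓ + 1) := by
      rw [← mul_pow]
      calc ((sphere ℓ n).card : ℝ) ≤ ((2 * n + 1 : ℕ) : ℝ) ^ (ℓ + 1) := by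
            exact_mod_cast card_sphere_le_card_box ℓ n
        _ ≤ _ := by
            push_cast
            gcongr
            linarith
    set K : ℝ := (ℓ + 1 : ℝ) ^ (N + (ℓ + 1)) * ∑ p, |C p|
    have h2 : ‖sphereSum f n‖ * (1 + (n : ℝ)) ^ (N + (ℓ + 1)) ≤ 2 ^ (ℓ + 1) * (1 + (n : ℝ)) ^ (ℓ + 1) * K := by
      calc _ ≤ (∑ x ∈ sphere ℓ n, ‖f x‖) * (1 + (n : ℝ)) ^ (N + (ℓ + 1)) := by
            gcongr
            exact norm_sum_le _ _
        _ = ∑ x ∈ sphere ℓ n, ‖f x‖ * (1 + (n : ℝ)) ^ (N + (ℓ + 1)) := by rw [Finset.sum_mul]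
        _ ≤ (sphere ℓ n).card • K := Finset.sum_le_card_nsmul _ _ _ key
        _ ≤ _ := by
            rw [nsmul_eq_mul]
            have : 0 ≤ K := by positivity
            gcongr
    rw [pow_add] at h2
    refine le_of_mul_le_mul_right (a := (1 + (n : ℝ)) ^ (ℓ + 1)) ?_ (by positivity)
    linarith
  | insert q s hq ih =>
    rw [Finset.card_insert_of_notMem hq]
    refine (ih (bdiff q f) (fun p hp => ?_) fun p hp => ?_).of_diff (sphereSum_bdiff_zero q f)
      (sphereSum_bdiff_succ q f)
    · rw [bdiff_comm]
      exact (h p (Finset.mem_insert_of_mem hp)).bdiff fun e => hq (e ▸ hp)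
    · by_cases hpq : p = q
      · subst hpq
        exact h p (Finset.mem_insert_self _ _)
      · refine (h' p fun hp' => ?_).bdiff hpq
        rcases Finset.mem_insert.1 hp' with h1 | h1
        · exact hpq h1
        · exact hp h1

/-- The diagonal of an operator. -/
def diagEntry (T : Hil ℓ →L[ℂ] Hil ℓ) (x : Idx ℓ) : ℂ := mat T x x

variable {T : Hil ℓ →L[ℂ] Hil ℓ}

theorem norm_diagEntry_le (T : Hil ℓ →L[ℂ] Hil ℓ) (x : Idx ℓ) : ‖diagEntry T x‖ ≤ ‖T‖ := norm_mat_le T x x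

/-- The outward step `su` is `sh`, or its inverse on the negative half line, so the shift condition
on diagonal entries applies. Indices that are not reached by an outward step have `|co p x| ≤ 1`,
where the operator norm suffices. -/
theorem IsAsympInvariant.rapidIn_bdiff (hT : IsAsympInvariant T) (p : Option (Fin ℓ)) :
    RapidIn p (bdiff p (diagEntry T)) := by
  intro N
  obtain ⟨C, hC⟩ := hT.shift p N
  have h1 (x : Idx ℓ) : ‖diagEntry T (sh p x) - diagEntry T x‖ * (1 + |co p x|) ^ N ≤ C := by
    have := hC x x
    rwa [mat_sub, mat_conj_shiftOp, offd_self, add_zero] at this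
  have hC0 : 0 ≤ C := le_trans (by positivity) (h1 (0, 0))
  have h2 {x : Idx ℓ} (hx : |co p x| ≤ 1) (hx' : ∀ y, su p y ≠ x) :
      ‖bdiff p (diagEntry T) x‖ * (1 + |co p x|) ^ N ≤ 2 ^ N * (C + ‖T‖) := by
    rw [bdiff, Pi.sub_apply, push_of_forall_ne hx', sub_zero]
    calc _ ≤ ‖T‖ * (1 + 1) ^ N := by
          gcongr
          exact norm_diagEntry_le T x
      _ ≤ _ := by
          rw [one_add_one_eq_two, mul_comm]
          gcongr
          linarith
  have h3 {x : Idx ℓ} (hx : su p x = sh p x) (hx' : |co p (sh p x)| ≤ |co p x| + 1) :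
      ‖bdiff p (diagEntry T) (su p x)‖ * (1 + |co p (su p x)|) ^ N ≤ 2 ^ N * (C + ‖T‖) := by
    rw [bdiff, Pi.sub_apply, push_su, hx]
    calc _ ≤ ‖diagEntry T (sh p x) - diagEntry T x‖ * (2 * (1 + |co p x|)) ^ N := by
          gcongr
          linarith [abs_nonneg (co p x)]
      _ = 2 ^ N * (‖diagEntry T (sh p x) - diagEntry T x‖ * (1 + |co p x|) ^ N) := by rw [mul_pow]; ring
      _ ≤ _ := by
          gcongr
          linarith [h1 x, norm_nonneg T]
  have h4 (x : Idx ℓ) : |co p (sh p x)| ≤ |co p x| + 1 := by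
    rw [co_sh, if_pos rfl]
    exact (abs_add_le _ _).trans (by rw [abs_one])
  refine ⟨2 ^ N * (C + ‖T‖), fun x => ?_⟩
  by_cases hx : ∃ y, su p y = x
  · obtain ⟨y, rfl⟩ := hx
    cases p with
    | some i => exact h3 rfl (h4 y)
    | none =>
      by_cases hy : 0 ≤ y.2
      · exact h3 (by simp [su, sh, hy]) (h4 y)
      · have e : sh none (su none y) = y := by simp [sh, su, hy]
        have := h1 (su none y)
        rw [e, norm_sub_rev] at this
        rw [bdiff, Pi.sub_apply, push_su]
        refine this.trans ?_
        have : (1 : ℝ) ≤ 2 ^ N := one_le_pow₀ (by norm_num)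
        nlinarith [norm_nonneg T]
  · have hx' : ∀ y, su p y ≠ x := fun y hy => hx ⟨y, hy⟩
    refine h2 ?_ hx'
    cases p with
    | some i =>
      have h0 : x.1 i = 0 := by
        by_contra h0
        refine hx' (Function.update x.1 i (x.1 i - 1), x.2) ?_
        simp only [su, Function.update_self, Function.update_idem]
        rw [Nat.sub_add_cancel (Nat.pos_of_ne_zero h0), Function.update_eq_self]
      simp [co, h0]
    | none =>
      -- The integer line splits into two half lines of constant sign, starting at `0` and at `-1`.
      have h0 : x.2 = 0 ∨ x.2 = -1 := by
        by_contra! h0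
        rcases lt_or_ge 0 x.2 with h | h
        · refine hx' (x.1, x.2 - 1) (Prod.ext rfl ?_)
          simp only [su]
          rw [if_pos (by omega)]
          omega
        · refine hx' (x.1, x.2 + 1) (Prod.ext rfl ?_)
          simp only [su]
          rw [if_neg (by omega)]
          omega
      rcases h0 with h0 | h0 <;> simp [co, h0]

/-- The sums of the diagonal entries over spheres have a polynomial asymptotic expansion. -/
theorem IsAsympInvariant.exists_expansion (hT : IsAsympInvariant T) : ∃ p : ℕ → ℂ,
    RapidSeq fun n => sphereSum (diagEntry T) n - ∑ j ∈ Finset.range (ℓ + 1), p j * (n : ℂ) ^ j := by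
  have h := hasExpansion_of_rapidIn Finset.univ (diagEntry T) (fun p _ => hT.rapidIn_bdiff p)
    fun p hp => absurd (Finset.mem_univ p) hp
  rw [Finset.card_univ, Fintype.card_option, Fintype.card_fin] at h
  exact h.exists_pow

end Spheres

/-! ### Dirichlet series with polynomial asymptotics -/

section ZetaSum

open Filter Topology

/-- The analytic continuation of the Dirichlet series of `n ↦ ∑_{j < m} p_j n^j + r_n`. -/
def zetaSum (p : ℕ → ℂ) (m : ℕ) (r : ℕ → ℂ) (z : ℂ) : ℂ :=
  ∑ j ∈ Finset.range m, p j * riemannZeta (z - j) + LSeries r z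

variable {p : ℕ → ℂ} {m : ℕ} {r : ℕ → ℂ}

/-- Decay of every order makes the Dirichlet series converge absolutely everywhere, so the remainder
is entire and contributes no pole. -/
theorem RapidSeq.abscissaOfAbsConv_lt (hr : RapidSeq r) (z : ℂ) : LSeries.abscissaOfAbsConv r < z.re := by
  obtain ⟨N, hN⟩ := exists_nat_gt (1 - z.re)
  have h : LSeries.abscissaOfAbsConv r ≤ ((-N : ℝ) : EReal) + 1 := by
    refine LSeries.abscissaOfAbsConv_le_of_le_const_mul_rpow ?_
    obtain ⟨C, hC0, hC⟩ := hr.norm_le N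
    refine ⟨C, fun n hn => (hC n).trans ?_⟩
    have hn' : (0 : ℝ) < n := by exact_mod_cast Nat.pos_of_ne_zero hn
    rw [Real.rpow_neg hn'.le, Real.rpow_natCast]
    gcongr
    linarith
  refine h.trans_lt ?_
  rw [← EReal.coe_one, ← EReal.coe_add, EReal.coe_lt_coe_iff]
  linarith

theorem RapidSeq.analyticAt_LSeries (hr : RapidSeq r) (z : ℂ) : AnalyticAt ℂ (LSeries r) z :=
  LSeries_analyticOnNhd r z (hr.abscissaOfAbsConv_lt z)

theorem lseriesHasSum_pow (j : ℕ) {z : ℂ} (hz : (j : ℝ) + 1 < z.re) :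
    LSeriesHasSum (fun n => (n : ℂ) ^ j) z (riemannZeta (z - j)) := by
  have h1 : 1 < (z - j).re := by
    rw [Complex.sub_re, Complex.natCast_re]; linarith
  -- Needed for the term `n = 0`, which an L-series omits: with nonzero exponent, `1 / 0 ^ (z - j)`
  -- is zero by convention.
  have h2 : z - j ≠ 0 := fun h => by
    rw [h, Complex.zero_re] at h1; linarith
  rw [zeta_eq_tsum_one_div_nat_cpow h1]
  rw [LSeriesHasSum]
  convert! (Complex.summable_one_div_nat_cpow.2 h1).hasSum using 2 with n
  rw [LSeries.term_def]
  split_ifs with hn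
  · rw [hn, Nat.cast_zero, Complex.zero_cpow h2, div_zero]
  · have hn' : (n : ℂ) ≠ 0 := by exact_mod_cast hn
    rw [Complex.cpow_sub _ _ hn', Complex.cpow_natCast, one_div_div]

theorem lseriesHasSum_zetaSum {a : ℕ → ℂ}
    (h : RapidSeq fun n => a n - ∑ j ∈ Finset.range m, p j * (n : ℂ) ^ j) {z : ℂ} (hz : (m : ℝ) < z.re) :
    LSeriesHasSum a z (zetaSum p m (fun n => a n - ∑ j ∈ Finset.range m, p j * (n : ℂ) ^ j) z) := by
  have h1 : HasSum (fun n => ∑ j ∈ Finset.range m, p j * LSeries.term (fun n => (n : ℂ) ^ j) z n)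
      (∑ j ∈ Finset.range m, p j * riemannZeta (z - j)) := by
    refine hasSum_sum fun j hj => (lseriesHasSum_pow j (lt_of_le_of_lt ?_ hz)).mul_left (p j)
    exact_mod_cast Finset.mem_range.1 hj
  have h2 := (LSeriesSummable_of_abscissaOfAbsConv_lt_re (h.abscissaOfAbsConv_lt z)).LSeriesHasSum
  rw [LSeriesHasSum] at h2 ⊢
  convert! h1.add h2 using 1
  funext n
  simp only [LSeries.term_def]
  split_ifs with hn
  · simp
  · simp only [mul_div_assoc', ← Finset.sum_div]
    ring

theorem analyticAt_riemannZeta_sub (j : ℕ) {s : ℂ} (hs : s ≠ (j + 1 : ℕ)) :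
    AnalyticAt ℂ (fun z => riemannZeta (z - j)) s := by
  have h1 : s - j ≠ 1 := fun h => hs (by push_cast; linear_combination h)
  exact AnalyticAt.fun_comp (f := fun z : ℂ => z - j) (analyticOn_riemannZeta (s - j) h1) (by fun_prop)

theorem analyticAt_zetaSum (hr : RapidSeq r) {s : ℂ} (hs : ∀ j < m, s ≠ (j + 1 : ℕ)) :
    AnalyticAt ℂ (zetaSum p m r) s := by
  refine AnalyticAt.add ?_ (hr.analyticAt_LSeries s)
  exact Finset.analyticAt_fun_sum _ fun j hj =>
    analyticAt_const.mul (analyticAt_riemannZeta_sub j (hs j (Finset.mem_range.1 hj)))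

theorem tendsto_sub_mul_of_analyticAt {f : ℂ → ℂ} {s : ℂ} (hf : AnalyticAt ℂ f s) :
    Tendsto (fun z => (z - s) * f z) (𝓝[≠] s) (𝓝 0) := by
  have h : ContinuousAt (fun z => (z - s) * f z) s := by
    have := hf.continuousAt
    fun_prop
  have := h.tendsto
  rw [sub_self, zero_mul] at this
  exact this.mono_left nhdsWithin_le_nhds

theorem tendsto_sub_mul_riemannZeta (j : ℕ) :
    Tendsto (fun z => (z - (j + 1 : ℕ)) * riemannZeta (z - j)) (𝓝[≠] ((j + 1 : ℕ) : ℂ)) (𝓝 1) := by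
  have h1 : Tendsto (fun z : ℂ => z - j) (𝓝[≠] ((j + 1 : ℕ) : ℂ)) (𝓝[≠] 1) := by
    refine tendsto_nhdsWithin_iff.2 ⟨?_, ?_⟩
    · have : ContinuousAt (fun z : ℂ => z - j) ((j + 1 : ℕ) : ℂ) := by fun_prop
      have := this.tendsto
      push_cast at this
      rw [add_sub_cancel_left] at this
      push_cast
      exact this.mono_left nhdsWithin_le_nhds
    · filter_upwards [self_mem_nhdsWithin] with z hz h
      refine hz ?_
      rw [Set.mem_singleton_iff] at h ⊢
      push_cast
      linear_combination h
  refine (riemannZeta_residue_one.comp h1).congr fun z => ?_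
  simp only [Function.comp_apply]
  push_cast
  ring

/-- Only the summand `j = k` is singular at `k + 1`, and zeta has residue 1; the residue is
therefore the coefficient `p k`. -/
theorem tendsto_sub_mul_zetaSum (hr : RapidSeq r) {k : ℕ} (hk : k < m) :
    Tendsto (fun z => (z - (k + 1 : ℕ)) * zetaSum p m r z) (𝓝[≠] ((k + 1 : ℕ) : ℂ)) (𝓝 (p k)) := by
  have h1 (j : ℕ) : Tendsto (fun z => (z - (k + 1 : ℕ)) * (p j * riemannZeta (z - j)))
      (𝓝[≠] ((k + 1 : ℕ) : ℂ)) (𝓝 (if j = k then p j else 0)) := by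
    split_ifs with h
    · subst h
      have := (tendsto_sub_mul_riemannZeta j).const_mul (p j)
      rw [mul_one] at this
      exact this.congr fun z => by ring
    · refine tendsto_sub_mul_of_analyticAt (analyticAt_const.mul (analyticAt_riemannZeta_sub j ?_))
      exact_mod_cast fun h' => h (by omega)
  have h2 := (tendsto_finsetSum (Finset.range m) fun j _ => h1 j).add
    (tendsto_sub_mul_of_analyticAt (hr.analyticAt_LSeries ((k + 1 : ℕ) : ℂ)))
  rw [Finset.sum_ite_eq', if_pos (Finset.mem_range.2 hk), add_zero] at h2
  refine h2.congr fun z => ?_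
  rw [zetaSum, mul_add, Finset.mul_sum]

theorem meromorphicAt_of_tendsto_sub_mul {f : ℂ → ℂ} {s c : ℂ} (hf : ∀ᶠ z in 𝓝[≠] s, AnalyticAt ℂ f z)
    (h : Tendsto (fun z => (z - s) * f z) (𝓝[≠] s) (𝓝 c)) : MeromorphicAt f s := by
  -- With exponent 2 the limit is 0, which is also the value at `s`. Exponent 1 would leave a
  -- discontinuity at `s` whenever `c ≠ 0`.
  refine ⟨2, Complex.analyticAt_of_differentiable_on_punctured_nhds_of_continuousAt ?_ ?_⟩
  · filter_upwards [hf] with z hz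
    have := hz.differentiableAt
    fun_prop
  · rw [continuousAt_iff_punctured_nhds]
    have h1 : Tendsto (fun z => z - s) (𝓝[≠] s) (𝓝 0) := by
      have : ContinuousAt (fun z => z - s) s := by fun_prop
      have := this.tendsto
      rw [sub_self] at this
      exact this.mono_left nhdsWithin_le_nhds
    have h2 := h1.mul h
    rw [zero_mul] at h2
    simp only [sub_self, ne_eq, OfNat.ofNat_ne_zero, not_false_eq_true, zero_pow, zero_smul]
    exact h2.congr fun z => by rw [smul_eq_mul]; ring

theorem meromorphic_zetaSum (hr : RapidSeq r) : Meromorphic (zetaSum p m r) := by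
  intro s
  by_cases hs : ∃ j < m, s = (j + 1 : ℕ)
  · obtain ⟨k, hk, rfl⟩ := hs
    refine meromorphicAt_of_tendsto_sub_mul ?_ (tendsto_sub_mul_zetaSum hr hk)
    have hfin : Set.Finite {z : ℂ | ∃ j < m, z = (j + 1 : ℕ)} := by
      refine (Set.Finite.image (fun j : ℕ => ((j + 1 : ℕ) : ℂ)) (Set.finite_lt_nat m)).subset ?_
      rintro _ ⟨j, hj, rfl⟩
      exact ⟨j, hj, rfl⟩
    have hcl := (hfin.subset (Set.sdiff_subset (t := {((k + 1 : ℕ) : ℂ)}))).isClosed.isOpen_compl.mem_nhds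
      (x := ((k + 1 : ℕ) : ℂ)) (fun h => h.2 rfl)
    filter_upwards [self_mem_nhdsWithin, mem_nhdsWithin_of_mem_nhds hcl] with z hz hz'
    refine analyticAt_zetaSum hr fun j hj h => hz' ⟨⟨j, hj, h⟩, hz⟩
  · exact (analyticAt_zetaSum hr fun j hj h => hs ⟨j, hj, h⟩).meromorphicAt

theorem meromorphicOrderAt_sub_mul_zetaSum (hr : RapidSeq r) (s : ℂ) :
    meromorphicOrderAt (fun z => (z - s) * zetaSum p m r z) s = 1 + meromorphicOrderAt (zetaSum p m r) s := by
  have h := meromorphicOrderAt_mul (f := fun z => z - s) (x := s) (by fun_prop) (meromorphic_zetaSum (p := p) (m := m) hr s)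
  rw [meromorphicOrderAt_id_sub_const] at h
  exact h

/-- All poles are simple. -/
theorem meromorphicOrderAt_zetaSum (hr : RapidSeq r) {s : ℂ} (hs : meromorphicOrderAt (zetaSum p m r) s < 0) :
    (∃ k, 1 ≤ k ∧ k ≤ m ∧ s = (k : ℂ)) ∧ meromorphicOrderAt (zetaSum p m r) s = (-1 : ℤ) := by
  by_cases h : ∃ j < m, s = (j + 1 : ℕ)
  · obtain ⟨k, hk, rfl⟩ := h
    refine ⟨⟨k + 1, by omega, by omega, rfl⟩, ?_⟩
    have hm : MeromorphicAt (fun z => (z - (k + 1 : ℕ)) * zetaSum p m r z) ((k + 1 : ℕ) : ℂ) :=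
      MeromorphicAt.fun_mul (by fun_prop) (meromorphic_zetaSum hr _)
    -- A finite limit of `(z - s) f` bounds the order of `f` below by `-1`.
    have h1 := (tendsto_nhds_iff_meromorphicOrderAt_nonneg hm).1 ⟨_, tendsto_sub_mul_zetaSum hr hk⟩
    rw [meromorphicOrderAt_sub_mul_zetaSum hr] at h1
    revert h1 hs
    generalize meromorphicOrderAt (zetaSum p m r) ((k + 1 : ℕ) : ℂ) = o
    intro hs h1
    induction o using WithTop.recTopCoe with
    | top => exact absurd hs (by simp)
    | coe o =>
      norm_cast at hs h1 ⊢
      omega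
  · refine absurd hs (not_lt.2 (AnalyticAt.meromorphicOrderAt_nonneg ?_))
    exact analyticAt_zetaSum hr fun j hj h' => h ⟨j, hj, h'⟩

theorem meromorphicOrderAt_zetaSum_neg (hr : RapidSeq r) {k : ℕ} (hk : k < m) (hp : p k ≠ 0) :
    meromorphicOrderAt (zetaSum p m r) ((k + 1 : ℕ) : ℂ) < 0 := by
  have hm : MeromorphicAt (fun z => (z - (k + 1 : ℕ)) * zetaSum p m r z) ((k + 1 : ℕ) : ℂ) :=
    MeromorphicAt.fun_mul (by fun_prop) (meromorphic_zetaSum hr _)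
  have h1 := (tendsto_ne_zero_iff_meromorphicOrderAt_eq_zero hm).1 ⟨_, hp, tendsto_sub_mul_zetaSum hr hk⟩
  rw [meromorphicOrderAt_sub_mul_zetaSum hr] at h1
  revert h1
  generalize meromorphicOrderAt (zetaSum p m r) ((k + 1 : ℕ) : ℂ) = o
  intro h1
  induction o using WithTop.recTopCoe with
  | top => exact absurd h1 (by simp)
  | coe o =>
    norm_cast at h1 ⊢
    omega

end ZetaSum

/-! ### Traces -/

section Traces

variable {ℓ : ℕ} {T : Hil ℓ →L[ℂ] Hil ℓ} {z : ℂ}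

/-- The decomposition of the index set into spheres. -/
def sphereEquiv (ℓ : ℕ) : (Σ n : ℕ, {x // x ∈ sphere ℓ n}) ≃ Idx ℓ where
  toFun s := s.2
  invFun x := ⟨natNrm x, x, mem_sphere.2 rfl⟩
  left_inv := by
    rintro ⟨n, x, hx⟩
    obtain rfl := mem_sphere.1 hx
    rfl
  right_inv _ := rfl

theorem sphereSum_mul_powCoef (f : Idx ℓ → ℂ) (z : ℂ) (n : ℕ) :
    ∑ x ∈ sphere ℓ n, f x * powCoef z x = LSeries.term (sphereSum f) z n := by
  have h : ∀ x ∈ sphere ℓ n, f x * powCoef z x = f x * if n = 0 then 0 else (n : ℂ) ^ (-z) := fun x hx => by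
    rw [powCoef_eq, mem_sphere.1 hx]
  rw [Finset.sum_congr rfl h, ← Finset.sum_mul, LSeries.term_def]
  split_ifs
  · rw [mul_zero]
  · rw [Complex.cpow_neg, div_eq_mul_inv]
    rfl

/-- The expansion applied to the identity operator says that sphere cardinalities are polynomial of
degree at most `ℓ` up to a rapid error, so their Dirichlet series converges absolutely in this half
plane. -/
theorem summable_powCoef (hz : (ℓ : ℝ) + 1 < z.re) : Summable fun x : Idx ℓ => ‖powCoef z x‖ := by
  have hi := summable_sigma_of_nonneg fun s => norm_nonneg (powCoef z (sphereEquiv ℓ s))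
  refine (sphereEquiv ℓ).summable_iff.1 (hi.2 ?_)
  refine ⟨fun n => Summable.of_finite, ?_⟩
  obtain ⟨p, hp⟩ := (IsSmooth.one (ℓ := ℓ)).isAsympInvariant.exists_expansion
  have h := (lseriesHasSum_zetaSum hp (z := z) (by push_cast; exact hz)).summable.norm
  refine h.congr fun n => ?_
  rw [← sphereSum_mul_powCoef]
  change _ = ∑' x : {x // x ∈ sphere ℓ n}, ‖powCoef z (x : Idx ℓ)‖
  rw [Finset.tsum_subtype (sphere ℓ n) fun x => ‖powCoef z x‖]
  have h1 : ∀ x ∈ sphere ℓ n, ‖powCoef z x‖ = ‖if n = 0 then (0 : ℂ) else (n : ℂ) ^ (-z)‖ := fun x hx => by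
    rw [powCoef_eq, mem_sphere.1 hx]
  have h2 : ∀ x ∈ sphere ℓ n, diagEntry (1 : Hil ℓ →L[ℂ] Hil ℓ) x * powCoef z x =
      if n = 0 then (0 : ℂ) else (n : ℂ) ^ (-z) := fun x hx => by
    rw [powCoef_eq, mem_sphere.1 hx, diagEntry, mat_one, if_pos rfl, one_mul]
  rw [Finset.sum_congr rfl h1, Finset.sum_congr rfl h2, Finset.sum_const, Finset.sum_const, nsmul_eq_mul,
    nsmul_eq_mul, norm_mul, Complex.norm_natCast]

theorem isTraceClass_mul_absPow (T : Hil ℓ →L[ℂ] Hil ℓ) (hz : (ℓ : ℝ) + 1 < z.re) :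
    IsTraceClass (T * absPow (dirac ℓ) z) := by
  obtain ⟨e⟩ := nonempty_equiv_of_countable (α := ℕ) (β := Idx ℓ)
  have hz0 : 0 ≤ z.re := by linarith [(Nat.cast_nonneg ℓ : (0 : ℝ) ≤ ℓ)]
  refine ⟨fun n => basisVec (e n), fun n => powCoef z (e n) • T (basisVec (e n)), ?_, fun v => ?_⟩
  · refine Summable.of_nonneg_of_le (fun n => by positivity) (fun n => ?_)
      ((e.summable_iff.2 (summable_powCoef hz)).mul_right ‖T‖)
    rw [norm_basisVec, one_mul, norm_smul]
    refine mul_le_mul_of_nonneg_left ?_ (norm_nonneg _)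
    exact (T.le_opNorm _).trans (by rw [norm_basisVec, mul_one])
  · have h := (hasSum_basisVec (absPow (dirac ℓ) z v)).mapL T
    rw [← e.hasSum_iff] at h
    change HasSum _ (T (absPow (dirac ℓ) z v))
    convert! h using 1
    funext n
    simp only [Function.comp_apply]
    rw [inner_basisVec, map_smul, absPow_eq, diagCLM_apply (norm_powCoef_le_one hz0), mul_comm, mul_smul,
      smul_comm]

/-- The eigenvalues of `|D|^{-z}` are constant on spheres, and absolute summability permits grouping
the trace by spheres. -/
theorem trace_mul_absPow (T : Hil ℓ →L[ℂ] Hil ℓ) (hz : (ℓ : ℝ) + 1 < z.re) :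
    trace (T * absPow (dirac ℓ) z) = LSeries (sphereSum (diagEntry T)) z := by
  have hz0 : 0 ≤ z.re := by linarith [(Nat.cast_nonneg ℓ : (0 : ℝ) ≤ ℓ)]
  have hs : Summable fun x : Idx ℓ => diagEntry T x * powCoef z x := by
    refine Summable.of_norm_bounded ((summable_powCoef hz).mul_left ‖T‖) fun x => ?_
    rw [norm_mul]
    exact mul_le_mul_of_nonneg_right (norm_diagEntry_le T x) (norm_nonneg _)
  have h1 : trace (T * absPow (dirac ℓ) z) = ∑' x, diagEntry T x * powCoef z x := by
    refine tsum_congr fun x => ?_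
    change mat (T * absPow (dirac ℓ) z) x x = _
    rw [absPow_eq, mat_mul_diagCLM (norm_powCoef_le_one hz0)]
    rfl
  rw [h1, ← (sphereEquiv ℓ).tsum_eq]
  refine (Summable.tsum_sigma ((sphereEquiv ℓ).summable_iff.2 hs)).trans ?_
  refine tsum_congr fun n => ?_
  rw [← sphereSum_mul_powCoef]
  exact Finset.tsum_subtype (sphere ℓ n) fun x => diagEntry T x * powCoef z x

theorem isZetaContinuation_zetaSum {p : ℕ → ℂ} {m : ℕ} (hm : m ≤ ℓ + 1)
    (h : RapidSeq fun n => sphereSum (diagEntry T) n - ∑ j ∈ Finset.range m, p j * (n : ℂ) ^ j) :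
    IsZetaContinuation (dirac ℓ) ((ℓ : ℝ) + 1) T
      (zetaSum p m fun n => sphereSum (diagEntry T) n - ∑ j ∈ Finset.range m, p j * (n : ℂ) ^ j) := by
  refine ⟨meromorphic_zetaSum h, fun z hz => ?_⟩
  rw [trace_mul_absPow T hz]
  refine (lseriesHasSum_zetaSum h (lt_of_le_of_lt ?_ hz)).LSeries_eq.symm
  exact_mod_cast hm

end Traces

/-! ### Existence of poles -/

section Poles

variable {ℓ : ℕ}

/-- The natural coordinates may be chosen freely below `m`: their sum is at most `ℓ m`, and the
integer coordinate makes up the rest of the norm. -/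
theorem pow_le_card_sphere (ℓ m : ℕ) : m ^ ℓ ≤ (sphere ℓ ((ℓ + 1) * m)).card := by
  classical
  set s : Finset (Fin ℓ → ℕ) := Fintype.piFinset fun _ => Finset.range m with hs
  have hcard : s.card = m ^ ℓ := by simp [hs]
  rw [← hcard]
  refine Finset.card_le_card_of_injOn (fun g => (g, (((ℓ + 1) * m : ℕ) : ℤ) - ((∑ i, g i : ℕ) : ℤ)))
    (fun g hg => ?_) fun g _ g' _ h => congrArg Prod.fst h
  have h1 : ∑ i, g i ≤ ℓ * m := by
    have := Finset.sum_le_card_nsmul Finset.univ g m fun i _ =>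
      (Finset.mem_range.1 (Fintype.mem_piFinset.1 hg i)).le
    simpa using this
  refine mem_sphere.2 ?_
  have h2 : (ℓ + 1) * m = ℓ * m + m := by ring
  simp only [natNrm]
  omega

/-- Without the leading term the cardinality would be `O((1 + n)^{ℓ-1})`, too few points for the
lower bound `m^ℓ` at `n = (ℓ + 1) m`. -/
theorem leading_coeff_card_sphere_ne_zero {p : ℕ → ℂ}
    (h : RapidSeq fun n => ((sphere ℓ n).card : ℂ) - ∑ j ∈ Finset.range (ℓ + 1), p j * (n : ℂ) ^ j) :
    p ℓ ≠ 0 := by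
  intro hp
  obtain ⟨C, hC⟩ := h 1
  have hC0 : 0 ≤ C := le_trans (by positivity) (hC 0)
  set K : ℝ := C + ∑ j ∈ Finset.range ℓ, ‖p j‖
  have hK : 0 ≤ K := by positivity
  have key (n : ℕ) : ((sphere ℓ n).card : ℝ) * (1 + n) ≤ K * (1 + n) ^ ℓ := by
    have hn : (1 : ℝ) ≤ 1 + n := by linarith [(Nat.cast_nonneg n : (0 : ℝ) ≤ n)]
    have h1 := hC n
    beta_reduce at h1
    rw [Finset.sum_range_succ, hp, zero_mul, add_zero, pow_one] at h1
    have h2 : ((sphere ℓ n).card : ℝ) ≤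
        ‖((sphere ℓ n).card : ℂ) - ∑ j ∈ Finset.range ℓ, p j * (n : ℂ) ^ j‖ +
          ∑ j ∈ Finset.range ℓ, ‖p j‖ * (n : ℝ) ^ j := by
      calc ((sphere ℓ n).card : ℝ) = ‖((sphere ℓ n).card : ℂ)‖ := (Complex.norm_natCast _).symm
        _ ≤ _ + ‖∑ j ∈ Finset.range ℓ, p j * (n : ℂ) ^ j‖ := norm_le_norm_sub_add _ _
        _ ≤ _ := by
          gcongr
          refine (norm_sum_le _ _).trans (le_of_eq (Finset.sum_congr rfl fun j _ => ?_))
          rw [norm_mul, norm_pow, Complex.norm_natCast]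
    have h3 : (∑ j ∈ Finset.range ℓ, ‖p j‖ * (n : ℝ) ^ j) * (1 + n) ≤
        (∑ j ∈ Finset.range ℓ, ‖p j‖) * (1 + n) ^ ℓ := by
      rw [Finset.sum_mul, Finset.sum_mul]
      refine Finset.sum_le_sum fun j hj => ?_
      rw [mul_assoc]
      refine mul_le_mul_of_nonneg_left ?_ (norm_nonneg _)
      calc (n : ℝ) ^ j * (1 + n) ≤ (1 + n) ^ j * (1 + n) := by gcongr; linarith
        _ = (1 + (n : ℝ)) ^ (j + 1) := (pow_succ _ _).symm
        _ ≤ _ := pow_le_pow_right₀ hn (Finset.mem_range.1 hj)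
    calc ((sphere ℓ n).card : ℝ) * (1 + n) ≤ (_ + _) * (1 + n) :=
          mul_le_mul_of_nonneg_right h2 (by positivity)
      _ ≤ C * (1 + n) ^ ℓ + (∑ j ∈ Finset.range ℓ, ‖p j‖) * (1 + n) ^ ℓ := by
          rw [add_mul]
          refine add_le_add (h1.trans (le_mul_of_one_le_right hC0 (one_le_pow₀ hn))) h3
      _ = _ := by rw [← add_mul]
  -- Chosen so that `1 + (ℓ + 1) m ≤ (ℓ + 2) m` turns the two bounds into the contradiction `m ≤ K
  -- (ℓ + 2)^ℓ`.
  obtain ⟨m, hm⟩ := exists_nat_gt (K * (ℓ + 2) ^ ℓ)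
  have hm0 : 0 < (m : ℝ) := lt_of_le_of_lt (by positivity) hm
  have hm1 : (1 : ℝ) ≤ m := by
    have : 0 < m := by exact_mod_cast hm0
    exact_mod_cast this
  have h1 := key ((ℓ + 1) * m)
  have h2 : ((m : ℝ)) ^ ℓ ≤ (sphere ℓ ((ℓ + 1) * m)).card := by exact_mod_cast pow_le_card_sphere ℓ m
  have hℓ : (0 : ℝ) ≤ ℓ := by positivity
  push_cast at h1
  have h3 : (m : ℝ) ^ ℓ * m ≤ K * ((ℓ + 2) * m) ^ ℓ := by
    calc (m : ℝ) ^ ℓ * m ≤ (sphere ℓ ((ℓ + 1) * m)).card * (1 + (ℓ + 1) * m) := by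
          gcongr
          nlinarith
      _ ≤ _ := h1
      _ ≤ _ := by
          gcongr
          nlinarith
  rw [mul_pow, ← mul_assoc, mul_comm] at h3
  exact absurd (le_of_mul_le_mul_right h3 (by positivity)) (not_le.2 hm)

theorem mat_pTensor (T : Hil ℓ →L[ℂ] Hil ℓ) (i j : ℕ) (x y : Idx ℓ) :
    mat (pTensor T) (ic i x) (ic j y) = if i = 0 ∧ j = 0 then mat T x y else 0 := by
  have h := mat_corner 0 0 i j T x y
  rwa [pow_zero, pow_zero, one_mul, mul_one] at h

theorem IsSmooth.pTensor {T : Hil ℓ →L[ℂ] Hil ℓ} (hT : IsSmooth T) : IsSmooth (pTensor T) := by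
  refine isSmooth_of_smoothAt fun N => ?_
  obtain ⟨C, hC⟩ := hT.exists_smoothAt N
  have hC0 := hC.nonneg
  refine ⟨_, SmoothAt.glue (lam := 0) (B := 2 ^ N * C) (K := fun i j => if i = 0 ∧ j = 0 then C else 0)
    (a := fun i j => if i = 0 ∧ j = 0 then mat T else 0) (fun i j => ?_) (fun i j => ?_) (fun n => ?_)
    fun i j x y => ?_⟩
  · split_ifs
    · exact hC
    · refine ⟨?_, ?_, ?_, ?_⟩ <;> simp [RapidAt]
  · split_ifs with h
    · simp [h.1, h.2]
    · rw [mul_zero, mul_zero]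
      positivity
  · simp only [Pi.zero_apply, norm_zero, mul_zero]
    positivity
  · rw [mat_pTensor]
    split_ifs <;> simp

theorem natNrm_ic (i : ℕ) (x : Idx ℓ) : natNrm (ic i x) = i + natNrm x := by
  simp [natNrm, ic, Fin.sum_univ_succ, add_assoc]

theorem sphereSum_diagEntry_pTensor (T : Hil ℓ →L[ℂ] Hil ℓ) (n : ℕ) :
    sphereSum (diagEntry (pTensor T)) n = sphereSum (diagEntry T) n := by
  classical
  have hsub : (sphere ℓ n).image (ic 0) ⊆ sphere (ℓ + 1) n := by
    intro x hx
    obtain ⟨y, hy, rfl⟩ := Finset.mem_image.1 hx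
    rw [mem_sphere] at hy ⊢
    rw [natNrm_ic, hy, zero_add]
  rw [sphereSum, ← Finset.sum_subset hsub, Finset.sum_image (ic_injective 0).injOn]
  · refine Finset.sum_congr rfl fun x _ => ?_
    rw [diagEntry, mat_pTensor, if_pos ⟨rfl, rfl⟩]
    rfl
  · intro x hx hx'
    obtain ⟨i, y, rfl⟩ := exists_eq_ic x
    rw [diagEntry, mat_pTensor, if_neg]
    rintro ⟨rfl, -⟩
    refine hx' (Finset.mem_image.2 ⟨y, ?_, rfl⟩)
    rw [mem_sphere, natNrm_ic, zero_add] at hx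
    exact mem_sphere.2 hx

/-- The witness is `p₀ ⊗ ⋯ ⊗ p₀ ⊗ 1` with `ℓ - k` projections. Its diagonal is the indicator of a
face isometric to the index set of level `k`. -/
theorem exists_isSmooth_sphereSum {k ℓ : ℕ} (h : k ≤ ℓ) :
    ∃ T : Hil ℓ →L[ℂ] Hil ℓ, IsSmooth T ∧ ∀ n, sphereSum (diagEntry T) n = (sphere k n).card := by
  induction ℓ, h using Nat.le_induction with
  | base =>
    refine ⟨1, IsSmooth.one, fun n => ?_⟩
    simp [sphereSum, diagEntry, mat_one]
  | succ ℓ _ ih =>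
    obtain ⟨T, hT, hT'⟩ := ih
    exact ⟨pTensor T, hT.pTensor, fun n => by rw [sphereSum_diagEntry_pTensor, hT']⟩

theorem exists_pole {k ℓ : ℕ} (h : k ≤ ℓ) : ∃ T : Hil ℓ →L[ℂ] Hil ℓ, IsSmooth T ∧
    ∃ f, IsZetaContinuation (dirac ℓ) ((ℓ : ℝ) + 1) T f ∧ meromorphicOrderAt f ((k + 1 : ℕ) : ℂ) < 0 := by
  obtain ⟨T, hT, hT'⟩ := exists_isSmooth_sphereSum h
  obtain ⟨S, hS, hS'⟩ := exists_isSmooth_sphereSum (le_refl k)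
  -- The expansion is taken at level `k`, where it has only `k + 1` terms and `p k` is the leading
  -- coefficient, known not to vanish.
  obtain ⟨p, hp⟩ := hS.isAsympInvariant.exists_expansion
  simp only [hS'] at hp
  have hp' : RapidSeq fun n => sphereSum (diagEntry T) n - ∑ j ∈ Finset.range (k + 1), p j * (n : ℂ) ^ j := by
    simpa only [hT'] using hp
  exact ⟨T, hT, _, isZetaContinuation_zetaSum (by omega) hp',
    meromorphicOrderAt_zetaSum_neg hp' (by omega) (leading_coeff_card_sphere_ne_zero hp)⟩

end Poles

/-! ### The dimension spectrum and the main theorem -/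

theorem hasSimpleDimensionSpectrum (ℓ : ℕ) :
    HasSimpleDimensionSpectrum (smoothAlgebra ℓ) (dirac ℓ) ((ℓ : ℝ) + 1)
      {s : ℂ | ∃ k : ℕ, 1 ≤ k ∧ k ≤ ℓ + 1 ∧ s = (k : ℂ)} := by
  refine ⟨Set.Finite.isDiscrete ?_, fun b hb => ⟨fun z hz => isTraceClass_mul_absPow b hz, ?_⟩, ?_⟩
  · refine (Set.Finite.image (fun k : ℕ => (k : ℂ)) (Set.finite_le_nat (ℓ + 1))).subset ?_
    rintro _ ⟨k, -, hk, rfl⟩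
    exact ⟨k, hk, rfl⟩
  · obtain ⟨p, hp⟩ := (isAsympInvariant_of_mem_derivAlgebra (fun a ha => mem_smoothAlgebra_iff.1 ha)
      hb).exists_expansion
    exact ⟨_, isZetaContinuation_zetaSum le_rfl hp, fun s hs => meromorphicOrderAt_zetaSum hp hs⟩
  · rintro _ ⟨k, hk, hk', rfl⟩
    obtain ⟨k, rfl⟩ : ∃ j, k = j + 1 := ⟨k - 1, by omega⟩
    obtain ⟨T, hT, hf⟩ := exists_pole (k := k) (ℓ := ℓ) (by omega)
    exact ⟨T, Algebra.subset_adjoin ⟨T, mem_smoothAlgebra_iff.2 hT, 0, Or.inl rfl⟩, hf⟩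

end TorusTriple

end

theorem mainTheorem3 (ℓ : ℕ) :
    TorusTriple.IsSpectralTriple (TorusTriple.smoothAlgebra ℓ)
        (TorusTriple.diagOp (TorusTriple.dirac ℓ)) ∧
      TorusTriple.IsRegular (TorusTriple.smoothAlgebra ℓ) (TorusTriple.dirac ℓ) ∧
      TorusTriple.IsPlusSummable (TorusTriple.dirac ℓ) ((ℓ : ℝ) + 1) ∧
      TorusTriple.HasSimpleDimensionSpectrum (TorusTriple.smoothAlgebra ℓ) (TorusTriple.dirac ℓ)
        ((ℓ : ℝ) + 1) {s : ℂ | ∃ k : ℕ, 1 ≤ k ∧ k ≤ ℓ + 1 ∧ s = (k : ℂ)} := by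
  have h (a) (ha : a ∈ TorusTriple.smoothAlgebra ℓ) : TorusTriple.IsSmooth a :=
    TorusTriple.mem_smoothAlgebra_iff.1 ha
  exact ⟨⟨TorusTriple.exists_starSubalgebra ℓ, TorusTriple.isSelfAdjoint_diagOp _,
    TorusTriple.hasCompactResolvent_dirac ℓ, fun a ha => (h a ha).exists_isCommutator.imp fun _ hc => hc.1⟩,
    TorusTriple.isRegular_of_isSmooth h, TorusTriple.isPlusSummable_dirac ℓ,
    TorusTriple.hasSimpleDimensionSpectrum ℓ⟩
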